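/- **Setting.** For $s_0<s_1$, a *rescaled Prandtl solution* on $[s_0,s_1]$ is a triple $(U,b,U_\infty)$ with $U=U(s,Y)$ on $[s_0,s_1]\times[0,\infty)$, such that * $b\in C([s_0,s_1])$ is differentiable on $(s_0,s_1)$; $\partial_Y^kU$ ($k\le 4$) is continuous on $[s_0,s_1]\times[0,\infty)$; $\partial_s\partial_Y^kU$ ($k\le2$) exists and is continuous on $(s_0,s_1]\times[0,\infty)$; $U,U_Y,U_{YY}$ are bounded; and $U>0$ for $Y>0$; * for $s\in(s_0,s_1)$, $Y>0$, $$UU_s-U_Y\int_0^YU_s-bU^2+\frac{3b}{2}U_Y\int_0^YU-U_{YY}=-1;$$ * for all $s\in[s_0,s_1]$: $U(s,0)=0$, $U_Y(s,0)=1$, $\lim_{Y\to\infty}U(s,Y)=U_\infty(s)$, where $U_\infty$ is differentiable and $U_\infty U_\infty'-bU_\infty^2=-1$. Fix $\chi\in C^\infty([0,\infty))$ vanishing for large arguments with $\chi\equiv1$ near $0$, and $\Theta\in C^4([0,\infty))$ strictly increasing with $\Theta(\xi)=\xi^2/2$ near $0$ and $\Theta(\xi)\to1$ as $\xi\to\infty$.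 With $a_4=\frac1{48}$, $a_7=\frac{a_4}{84}$, $a_{10}=\frac{27}{16\cdot 90}a_7$, $a_{11}=\frac{3}{16\cdot110}a_7$, let $$U^{\rm app}(s,Y)=\chi\Big(\frac{Y}{s^{2/7}}\Big)\big[Y-a_4bY^4-a_7b^2Y^7-a_{10}b^3Y^{10}-a_{11}b^3Y^{11}\big]+\frac1b\Theta(\sqrt b\,Y),\qquad V=U-U^{\rm app},$$ $$\mathcal L_UV=U_Y\int_0^Y\frac{V_{YY}}{U^2}+\frac{V_{YY}}{U},\qquad E_1(s)=\int_0^\infty(\partial_Y^2\mathcal L_UV)^2\,Y^{-a}(1+s^{-\beta_1}Y)^{-m_1}\,dY\in[0,\infty].$$ **Proposition.** There exist universal constants $\bar M,\bar C>0$ such that the following holds. Let $\chi,\Theta$ be as above, $C_1>0$, $\beta_1\in(\frac14,\frac27)$, $m_1\in\mathbb N$. There exists $S_0>0$, depending only on $C_1,\beta_1,m_1$ (and on the fixed profiles $\chi,\Theta$), such that for all $a\in(0,1)$, $J>0$, $\eta>0$, $\epsilon\in(0,\frac12)$, $M_0\in\mathbb R$, all $s_0<s_1$ with $$s_0\ge\max\big(S_0,\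 \bar C(J\epsilon^{-2})^{1/(2\eta)}\big),$$ and every rescaled Prandtl solution $(U,b,U_\infty)$ on $[s_0,s_1]$ such that $U(s_0,\cdot)$ is nondecreasing and 1. $\displaystyle\int_{s_0}^{s_1}s^{3+2\eta}|b_s+b^2|^2\,ds\le J$, and $\displaystyle\frac{1-\epsilon}{s}\le b(s)\le\frac{1+\epsilon}{s}$ for all $s\in[s_0,s_1]$; 2. $-M_0\inf(1,s_0^{-1}Y^2)\le U_{YY}(s_0,Y)-1\le0$ for all $Y>0$, and $\lim_{Y\to\infty}U(s_0,Y)\le M_0s_0$; 3. $E_1(s)\le C_1s^{-13/4}$ for all $s\in[s_0,s_1]$, one has, with $M'=\bar M\max(1,M_0)$, $$-M'bY^2\le U_{YY}(s,Y)-1\le0\quad\forall s\in[s_0,s_1],\ \forall Y\in[0,s^{1/3}],$$ $$-M'\le U_{YY}(s,Y)-1\le0\quad\forall s\in[s_0,s_1],\ \forall Y\ge s^{1/3}.$$ -/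

import Mathlib

open Set Filter Topology MeasureTheory
open scoped ContDiff ENNReal

namespace Prandtl

noncomputable section

/-- The `k`-th derivative in the normal variable `Y ∈ [0, ∞)` (one-sided at `Y = 0`). -/
def dY (k : ℕ) (f : ℝ → ℝ) (Y : ℝ) : ℝ := iteratedDerivWithin k f (Ici 0) Y

/-- The derivative in the tangential variable `s ∈ (s₀, s₁]` (one-sided at `s = s₁`). -/
def dS (s₀ s₁ : ℝ) (f : ℝ → ℝ) (s : ℝ) : ℝ := derivWithin f (Ioc s₀ s₁) s

/-- Classical solutions `U`, with modulation rate `b` and outer velocity `Uinf`, of the rescaled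
stationary Prandtl equation
`U U_s - U_Y ∫₀^Y U_s - b U² + (3b/2) U_Y ∫₀^Y U - U_YY = -1`
on `[s₀, s₁] × [0, ∞)`, which are positive for `Y > 0`, with
`U = 0`, `U_Y = 1` at `Y = 0` and `U → Uinf` as `Y → ∞`. -/
structure IsRescaledSolution (s₀ s₁ : ℝ) (b : ℝ → ℝ) (U : ℝ → ℝ → ℝ) (Uinf : ℝ → ℝ) :
    Prop where
  /-- `b` is continuous on `[s₀, s₁]` and differentiable inside. -/
  b_continuousOn : ContinuousOn b (Icc s₀ s₁)
  b_differentiableOn : DifferentiableOn ℝ b (Ioo s₀ s₁)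
  /-- `U` has four derivatives in `Y`, jointly continuous up to the boundary. -/
  contDiffOn : ∀ s ∈ Icc s₀ s₁, ContDiffOn ℝ 4 (U s) (Ici 0)
  continuousOn_dY : ∀ k ≤ 4,
    ContinuousOn (fun p : ℝ × ℝ => dY k (U p.1) p.2) (Icc s₀ s₁ ×ˢ Ici 0)
  /-- `U`, `U_Y`, `U_YY` have a derivative in `s`, jointly continuous for `s > s₀`. -/
  differentiableOn_s : ∀ k ≤ 2, ∀ Y ∈ Ici (0 : ℝ),
    DifferentiableOn ℝ (fun s => dY k (U s) Y) (Ioc s₀ s₁)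
  continuousOn_dS : ∀ k ≤ 2,
    ContinuousOn (fun p : ℝ × ℝ => dS s₀ s₁ (fun s => dY k (U s) p.2) p.1) (Ioc s₀ s₁ ×ˢ Ici 0)
  /-- `U`, `U_Y`, `U_YY` are bounded. -/
  bounded : ∃ K : ℝ, ∀ k ≤ 2, ∀ s ∈ Icc s₀ s₁, ∀ Y ∈ Ici (0 : ℝ), |dY k (U s) Y| ≤ K
  pos : ∀ s ∈ Icc s₀ s₁, ∀ Y > 0, 0 < U s Y
  equation : ∀ s ∈ Ioo s₀ s₁, ∀ Y > 0,
    U s Y * dS s₀ s₁ (fun t => U t Y) s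
      - dY 1 (U s) Y * (∫ z in (0 : ℝ)..Y, dS s₀ s₁ (fun t => U t z) s)
      - b s * U s Y ^ 2
      + 3 * b s / 2 * dY 1 (U s) Y * (∫ z in (0 : ℝ)..Y, U s z)
      - dY 2 (U s) Y = -1
  zero : ∀ s ∈ Icc s₀ s₁, U s 0 = 0
  slope : ∀ s ∈ Icc s₀ s₁, dY 1 (U s) 0 = 1
  tendsto : ∀ s ∈ Icc s₀ s₁, Tendsto (U s) atTop (𝓝 (Uinf s))
  /-- Bernoulli's law for the outer flow: `Uinf Uinf' - b Uinf² = -1`. -/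
  outer_differentiableOn : DifferentiableOn ℝ Uinf (Icc s₀ s₁)
  outer : ∀ s ∈ Icc s₀ s₁, Uinf s * derivWithin Uinf (Icc s₀ s₁) s - b s * Uinf s ^ 2 = -1

/-- Smooth compactly supported functions on `[0, ∞)` equal to `1` near `0`. -/
structure IsCutoff (χ : ℝ → ℝ) : Prop where
  smooth : ContDiffOn ℝ ∞ χ (Ici 0)
  eq_one : ∃ r > 0, ∀ ξ ∈ Icc 0 r, χ ξ = 1
  eq_zero : ∃ R : ℝ, ∀ ξ ≥ R, χ ξ = 0

/-- Outer profiles: `Θ(ξ) = ξ²/2` near `0`, `Θ` strictly increasing with limit `1`; four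
derivatives are what the energy `E₁` below differentiates. -/
structure IsOuterProfile (Θ : ℝ → ℝ) : Prop where
  smooth : ContDiffOn ℝ 4 Θ (Ici 0)
  eq_sq : ∃ c > 0, ∀ ξ ∈ Icc 0 c, Θ ξ = ξ ^ 2 / 2
  strictMono : StrictMonoOn Θ (Ici 0)
  tendsto : Tendsto Θ atTop (𝓝 1)

def a₄ : ℝ := 1 / 48
def a₇ : ℝ := a₄ / 84
def a₁₀ : ℝ := 27 / (16 * 90) * a₇
def a₁₁ : ℝ := 3 / (16 * 110) * a₇

/-- The approximate solution at time `s`, where `β = b(s)` is the value of the modulation rate. -/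
def Uapp (χ Θ : ℝ → ℝ) (s β Y : ℝ) : ℝ :=
  χ (Y / s ^ (2 / 7 : ℝ)) *
      (Y - a₄ * β * Y ^ 4 - a₇ * β ^ 2 * Y ^ 7 - a₁₀ * β ^ 3 * Y ^ 10 - a₁₁ * β ^ 3 * Y ^ 11)
    + 1 / β * Θ (√β * Y)

/-- `L_U⁻¹ f = (U ∫₀^Y f / U²)_Y = U_Y ∫₀^Y f / U² + f / U`, the inverse of
`L_U g = U g - U_Y ∫₀^Y g`. -/
def Linv (U f : ℝ → ℝ) (Y : ℝ) : ℝ :=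
  dY 1 U Y * (∫ z in (0 : ℝ)..Y, f z / U z ^ 2) + f Y / U Y

/-- The diffusion operator `𝓛_U = L_U⁻¹ ∂_YY`. -/
def calL (U V : ℝ → ℝ) : ℝ → ℝ := Linv U (dY 2 V)

/-- The weight `w₁ = Y^{-a} (1 + s^{-β₁} Y)^{-m₁}`. -/
def w₁ (a β₁ : ℝ) (m₁ : ℕ) (s Y : ℝ) : ℝ :=
  Y ^ (-a) * ((1 + s ^ (-β₁) * Y) ^ m₁)⁻¹

/-- The energy `E₁(s) = ∫₀^∞ (∂_Y² 𝓛_U V)² w₁ dY ∈ [0, ∞]`, where `V = U - Uapp`. -/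
def E₁ (χ Θ : ℝ → ℝ) (a β₁ : ℝ) (m₁ : ℕ) (b : ℝ → ℝ) (U : ℝ → ℝ → ℝ) (s : ℝ) : ℝ≥0∞ :=
  ∫⁻ Y in Ioi (0 : ℝ), ENNReal.ofReal
    (dY 2 (calL (U s) (fun y => U s y - Uapp χ Θ s (b s) y)) Y ^ 2 * w₁ a β₁ m₁ s Y)

end

end Prandtl

/-! Write G = U_Y, F = U_YY, ψ = ∫₀^Y U and S = ∫₀^Y U_s. Combining the equation with its first two
Y-derivatives gives a parabolic equation for F (`parabolic_eq`): U F_s + F_Y (3bψ/2 - S + G/U) -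
F_YY = F (F - 1)/U. A maximum principle is available, but the equation degenerates at the wall and
involves the nonlocal velocity S. The half line is therefore cut at Y = 1: the energy controls [0,
1] and barriers control [1, ∞).

Near the wall. The energy bounds ∂_Y² of 𝓛_U V in a weighted L² space. Integrating twice from Y = 0
and undoing 𝓛_U gives F = 1 - bY²/4 + O(s^{-13/8} Y² (1 + Y)²) for Y ≤ s^{1/4}
(`exists_boundary_layer_estimate`). On [0, 1] this places 1 - F between bY²/8 and 3bY²/8.

Upper barriers. The transport part U ∂_s - S ∂_Y annihilates ψ, so small multiples of e^{Λs} (1 + ψ)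
handle infinity whatever S is. They give G ≥ 0 (`dY_one_nonneg`), then F ≤ 1 (`dY_two_le_one`).

Lower barrier. Inverting g ↦ U g - G ∫₀^Y g in the equation expresses S through ψ, U and ∫₀^Y (F -
1)/U². Since F ≤ 1 and U increases, that integral has a usable one-sided bound
(`integral_div_sq_le`). If g' = -bg, then contact of 1 - F with α + κgY² forces (α + κgY²)² ≤ α,
impossible for α = 0 or α ≥ 1 (`one_sub_dY_two_lt`). The choice α = 0 yields the quadratic bound,
and α = max(1, M₀) the uniform one.

Comparing g with b. At the fixed height L = r^{1/4}, for times in [r, 256r], the quantity U - L -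
L²/2 is close to -bL⁴/48, and its s-derivative is -b times itself up to O(r^{-9/8})
(`edge_estimates`). Hence b exp(∫b) has relative variation O(r^{-1/8}) on such a window. These
errors form a geometric series over successive windows, so b is comparable to g = b(s₀) exp(-∫b)
(`exists_comparison_rate`). -/

namespace Prandtl

/-! ### A first-touching argument -/

theorem nonpos_of_hasDerivAt_of_le_left {φ : ℝ → ℝ} {a s d : ℝ} (has : a < s)
    (hd : HasDerivAt φ d s) (h : ∀ r ∈ Ioo a s, φ s ≤ φ r) : d ≤ 0 := by
  have h1 : Tendsto (slope φ s) (𝓝[<] s) (𝓝 d) :=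
    (hasDerivAt_iff_tendsto_slope.1 hd).mono_left
      (nhdsWithin_mono _ fun x hx => (mem_Iio.1 hx).ne)
  refine le_of_tendsto h1 ?_
  filter_upwards [Ioo_mem_nhdsLT has] with r hr
  rw [slope_def_field]
  exact div_nonpos_of_nonneg_of_nonpos (sub_nonneg.2 (h r hr)) (sub_nonpos.2 hr.2.le)

/-- A negative second derivative would make the minimum a local maximum as well. The function would
then be locally constant, and its second derivative zero. -/
theorem nonneg_of_isLocalMin_of_hasDerivAt {f f' : ℝ → ℝ} {x f'' : ℝ} (hmin : IsLocalMin f x)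
    (hf : ∀ᶠ y in 𝓝 x, HasDerivAt f (f' y) y) (hf' : HasDerivAt f' f'' x) : 0 ≤ f'' := by
  by_contra! hneg
  have hev : deriv f =ᶠ[𝓝 x] f' := hf.mono fun y hy => hy.deriv
  have hdd : deriv (deriv f) x = f'' := by rw [hev.deriv_eq, hf'.deriv]
  have hmax : IsLocalMax f x :=
    isLocalMax_of_deriv_deriv_neg (by rw [hdd]; exact hneg) hmin.deriv_eq_zero
      hf.self_of_nhds.continuousAt
  have hconst : f =ᶠ[𝓝 x] fun _ => f x := by
    filter_upwards [hmin, hmax] with y h1 h2 using le_antisymm h2 h1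
  have h0 : deriv f =ᶠ[𝓝 x] fun _ => 0 := by
    have := hconst.deriv
    simpa using this
  have : deriv (deriv f) x = 0 := by rw [h0.deriv_eq]; simp
  rw [hdd] at this
  exact hneg.ne this

/-- If a function which is positive on the parabolic boundary of `[s₀, t] × [c, ∞)` and near
infinity never touches zero from above inside, it is positive. -/
theorem pos_of_no_touching {φ φs φY φYY : ℝ → ℝ → ℝ} {s₀ t c R : ℝ}
    (hcont : ContinuousOn (fun p : ℝ × ℝ => φ p.1 p.2) (Icc s₀ t ×ˢ Ici c))
    (hinf : ∀ s ∈ Icc s₀ t, ∀ Y ≥ c, R ≤ Y → 0 < φ s Y)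
    (hinit : ∀ Y ≥ c, 0 < φ s₀ Y)
    (hbdry : ∀ s ∈ Icc s₀ t, 0 < φ s c)
    (hs : ∀ s ∈ Ioc s₀ t, ∀ Y > c, HasDerivAt (fun r => φ r Y) (φs s Y) s)
    (hY : ∀ s ∈ Ioc s₀ t, ∀ Y > c, HasDerivAt (φ s) (φY s Y) Y)
    (hYY : ∀ s ∈ Ioc s₀ t, ∀ Y > c, HasDerivAt (φY s) (φYY s Y) Y)
    (htouch : ∀ s ∈ Ioc s₀ t, ∀ Y > c, φ s Y = 0 → φs s Y ≤ 0 → φY s Y = 0 → 0 ≤ φYY s Y → False) :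
    ∀ s ∈ Icc s₀ t, ∀ Y ≥ c, 0 < φ s Y := by
  by_contra! hneg
  obtain ⟨s₁, hs₁, Y₁, hY₁, hle⟩ := hneg
  -- Contact can only occur for Y ≤ R, so this set is compact and contains a point with least s. At
  -- that time φ is nonnegative as a limit of positive values, so the contact point is a spatial
  -- minimum.
  set Z : Set (ℝ × ℝ) := {p ∈ Icc s₀ t ×ˢ Icc c R | φ p.1 p.2 ≤ 0} with hZ
  have hsub : Icc s₀ t ×ˢ Icc c R ⊆ Icc s₀ t ×ˢ Ici c :=
    prod_mono le_rfl Icc_subset_Ici_self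
  have hZc : IsCompact Z := by
    have h1 : IsClosed Z := by
      have := (hcont.mono hsub).preimage_isClosed_of_isClosed
        (isClosed_Icc.prod isClosed_Icc) (isClosed_Iic (a := (0 : ℝ)))
      exact this
    exact (isCompact_Icc.prod isCompact_Icc).of_isClosed_subset h1 (sep_subset _ _)
  have hmemZ : ∀ s ∈ Icc s₀ t, ∀ Y ≥ c, φ s Y ≤ 0 → (s, Y) ∈ Z := by
    intro s hs Y hY hle
    refine ⟨⟨hs, hY, ?_⟩, hle⟩
    by_contra! hR
    exact absurd (hinf s hs Y hY hR.le) (not_lt.2 hle)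
  obtain ⟨⟨s, Y⟩, hp, hmin⟩ := hZc.exists_isMinOn ⟨_, hmemZ s₁ hs₁ Y₁ hY₁ hle⟩
    continuous_fst.continuousOn
  obtain ⟨⟨hsI, hYI⟩, hφ⟩ := hp
  simp only at hsI hYI hφ
  have hlt : ∀ r ∈ Icc s₀ t, r < s → ∀ y ≥ c, 0 < φ r y := by
    intro r hr hrs y hy
    by_contra! hle'
    exact absurd (hmin (hmemZ r hr y hy hle')) (not_le.2 hrs)
  have hs0 : s₀ < s := by
    rcases hsI.1.eq_or_lt with h | h
    · subst h; exact absurd (hinit Y hYI.1) (not_lt.2 hφ)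
    · exact h
  have hcY : c < Y := by
    rcases hYI.1.eq_or_lt with h | h
    · subst h; exact absurd (hbdry s hsI) (not_lt.2 hφ)
    · exact h
  have hnn : ∀ y ≥ c, 0 ≤ φ s y := by
    intro y hy
    have h1 : ContinuousWithinAt (fun r => φ r y) (Icc s₀ t) s :=
      (hcont (s, y) ⟨hsI, hy⟩).comp (f := fun r => (r, y))
        (by fun_prop) (fun r hr => ⟨hr, hy⟩)
    have h2 : Tendsto (fun r => φ r y) (𝓝[Ioo s₀ s] s) (𝓝 (φ s y)) :=
      h1.mono_left (nhdsWithin_mono _ fun r hr => ⟨hr.1.le, hr.2.le.trans hsI.2⟩)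
    have : (𝓝[Ioo s₀ s] s).NeBot := by
      rw [nhdsWithin_Ioo_eq_nhdsLT hs0]; infer_instance
    refine ge_of_tendsto h2 ?_
    filter_upwards [self_mem_nhdsWithin] with r hr
    exact (hlt r ⟨hr.1.le, hr.2.le.trans hsI.2⟩ hr.2 y hy).le
  have hzero : φ s Y = 0 := le_antisymm hφ (hnn Y hcY.le)
  have hloc : IsLocalMin (φ s) Y := by
    filter_upwards [Ioi_mem_nhds hcY] with y hy
    rw [hzero]; exact hnn y (le_of_lt hy)
  have hsI' : s ∈ Ioc s₀ t := ⟨hs0, hsI.2⟩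
  refine htouch s hsI' Y hcY hzero ?_ (hloc.hasDerivAt_eq_zero (hY s hsI' Y hcY)) ?_
  · refine nonpos_of_hasDerivAt_of_le_left hs0 (hs s hsI' Y hcY) fun r hr => ?_
    rw [hzero]
    exact (hlt r ⟨hr.1.le, hr.2.le.trans hsI.2⟩ hr.2 Y hcY.le).le
  · refine nonneg_of_isLocalMin_of_hasDerivAt hloc ?_ (hYY s hsI' Y hcY)
    filter_upwards [Ioi_mem_nhds hcY] with y hy using hY s hsI' y hy

/-! ### Differentiation under the integral sign -/

theorem hasDerivAt_intervalIntegral_param {f fs : ℝ → ℝ → ℝ} {a b Y : ℝ} (hY : 0 ≤ Y)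
    (hf : ∀ s ∈ Ioo a b, ContinuousOn (f s) (Ici 0))
    (hd : ∀ s ∈ Ioo a b, ∀ y ≥ 0, HasDerivAt (fun t => f t y) (fs s y) s)
    (hc : ContinuousOn (fun p : ℝ × ℝ => fs p.1 p.2) (Ioo a b ×ˢ Ici 0)) {s : ℝ}
    (hs : s ∈ Ioo a b) :
    HasDerivAt (fun t => ∫ z in (0 : ℝ)..Y, f t z) (∫ z in (0 : ℝ)..Y, fs s z) s := by
  obtain ⟨c, hac, hcs⟩ := exists_between hs.1
  obtain ⟨d, hsd, hdb⟩ := exists_between hs.2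
  have hsub : Icc c d ⊆ Ioo a b := fun x hx => ⟨hac.trans_le hx.1, hx.2.trans_lt hdb⟩
  have huI : uIoc 0 Y ⊆ Icc 0 Y := by
    rw [uIoc_of_le hY]; exact Ioc_subset_Icc_self
  have hfm : ∀ r ∈ Ioo a b, AEStronglyMeasurable (f r) (volume.restrict (uIoc 0 Y)) := fun r hr =>
    (((hf r hr).mono fun x hx => (huI hx).1)).aestronglyMeasurable measurableSet_uIoc
  have hfsc : ContinuousOn (fs s) (Ici 0) :=
    hc.comp (f := fun y => (s, y)) (by fun_prop) fun y hy => ⟨hs, hy⟩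
  obtain ⟨C, hC⟩ := ((isCompact_Icc (a := c) (b := d)).prod
    (isCompact_Icc (a := (0 : ℝ)) (b := Y))).exists_bound_of_continuousOn
    (hc.mono (prod_mono hsub Icc_subset_Ici_self))
  refine (intervalIntegral.hasDerivAt_integral_of_dominated_loc_of_deriv_le (F := f) (F' := fs)
    (bound := fun _ => C) (Icc_mem_nhds hcs hsd) ?_ ?_ ?_ ?_ ?_ ?_).2
  · filter_upwards [Icc_mem_nhds hcs hsd] with r hr using hfm r (hsub hr)
  · exact ((hf s hs).mono (by rw [uIcc_of_le hY]; exact Icc_subset_Ici_self)).intervalIntegrable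
  · exact (hfsc.mono fun x hx => (huI hx).1).aestronglyMeasurable measurableSet_uIoc
  · exact Eventually.of_forall fun z hz r hr => hC (r, z) ⟨hr, huI hz⟩
  · exact intervalIntegrable_const
  · exact Eventually.of_forall fun z hz r hr => hd r (hsub hr) z (huI hz).1

/-- Mixed partial derivatives agree when one of them is jointly continuous. -/
theorem hasDerivAt_mixed {f fY fs fYs : ℝ → ℝ → ℝ} {a b : ℝ}
    (hfY : ∀ s ∈ Ioo a b, ∀ y ≥ 0, HasDerivWithinAt (f s) (fY s y) (Ici 0) y)
    (hfYc : ∀ s ∈ Ioo a b, ContinuousOn (fY s) (Ici 0))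
    (hd : ∀ s ∈ Ioo a b, ∀ y ≥ 0, HasDerivAt (fun t => f t y) (fs s y) s)
    (hdY : ∀ s ∈ Ioo a b, ∀ y ≥ 0, HasDerivAt (fun t => fY t y) (fYs s y) s)
    (hc : ContinuousOn (fun p : ℝ × ℝ => fYs p.1 p.2) (Ioo a b ×ˢ Ici 0)) {s Y : ℝ}
    (hs : s ∈ Ioo a b) (hY : 0 < Y) :
    HasDerivAt (fs s) (fYs s Y) Y := by
  -- Differentiating this formula in s under the integral exhibits `fs s` as a primitive of `fYs s`.
  have hint : ∀ r ∈ Ioo a b, ∀ y ≥ 0, f r y = f r 0 + ∫ z in (0 : ℝ)..y, fY r z := by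
    intro r hr y hy
    have hcf : ContinuousOn (f r) (Icc 0 y) := fun z hz =>
      ((hfY r hr z hz.1).continuousWithinAt).mono Icc_subset_Ici_self
    rw [intervalIntegral.integral_eq_sub_of_hasDerivAt_of_le hy hcf
      (fun z hz => (hfY r hr z hz.1.le).hasDerivAt (Ici_mem_nhds hz.1))
      (((hfYc r hr).mono (by rw [uIcc_of_le hy]; exact Icc_subset_Ici_self)).intervalIntegrable)]
    ring
  have hfs : ∀ y ≥ 0, fs s y = fs s 0 + ∫ z in (0 : ℝ)..y, fYs s z := by
    intro y hy
    have h1 := (hd s hs 0 le_rfl).add (hasDerivAt_intervalIntegral_param hy hfYc hdY hc hs)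
    refine (hd s hs y hy).unique (h1.congr_of_eventuallyEq ?_)
    filter_upwards [Ioo_mem_nhds hs.1 hs.2] with r hr using hint r hr y hy
  have hcs : ContinuousOn (fYs s) (Ici 0) :=
    hc.comp (f := fun y => (s, y)) (by fun_prop) fun y hy => ⟨hs, hy⟩
  have h2 : HasDerivAt (fun y => ∫ z in (0 : ℝ)..y, fYs s z) (fYs s Y) Y :=
    intervalIntegral.integral_hasDerivAt_right
      ((hcs.mono (by rw [uIcc_of_le hY.le]; exact Icc_subset_Ici_self)).intervalIntegrable)
      ((hcs.mono Ioi_subset_Ici_self).stronglyMeasurableAtFilter isOpen_Ioi Y hY)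
      (hcs.continuousAt (Ici_mem_nhds hY))
  refine (h2.const_add (fs s 0)).congr_of_eventuallyEq ?_
  filter_upwards [Ioi_mem_nhds hY] with y hy using hfs y (le_of_lt hy)

theorem hasDerivAt_integral_Ici {f : ℝ → ℝ} (hf : ContinuousOn f (Ici 0)) {Y : ℝ} (hY : 0 < Y) :
    HasDerivAt (fun y => ∫ z in (0 : ℝ)..y, f z) (f Y) Y :=
  intervalIntegral.integral_hasDerivAt_right
    ((hf.mono (by rw [uIcc_of_le hY.le]; exact Icc_subset_Ici_self)).intervalIntegrable)
    ((hf.mono Ioi_subset_Ici_self).stronglyMeasurableAtFilter isOpen_Ioi Y hY)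
    (hf.continuousAt (Ici_mem_nhds hY))

theorem continuousOn_integral_Ici {f : ℝ → ℝ} (hf : ContinuousOn f (Ici 0)) :
    ContinuousOn (fun y => ∫ z in (0 : ℝ)..y, f z) (Ici 0) := by
  intro Y hY
  have hY' : (0 : ℝ) ≤ Y := hY
  have h := intervalIntegral.continuousOn_primitive_interval (μ := volume) (a := 0) (b := Y + 1)
    (f := f) ((hf.mono (by
      rw [uIcc_of_le (by linarith)]; exact Icc_subset_Ici_self)).integrableOn_compact isCompact_uIcc)
  rw [uIcc_of_le (by linarith)] at h
  refine (h Y ⟨hY', by linarith⟩).mono_of_mem_nhdsWithin ?_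
  rw [← Ici_inter_Iic]
  exact inter_mem self_mem_nhdsWithin (mem_nhdsWithin_of_mem_nhds (Iic_mem_nhds (by linarith)))

/-! ### Normal derivatives on the half line -/

theorem dY_zero (f : ℝ → ℝ) : dY 0 f = f := by
  funext Y; simp [dY]

theorem hasDerivWithinAt_dY {f : ℝ → ℝ} (hf : ContDiffOn ℝ 4 f (Ici 0)) {k : ℕ} (hk : k < 4)
    {Y : ℝ} (hY : 0 ≤ Y) : HasDerivWithinAt (dY k f) (dY (k + 1) f Y) (Ici 0) Y := by
  have h := (hf.differentiableOn_iteratedDerivWithin (m := k) (by exact_mod_cast hk)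
    (uniqueDiffOn_Ici 0)) Y hY
  have h2 := h.hasDerivWithinAt
  rw [← iteratedDerivWithin_succ] at h2
  exact h2

theorem hasDerivAt_dY {f : ℝ → ℝ} (hf : ContDiffOn ℝ 4 f (Ici 0)) {k : ℕ} (hk : k < 4)
    {Y : ℝ} (hY : 0 < Y) : HasDerivAt (dY k f) (dY (k + 1) f Y) Y :=
  (hasDerivWithinAt_dY hf hk hY.le).hasDerivAt (Ici_mem_nhds hY)

theorem continuousOn_dY_of_contDiffOn {f : ℝ → ℝ} (hf : ContDiffOn ℝ 4 f (Ici 0)) {k : ℕ} (hk : k ≤ 4) :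
    ContinuousOn (dY k f) (Ici 0) :=
  hf.continuousOn_iteratedDerivWithin (by exact_mod_cast hk) (uniqueDiffOn_Ici 0)

end Prandtl

namespace Prandtl

/-! ### Differential identities for rescaled solutions -/

/-- The mixed derivative `∂_s ∂_Y^k U`. -/
noncomputable def dSY (s₀ s₁ : ℝ) (U : ℝ → ℝ → ℝ) (k : ℕ) (s Y : ℝ) : ℝ :=
  dS s₀ s₁ (fun t => dY k (U t) Y) s

/-- The stream function `∫₀^Y U`. -/
noncomputable def stream (U : ℝ → ℝ → ℝ) (s Y : ℝ) : ℝ := ∫ z in (0 : ℝ)..Y, U s z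

theorem stream_zero (U : ℝ → ℝ → ℝ) (s : ℝ) : stream U s 0 = 0 :=
  intervalIntegral.integral_same

theorem dSY_zero (s₀ s₁ : ℝ) (U : ℝ → ℝ → ℝ) (s Y : ℝ) :
    dSY s₀ s₁ U 0 s Y = dS s₀ s₁ (fun t => U t Y) s := by
  simp only [dSY, dY_zero]

namespace IsRescaledSolution

variable {s₀ s₁ : ℝ} {b : ℝ → ℝ} {U : ℝ → ℝ → ℝ} {Uinf : ℝ → ℝ}

theorem continuousOn_U (h : IsRescaledSolution s₀ s₁ b U Uinf) {s : ℝ} (hs : s ∈ Icc s₀ s₁) :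
    ContinuousOn (U s) (Ici 0) := (h.contDiffOn s hs).continuousOn

theorem hasDerivAt_U (h : IsRescaledSolution s₀ s₁ b U Uinf) {s : ℝ} (hs : s ∈ Icc s₀ s₁) {Y : ℝ}
    (hY : 0 < Y) : HasDerivAt (U s) (dY 1 (U s) Y) Y := by
  have := hasDerivAt_dY (h.contDiffOn s hs) (k := 0) (by norm_num) hY
  rwa [dY_zero] at this

theorem hasDerivAt_s (h : IsRescaledSolution s₀ s₁ b U Uinf) {k : ℕ} (hk : k ≤ 2) {s : ℝ}
    (hs : s ∈ Ioo s₀ s₁) {Y : ℝ} (hY : 0 ≤ Y) :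
    HasDerivAt (fun t => dY k (U t) Y) (dSY s₀ s₁ U k s Y) s :=
  (h.differentiableOn_s k hk Y hY s ⟨hs.1, hs.2.le⟩).hasDerivWithinAt.hasDerivAt
    (Ioc_mem_nhds hs.1 hs.2)

theorem hasDerivAt_U_s (h : IsRescaledSolution s₀ s₁ b U Uinf) {s : ℝ}
    (hs : s ∈ Ioo s₀ s₁) {Y : ℝ} (hY : 0 ≤ Y) :
    HasDerivAt (fun t => U t Y) (dSY s₀ s₁ U 0 s Y) s := by
  have := h.hasDerivAt_s (k := 0) (by norm_num) hs hY
  simpa only [dY_zero] using this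

theorem continuousOn_dSY (h : IsRescaledSolution s₀ s₁ b U Uinf) {k : ℕ} (hk : k ≤ 2) :
    ContinuousOn (fun p : ℝ × ℝ => dSY s₀ s₁ U k p.1 p.2) (Ioo s₀ s₁ ×ˢ Ici 0) :=
  (h.continuousOn_dS k hk).mono (prod_mono Ioo_subset_Ioc_self le_rfl)

theorem continuousOn_dSY_right (h : IsRescaledSolution s₀ s₁ b U Uinf) {k : ℕ} (hk : k ≤ 2)
    {s : ℝ} (hs : s ∈ Ioo s₀ s₁) : ContinuousOn (dSY s₀ s₁ U k s) (Ici 0) :=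
  (h.continuousOn_dSY hk).comp (f := fun y => (s, y)) (by fun_prop) fun _ hy => ⟨hs, hy⟩

theorem hasDerivAt_dSY (h : IsRescaledSolution s₀ s₁ b U Uinf) {k : ℕ} (hk : k ≤ 1) {s : ℝ}
    (hs : s ∈ Ioo s₀ s₁) {Y : ℝ} (hY : 0 < Y) :
    HasDerivAt (dSY s₀ s₁ U k s) (dSY s₀ s₁ U (k + 1) s Y) Y :=
  hasDerivAt_mixed (f := fun s => dY k (U s)) (fY := fun s => dY (k + 1) (U s))
    (fun r hr _ hy => hasDerivWithinAt_dY (h.contDiffOn r (Ioo_subset_Icc_self hr)) (by omega) hy)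
    (fun r hr => continuousOn_dY_of_contDiffOn (h.contDiffOn r (Ioo_subset_Icc_self hr)) (by omega))
    (fun _ hr _ hy => h.hasDerivAt_s (by omega) hr hy)
    (fun _ hr _ hy => h.hasDerivAt_s (by omega) hr hy)
    (h.continuousOn_dSY (by omega)) hs hY

theorem hasDerivAt_stream (h : IsRescaledSolution s₀ s₁ b U Uinf) {s : ℝ} (hs : s ∈ Icc s₀ s₁)
    {Y : ℝ} (hY : 0 < Y) : HasDerivAt (stream U s) (U s Y) Y :=
  hasDerivAt_integral_Ici (h.continuousOn_U hs) hY

theorem hasDerivAt_stream_s (h : IsRescaledSolution s₀ s₁ b U Uinf) {s : ℝ} (hs : s ∈ Ioo s₀ s₁)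
    {Y : ℝ} (hY : 0 ≤ Y) :
    HasDerivAt (fun t => stream U t Y) (stream (dSY s₀ s₁ U 0) s Y) s :=
  hasDerivAt_intervalIntegral_param hY (fun _ hr => h.continuousOn_U (Ioo_subset_Icc_self hr))
    (fun _ hr _ hy => h.hasDerivAt_U_s hr hy) (h.continuousOn_dSY (by norm_num)) hs

theorem hasDerivAt_stream_dSY (h : IsRescaledSolution s₀ s₁ b U Uinf) {s : ℝ}
    (hs : s ∈ Ioo s₀ s₁) {Y : ℝ} (hY : 0 < Y) :
    HasDerivAt (stream (dSY s₀ s₁ U 0) s) (dSY s₀ s₁ U 0 s Y) Y :=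
  hasDerivAt_integral_Ici (h.continuousOn_dSY_right (by norm_num) hs) hY

theorem dSY_zero_at_zero (h : IsRescaledSolution s₀ s₁ b U Uinf) {s : ℝ} (hs : s ∈ Ioo s₀ s₁) :
    dSY s₀ s₁ U 0 s 0 = 0 := by
  refine (h.hasDerivAt_U_s hs le_rfl).unique ((hasDerivAt_const s (0 : ℝ)).congr_of_eventuallyEq ?_)
  filter_upwards [Icc_mem_nhds hs.1 hs.2] with r hr using h.zero r hr

theorem dSY_one_at_zero (h : IsRescaledSolution s₀ s₁ b U Uinf) {s : ℝ} (hs : s ∈ Ioo s₀ s₁) :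
    dSY s₀ s₁ U 1 s 0 = 0 := by
  refine (h.hasDerivAt_s (k := 1) (by norm_num) hs le_rfl).unique
    ((hasDerivAt_const s (1 : ℝ)).congr_of_eventuallyEq ?_)
  filter_upwards [Icc_mem_nhds hs.1 hs.2] with r hr using h.slope r hr

theorem dY_two_eq (h : IsRescaledSolution s₀ s₁ b U Uinf) {s : ℝ} (hs : s ∈ Ioo s₀ s₁) {Y : ℝ}
    (hY : 0 < Y) :
    dY 2 (U s) Y = U s Y * dSY s₀ s₁ U 0 s Y - dY 1 (U s) Y * stream (dSY s₀ s₁ U 0) s Y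
      - b s * U s Y ^ 2 + 3 * b s / 2 * dY 1 (U s) Y * stream U s Y + 1 := by
  have h1 := h.equation s hs Y hY
  have h2 : stream (dSY s₀ s₁ U 0) s Y = ∫ z in (0 : ℝ)..Y, dS s₀ s₁ (fun t => U t z) s := by
    simp only [stream, dSY_zero]
  rw [h2, dSY_zero, stream]
  linarith

theorem dY_three_eq (h : IsRescaledSolution s₀ s₁ b U Uinf) {s : ℝ} (hs : s ∈ Ioo s₀ s₁) {Y : ℝ}
    (hY : 0 < Y) :
    dY 3 (U s) Y = U s Y * dSY s₀ s₁ U 1 s Y - dY 2 (U s) Y * stream (dSY s₀ s₁ U 0) s Y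
      - b s / 2 * U s Y * dY 1 (U s) Y + 3 * b s / 2 * dY 2 (U s) Y * stream U s Y := by
  have hs' := Ioo_subset_Icc_self hs
  have hU := h.hasDerivAt_U hs' hY
  have hG := hasDerivAt_dY (h.contDiffOn s hs') (k := 1) (by norm_num) hY
  have hF := hasDerivAt_dY (h.contDiffOn s hs') (k := 2) (by norm_num) hY
  have hUs := h.hasDerivAt_dSY (k := 0) (by norm_num) hs hY
  have hS := h.hasDerivAt_stream_dSY hs hY
  have hψ := h.hasDerivAt_stream hs' hY
  have hR := ((((hU.mul hUs).sub (hG.mul hS)).sub ((hU.pow 2).const_mul (b s))).add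
    ((hG.const_mul (3 * b s / 2)).mul hψ)).add_const 1
  refine (hF.unique (hR.congr_of_eventuallyEq ?_)).trans ?_
  · filter_upwards [Ioi_mem_nhds hY] with y hy using h.dY_two_eq hs hy
  norm_num
  ring

theorem dY_four_eq (h : IsRescaledSolution s₀ s₁ b U Uinf) {s : ℝ} (hs : s ∈ Ioo s₀ s₁) {Y : ℝ}
    (hY : 0 < Y) :
    dY 4 (U s) Y = dY 1 (U s) Y * dSY s₀ s₁ U 1 s Y + U s Y * dSY s₀ s₁ U 2 s Y
      - dY 3 (U s) Y * stream (dSY s₀ s₁ U 0) s Y - dY 2 (U s) Y * dSY s₀ s₁ U 0 s Y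
      - b s / 2 * (dY 1 (U s) Y ^ 2 + U s Y * dY 2 (U s) Y)
      + 3 * b s / 2 * (dY 3 (U s) Y * stream U s Y + dY 2 (U s) Y * U s Y) := by
  have hs' := Ioo_subset_Icc_self hs
  have hU := h.hasDerivAt_U hs' hY
  have hG := hasDerivAt_dY (h.contDiffOn s hs') (k := 1) (by norm_num) hY
  have hF := hasDerivAt_dY (h.contDiffOn s hs') (k := 2) (by norm_num) hY
  have hF3 := hasDerivAt_dY (h.contDiffOn s hs') (k := 3) (by norm_num) hY
  have hGs := h.hasDerivAt_dSY (k := 1) (by norm_num) hs hY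
  have hS := h.hasDerivAt_stream_dSY hs hY
  have hψ := h.hasDerivAt_stream hs' hY
  have hR := (((hU.mul hGs).sub (hF.mul hS)).sub ((hU.const_mul (b s / 2)).mul hG)).add
    ((hF.const_mul (3 * b s / 2)).mul hψ)
  refine (hF3.unique (hR.congr_of_eventuallyEq ?_)).trans ?_
  · filter_upwards [Ioi_mem_nhds hY] with y hy using h.dY_three_eq hs hy
  norm_num
  ring

/-- The parabolic equation satisfied by `U_YY - 1`. -/
theorem parabolic_eq (h : IsRescaledSolution s₀ s₁ b U Uinf) {s : ℝ} (hs : s ∈ Ioo s₀ s₁) {Y : ℝ}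
    (hY : 0 < Y) :
    U s Y * dSY s₀ s₁ U 2 s Y
      + dY 3 (U s) Y * (3 * b s / 2 * stream U s Y - stream (dSY s₀ s₁ U 0) s Y
        + dY 1 (U s) Y / U s Y) - dY 4 (U s) Y
      = (dY 2 (U s) Y - 1) * dY 2 (U s) Y / U s Y := by
  have hpos := (h.pos s (Ioo_subset_Icc_self hs) Y hY).ne'
  have h2 := h.dY_two_eq hs hY
  have h3 := h.dY_three_eq hs hY
  have h4 := h.dY_four_eq hs hY
  field_simp
  -- This combination cancels U_s and ∂_s U_Y, and leaves the nonlocal term only as a coefficient of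
  -- F_Y.
  linear_combination (-2 * U s Y) * h4 + 2 * dY 1 (U s) Y * h3 - 2 * dY 2 (U s) Y * h2

theorem tendsto_dY_zero (h : IsRescaledSolution s₀ s₁ b U Uinf) {s : ℝ} (hs : s ∈ Icc s₀ s₁)
    {k : ℕ} (hk : k ≤ 4) : Tendsto (dY k (U s)) (𝓝[>] 0) (𝓝 (dY k (U s) 0)) :=
  ((continuousOn_dY_of_contDiffOn (h.contDiffOn s hs) hk) 0 self_mem_Ici).mono_left
    (nhdsWithin_mono _ Ioi_subset_Ici_self)

/-- U and U_Y do not depend on s at the wall, so their s-derivatives vanish there. The equation and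
its two Y-derivatives, continued to Y = 0, then give the values. The last one matches the Y⁴
coefficient of the approximate solution. -/
theorem boundary_values_of_mem_Ioo (h : IsRescaledSolution s₀ s₁ b U Uinf) {s : ℝ}
    (hs : s ∈ Ioo s₀ s₁) :
    dY 2 (U s) 0 = 1 ∧ dY 3 (U s) 0 = 0 ∧ dY 4 (U s) 0 = -(b s / 2) := by
  have hs' := Ioo_subset_Icc_self hs
  have T : ∀ {f : ℝ → ℝ}, ContinuousOn f (Ici 0) → Tendsto f (𝓝[>] 0) (𝓝 (f 0)) := fun hf =>
    (hf 0 self_mem_Ici).mono_left (nhdsWithin_mono _ Ioi_subset_Ici_self)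
  have tU : Tendsto (U s) (𝓝[>] 0) (𝓝 0) := by
    have := T (h.continuousOn_U hs'); rwa [h.zero s hs'] at this
  have tG : Tendsto (dY 1 (U s)) (𝓝[>] 0) (𝓝 1) := by
    have := h.tendsto_dY_zero hs' (k := 1) (by norm_num); rwa [h.slope s hs'] at this
  have tUs : Tendsto (dSY s₀ s₁ U 0 s) (𝓝[>] 0) (𝓝 0) := by
    have := T (h.continuousOn_dSY_right (k := 0) (by norm_num) hs)
    rwa [h.dSY_zero_at_zero hs] at this
  have tGs : Tendsto (dSY s₀ s₁ U 1 s) (𝓝[>] 0) (𝓝 0) := by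
    have := T (h.continuousOn_dSY_right (k := 1) (by norm_num) hs)
    rwa [h.dSY_one_at_zero hs] at this
  have tFs := T (h.continuousOn_dSY_right (k := 2) (by norm_num) hs)
  have tψ : Tendsto (stream U s) (𝓝[>] 0) (𝓝 0) := by
    have : Tendsto (stream U s) (𝓝[>] 0) (𝓝 (stream U s 0)) :=
      T (continuousOn_integral_Ici (h.continuousOn_U hs'))
    rwa [stream_zero] at this
  have tS : Tendsto (stream (dSY s₀ s₁ U 0) s) (𝓝[>] 0) (𝓝 0) := by
    have : Tendsto (stream (dSY s₀ s₁ U 0) s) (𝓝[>] 0) (𝓝 (stream (dSY s₀ s₁ U 0) s 0)) :=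
      T (continuousOn_integral_Ici (h.continuousOn_dSY_right (k := 0) (by norm_num) hs))
    rwa [stream_zero] at this
  have t2 := h.tendsto_dY_zero hs' (k := 2) (by norm_num)
  have t3 := h.tendsto_dY_zero hs' (k := 3) (by norm_num)
  have t4 := h.tendsto_dY_zero hs' (k := 4) (by norm_num)
  have e2 : dY 2 (U s) 0 = 1 := by
    have hR := ((((tU.mul tUs).sub (tG.mul tS)).sub ((tU.pow 2).const_mul (b s))).add
      ((tG.const_mul (3 * b s / 2)).mul tψ)).add_const 1
    have := tendsto_nhds_unique (t2.congr' (by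
      filter_upwards [self_mem_nhdsWithin] with y hy using h.dY_two_eq hs hy)) hR
    rw [this]; ring
  have e3 : dY 3 (U s) 0 = 0 := by
    have hR := (((tU.mul tGs).sub (t2.mul tS)).sub ((tU.const_mul (b s / 2)).mul tG)).add
      ((t2.const_mul (3 * b s / 2)).mul tψ)
    have := tendsto_nhds_unique (t3.congr' (by
      filter_upwards [self_mem_nhdsWithin] with y hy using h.dY_three_eq hs hy)) hR
    rw [this]; ring
  refine ⟨e2, e3, ?_⟩
  have hR := (((((tG.mul tGs).add (tU.mul tFs)).sub (t3.mul tS)).sub (t2.mul tUs)).sub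
    (((tG.pow 2).add (tU.mul t2)).const_mul (b s / 2))).add
    (((t3.mul tψ).add (t2.mul tU)).const_mul (3 * b s / 2))
  have := tendsto_nhds_unique (t4.congr' (by
    filter_upwards [self_mem_nhdsWithin] with y hy using h.dY_four_eq hs hy)) hR
  rw [this]; ring

theorem continuousOn_dY_left (h : IsRescaledSolution s₀ s₁ b U Uinf) {k : ℕ} (hk : k ≤ 4) {Y : ℝ}
    (hY : 0 ≤ Y) : ContinuousOn (fun s => dY k (U s) Y) (Icc s₀ s₁) :=
  (h.continuousOn_dY k hk).comp (f := fun s => (s, Y)) (by fun_prop) fun _ hs => ⟨hs, hY⟩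

theorem boundary_values (h : IsRescaledSolution s₀ s₁ b U Uinf) (hlt : s₀ < s₁) {s : ℝ}
    (hs : s ∈ Icc s₀ s₁) :
    dY 2 (U s) 0 = 1 ∧ dY 3 (U s) 0 = 0 ∧ dY 4 (U s) 0 = -(b s / 2) := by
  have hcl : Icc s₀ s₁ ⊆ closure (Ioo s₀ s₁) := by rw [closure_Ioo hlt.ne]
  refine ⟨?_, ?_, ?_⟩
  · exact EqOn.of_subset_closure (fun r hr => (h.boundary_values_of_mem_Ioo hr).1)
      (h.continuousOn_dY_left (by norm_num) le_rfl) continuousOn_const Ioo_subset_Icc_self hcl hs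
  · exact EqOn.of_subset_closure (fun r hr => (h.boundary_values_of_mem_Ioo hr).2.1)
      (h.continuousOn_dY_left (by norm_num) le_rfl) continuousOn_const Ioo_subset_Icc_self hcl hs
  · exact EqOn.of_subset_closure (fun r hr => (h.boundary_values_of_mem_Ioo hr).2.2)
      (h.continuousOn_dY_left (by norm_num) le_rfl) ((h.b_continuousOn.div_const 2).neg)
      Ioo_subset_Icc_self hcl hs

end IsRescaledSolution

end Prandtl

namespace Prandtl

namespace IsRescaledSolution

variable {s₀ s₁ : ℝ} {b : ℝ → ℝ} {U : ℝ → ℝ → ℝ} {Uinf : ℝ → ℝ}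

/-! ### The stream function at infinity -/

theorem nonneg (h : IsRescaledSolution s₀ s₁ b U Uinf) {s : ℝ} (hs : s ∈ Icc s₀ s₁) {Y : ℝ}
    (hY : 0 ≤ Y) : 0 ≤ U s Y := by
  rcases hY.eq_or_lt with h0 | h0
  · rw [← h0, h.zero s hs]
  · exact (h.pos s hs Y h0).le

theorem intervalIntegrable_U (h : IsRescaledSolution s₀ s₁ b U Uinf) {s : ℝ} (hs : s ∈ Icc s₀ s₁)
    {y Y : ℝ} (hy : 0 ≤ y) (hyY : y ≤ Y) : IntervalIntegrable (U s) volume y Y :=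
  ((h.continuousOn_U hs).mono (by
    rw [uIcc_of_le hyY]; exact fun x hx => hy.trans hx.1)).intervalIntegrable

theorem stream_sub (h : IsRescaledSolution s₀ s₁ b U Uinf) {s : ℝ} (hs : s ∈ Icc s₀ s₁)
    {y Y : ℝ} (hy : 0 ≤ y) (hyY : y ≤ Y) :
    stream U s Y - stream U s y = ∫ z in y..Y, U s z :=
  intervalIntegral.integral_interval_sub_left (h.intervalIntegrable_U hs le_rfl (hy.trans hyY))
    (h.intervalIntegrable_U hs le_rfl hy)

theorem stream_mono (h : IsRescaledSolution s₀ s₁ b U Uinf) {s : ℝ} (hs : s ∈ Icc s₀ s₁)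
    {y Y : ℝ} (hy : 0 ≤ y) (hyY : y ≤ Y) : stream U s y ≤ stream U s Y := by
  have h1 := h.stream_sub hs hy hyY
  have h2 : 0 ≤ ∫ z in y..Y, U s z :=
    intervalIntegral.integral_nonneg hyY fun z hz => h.nonneg hs (hy.trans hz.1)
  linarith

theorem stream_nonneg (h : IsRescaledSolution s₀ s₁ b U Uinf) {s : ℝ} (hs : s ∈ Icc s₀ s₁)
    {Y : ℝ} (hY : 0 ≤ Y) : 0 ≤ stream U s Y := by
  have := h.stream_mono hs le_rfl hY
  rwa [stream_zero] at this

theorem continuousOn_stream (h : IsRescaledSolution s₀ s₁ b U Uinf) (hle : s₀ ≤ s₁) :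
    ContinuousOn (fun p : ℝ × ℝ => stream U p.1 p.2) (Icc s₀ s₁ ×ˢ Ici 0) := by
  -- U is frozen outside the strip, which makes the integrand continuous on the whole space.
  set V : ℝ × ℝ → ℝ → ℝ := fun p z => U (projIcc s₀ s₁ hle p.1) (max z 0) with hV
  have hVc : Continuous (Function.uncurry V) := by
    have h0 := h.continuousOn_dY 0 (by norm_num)
    simp only [dY_zero] at h0
    refine h0.comp_continuous (f := fun q : (ℝ × ℝ) × ℝ =>
      ((projIcc s₀ s₁ hle q.1.1 : ℝ), max q.2 0)) ?_ ?_
    · refine Continuous.prodMk ?_ (by fun_prop)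
      exact continuous_subtype_val.comp (continuous_projIcc.comp (by fun_prop))
    · exact fun q => ⟨(projIcc s₀ s₁ hle q.1.1).2, mem_Ici.2 (le_max_right _ _)⟩
  have hc : Continuous fun p : ℝ × ℝ => ∫ z in (0 : ℝ)..p.2, V p z :=
    intervalIntegral.continuous_parametric_intervalIntegral_of_continuous hVc continuous_snd
  refine hc.continuousOn.congr fun p hp => ?_
  refine intervalIntegral.integral_congr fun z hz => ?_
  rw [uIcc_of_le hp.2] at hz
  simp only [hV, projIcc_of_mem hle hp.1, max_eq_left hz.1]

/-- The limit of positive values is nonnegative, and where it vanishes Bernoulli's law would read 0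
= -1. -/
theorem outer_pos (h : IsRescaledSolution s₀ s₁ b U Uinf) {s : ℝ} (hs : s ∈ Icc s₀ s₁) :
    0 < Uinf s := by
  have h0 : 0 ≤ Uinf s := ge_of_tendsto (h.tendsto s hs) (by
    filter_upwards [eventually_gt_atTop 0] with Y hY using (h.pos s hs Y hY).le)
  rcases h0.eq_or_lt with h1 | h1
  · have := h.outer s hs
    rw [← h1] at this
    norm_num at this
  · exact h1

theorem exists_lt_stream (h : IsRescaledSolution s₀ s₁ b U Uinf) {s : ℝ} (hs : s ∈ Icc s₀ s₁)
    (R : ℝ) : ∃ L ≥ 0, R < stream U s L := by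
  have hpos := h.outer_pos hs
  obtain ⟨N, hN⟩ := eventually_atTop.1
    ((h.tendsto s hs).eventually (lt_mem_nhds (half_lt_self hpos)))
  set N' := max N 0
  set L := N' + (|R| + 1) / (Uinf s / 2) with hL
  have hLN : N' ≤ L := by rw [hL]; have : 0 ≤ (|R| + 1) / (Uinf s / 2) := by positivity
                          linarith
  have hN0 : 0 ≤ N' := le_max_right _ _
  refine ⟨L, hN0.trans hLN, ?_⟩
  have h1 := h.stream_sub hs hN0 hLN
  have h2 : ∫ z in N'..L, Uinf s / 2 ≤ ∫ z in N'..L, U s z :=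
    intervalIntegral.integral_mono_on hLN intervalIntegrable_const
      (h.intervalIntegrable_U hs hN0 hLN)
      fun z hz => (hN z ((le_max_left _ _).trans hz.1)).le
  have h3 : ∫ z in N'..L, Uinf s / 2 = |R| + 1 := by
    rw [intervalIntegral.integral_const, smul_eq_mul, hL]
    field_simp
    ring
  have h4 := h.stream_nonneg hs hN0
  have := le_abs_self R
  linarith

/-- The stream function tends to infinity uniformly in `s`. -/
theorem exists_forall_lt_stream (h : IsRescaledSolution s₀ s₁ b U Uinf) (hle : s₀ ≤ s₁) (R : ℝ) :
    ∃ L ≥ 0, ∀ s ∈ Icc s₀ s₁, ∀ Y ≥ L, R < stream U s Y := by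
  -- The stream function increases in Y, so the heights found near each time can be merged by taking
  -- a maximum. Compactness of the time interval then gives a single height.
  have key : ∃ L ≥ 0, ∀ s ∈ Icc s₀ s₁, s ∈ Icc s₀ s₁ → R < stream U s L := by
    refine isCompact_Icc.induction_on (p := fun A => ∃ L ≥ 0, ∀ s ∈ A, s ∈ Icc s₀ s₁ →
      R < stream U s L) ⟨0, le_rfl, by simp⟩ ?_ ?_ ?_
    · rintro A B hAB ⟨L, hL, hB⟩
      exact ⟨L, hL, fun s hs => hB s (hAB hs)⟩
    · rintro A B ⟨L, hL, hA⟩ ⟨L', hL', hB⟩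
      refine ⟨max L L', le_max_of_le_left hL, ?_⟩
      rintro s (hs | hs) hsI
      · exact (hA s hs hsI).trans_le (h.stream_mono hsI hL (le_max_left _ _))
      · exact (hB s hs hsI).trans_le (h.stream_mono hsI hL' (le_max_right _ _))
    · intro s hs
      obtain ⟨L, hL, hlt⟩ := h.exists_lt_stream hs R
      have hc : ContinuousWithinAt (fun r => stream U r L) (Icc s₀ s₁) s :=
        (h.continuousOn_stream hle (s, L) ⟨hs, hL⟩).comp (f := fun r => (r, L))
          (by fun_prop) (fun r hr => ⟨hr, hL⟩)
      refine ⟨_, inter_mem self_mem_nhdsWithin (hc.eventually (lt_mem_nhds hlt)), L, hL, ?_⟩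
      exact fun r hr _ => hr.2
  obtain ⟨L, hL, hk⟩ := key
  exact ⟨L, hL, fun s hs Y hY => (hk s hs hs).trans_le (h.stream_mono hs hL hY)⟩

/-! ### Monotonicity in the normal variable -/

/-- Inequalities valid before the final time persist there. -/
theorem forall_Icc_of_forall_Ico (hlt : s₀ < s₁) {f g : ℝ → ℝ} (hf : ContinuousOn f (Icc s₀ s₁))
    (hg : ContinuousOn g (Icc s₀ s₁)) (hle : ∀ s ∈ Ico s₀ s₁, f s ≤ g s) :
    ∀ s ∈ Icc s₀ s₁, f s ≤ g s := by
  intro s hs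
  have hcl : s ∈ closure (Ico s₀ s₁) := by rwa [closure_Ico hlt.ne]
  exact ContinuousWithinAt.closure_le hcl ((hf s hs).mono Ico_subset_Icc_self)
    ((hg s hs).mono Ico_subset_Icc_self) hle

/-- The barrier is -δ e^s (1 + ψ). It starts below G, lies below it at the wall, and falls below any
bounded function at infinity. At contact U_Y and U_YY are those of the barrier, and the terms in S
cancel because ψ_s = S and ψ_Y = U. The factor e^s beats the zeroth-order term bU/2 as soon as b ≤
2. Letting δ → 0 concludes. -/
theorem dY_one_nonneg (h : IsRescaledSolution s₀ s₁ b U Uinf) (hlt : s₀ < s₁)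
    (hb : ∀ s ∈ Icc s₀ s₁, 0 < b s ∧ b s ≤ 2) (hmono : MonotoneOn (U s₀) (Ici 0)) :
    ∀ s ∈ Icc s₀ s₁, ∀ Y ≥ 0, 0 ≤ dY 1 (U s) Y := by
  obtain ⟨K, hK⟩ := h.bounded
  intro s hs Y hY
  refine forall_Icc_of_forall_Ico hlt (f := fun _ => 0) continuousOn_const
    (h.continuousOn_dY_left (by norm_num) hY) ?_ s hs
  intro t ht
  have htI : Icc s₀ t ⊆ Icc s₀ s₁ := Icc_subset_Icc le_rfl ht.2.le
  have key : ∀ δ > 0, 0 < dY 1 (U t) Y + δ * Real.exp t * (1 + stream U t Y) := by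
    intro δ hδ
    obtain ⟨L, hL, hLs⟩ := h.exists_forall_lt_stream hlt.le (K / (δ * Real.exp s₀))
    refine pos_of_no_touching (c := 0) (R := L) (s₀ := s₀) (t := t)
      (φ := fun r y => dY 1 (U r) y + δ * Real.exp r * (1 + stream U r y))
      (φs := fun r y => dSY s₀ s₁ U 1 r y + (δ * Real.exp r * (1 + stream U r y)
        + δ * Real.exp r * stream (dSY s₀ s₁ U 0) r y))
      (φY := fun r y => dY 2 (U r) y + δ * Real.exp r * U r y)
      (φYY := fun r y => dY 3 (U r) y + δ * Real.exp r * dY 1 (U r) y)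
      ?_ ?_ ?_ ?_ ?_ ?_ ?_ ?_ t ⟨ht.1, le_rfl⟩ Y hY
    · have h1 := (h.continuousOn_dY 1 (by norm_num)).mono (prod_mono htI (le_refl (Ici 0)))
      have h2 := (h.continuousOn_stream hlt.le).mono (prod_mono htI (le_refl (Ici 0)))
      exact h1.add ((continuousOn_const.mul (Real.continuous_exp.comp continuous_fst).continuousOn).mul
        (continuousOn_const.add h2))
    · intro r hr y hy hLy
      have hrI := htI hr
      have h1 := neg_le_of_abs_le (hK 1 (by norm_num) r hrI y hy)
      have h2 := hLs r hrI y hLy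
      have h3 : Real.exp s₀ ≤ Real.exp r := Real.exp_le_exp.2 hr.1
      rw [div_lt_iff₀ (by positivity)] at h2
      have h4 : stream U r y * (δ * Real.exp s₀) ≤ stream U r y * (δ * Real.exp r) := by
        have := h.stream_nonneg hrI hy
        gcongr
      have : 0 < δ * Real.exp r := by positivity
      linarith
    · intro y hy
      have h0 : s₀ ∈ Icc s₀ s₁ := ⟨le_rfl, hlt.le⟩
      have h1 : 0 ≤ dY 1 (U s₀) y := by
        rw [dY, iteratedDerivWithin_one]
        exact hmono.derivWithin_nonneg
      have := h.stream_nonneg h0 hy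
      positivity
    · intro r hr
      simp only [h.slope r (htI hr), stream_zero]
      positivity
    · intro r hr y hy
      have hr' : r ∈ Ioo s₀ s₁ := ⟨hr.1, hr.2.trans_lt ht.2⟩
      exact (h.hasDerivAt_s (by norm_num) hr' hy.le).add
        (((Real.hasDerivAt_exp r).const_mul δ).mul
          ((h.hasDerivAt_stream_s hr' hy.le).const_add 1))
    · intro r hr y hy
      have hr' := htI (Ioc_subset_Icc_self hr)
      exact (hasDerivAt_dY (h.contDiffOn r hr') (by norm_num) hy).add
        (((h.hasDerivAt_stream hr' hy).const_add 1).const_mul _)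
    · intro r hr y hy
      have hr' := htI (Ioc_subset_Icc_self hr)
      exact (hasDerivAt_dY (h.contDiffOn r hr') (by norm_num) hy).add
        ((h.hasDerivAt_U hr' hy).const_mul _)
    · intro r hr y hy e0 e1 e2 e3
      have hr' : r ∈ Ioo s₀ s₁ := ⟨hr.1, hr.2.trans_lt ht.2⟩
      have hrI := Ioo_subset_Icc_self hr'
      have h3 := h.dY_three_eq hr' hy
      have hU := h.pos r hrI y hy
      have hψ := h.stream_nonneg hrI hy.le
      obtain ⟨hb0, hb2⟩ := hb r hrI
      have hd : 0 < δ * Real.exp r := by positivity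
      generalize δ * Real.exp r = d at *
      generalize dSY s₀ s₁ U 1 r y = Gs at *
      generalize stream (dSY s₀ s₁ U 0) r y = S at *
      generalize stream U r y = ψ at *
      generalize dY 3 (U r) y = F3 at *
      generalize U r y = u at *
      have hG : dY 1 (U r) y = -(d * (1 + ψ)) := by linarith
      have hF : dY 2 (U r) y = -(d * u) := by linarith
      rw [hG, hF] at h3
      rw [hG] at e3
      have hGs : u * Gs ≤ u * (-(d * (1 + ψ) + d * S)) :=
        mul_le_mul_of_nonneg_left (by linarith) hU.le
      have p1 : 0 < d * (d * (1 + ψ)) := by positivity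
      have p2 : 0 ≤ (1 - b r / 2) * (u * d * (1 + ψ)) :=
        mul_nonneg (by linarith) (by positivity)
      have p3 : 0 ≤ b r * d * u * ψ := by positivity
      nlinarith
  have hnn := h.stream_nonneg (htI ⟨ht.1, le_rfl⟩) hY
  have hB : 0 < Real.exp t * (1 + stream U t Y) := by positivity
  -- If U_Y were negative at this point, the δ chosen below would make the perturbed quantity
  -- exactly zero there.
  by_contra! hneg
  have hneg' : dY 1 (U t) Y < 0 := hneg
  have := key (-dY 1 (U t) Y / (Real.exp t * (1 + stream U t Y))) (div_pos (by linarith) hB)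
  rw [mul_assoc, div_mul_cancel₀ _ hB.ne'] at this
  linarith

theorem monotoneOn_U (h : IsRescaledSolution s₀ s₁ b U Uinf)
    (hG : ∀ s ∈ Icc s₀ s₁, ∀ Y ≥ 0, 0 ≤ dY 1 (U s) Y) {s : ℝ} (hs : s ∈ Icc s₀ s₁) :
    MonotoneOn (U s) (Ici 0) := by
  refine monotoneOn_of_deriv_nonneg (convex_Ici 0) (h.continuousOn_U hs) ?_ ?_
  · rw [interior_Ici]
    exact fun y hy => (h.hasDerivAt_U hs hy).differentiableAt.differentiableWithinAt
  · rw [interior_Ici]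
    intro y hy
    rw [(h.hasDerivAt_U hs hy).deriv]
    exact hG s hs y (le_of_lt hy)

/-! ### The upper bound on the second derivative -/

/-- The barrier is 1 + δ e^{Λs} (1 + ψ), and the terms in S cancel as for U_Y. At contact the
parabolic equation leaves Λ U² ≤ U_YY. On Y ≥ 1 the increasing function U stays away from zero, so
this fails for Λ large. The wall, where U vanishes, has to be treated by other means. -/
theorem dY_two_le_one (h : IsRescaledSolution s₀ s₁ b U Uinf) (hlt : s₀ < s₁)
    (hb : ∀ s ∈ Icc s₀ s₁, 0 < b s) (hG : ∀ s ∈ Icc s₀ s₁, ∀ Y ≥ 0, 0 ≤ dY 1 (U s) Y)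
    (hinit : ∀ Y ≥ 1, dY 2 (U s₀) Y ≤ 1) (hbdry : ∀ s ∈ Icc s₀ s₁, dY 2 (U s) 1 < 1) :
    ∀ s ∈ Icc s₀ s₁, ∀ Y ≥ 1, dY 2 (U s) Y ≤ 1 := by
  obtain ⟨K, hK⟩ := h.bounded
  have hU1c : ContinuousOn (fun s => U s 1) (Icc s₀ s₁) := by
    have := h.continuousOn_dY_left (k := 0) (by norm_num) zero_le_one
    simpa only [dY_zero] using this
  obtain ⟨c, hc, hcU⟩ : ∃ c > 0, ∀ s ∈ Icc s₀ s₁, c ≤ U s 1 := by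
    obtain ⟨r, hr, hmin⟩ := isCompact_Icc.exists_isMinOn (nonempty_Icc.2 hlt.le) hU1c
    exact ⟨U r 1, h.pos r hr 1 one_pos, fun s hs => hmin hs⟩
  intro s hs Y hY
  have hY0 : (0 : ℝ) ≤ Y := zero_le_one.trans hY
  refine forall_Icc_of_forall_Ico hlt (g := fun _ => 1)
    (h.continuousOn_dY_left (by norm_num) hY0) continuousOn_const ?_ s hs
  intro t ht
  have htI : Icc s₀ t ⊆ Icc s₀ s₁ := Icc_subset_Icc le_rfl ht.2.le
  have hsub : Ici (1 : ℝ) ⊆ Ici 0 := Ici_subset_Ici.2 zero_le_one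
  -- Here K bounds U_YY and c bounds U from below on Y ≥ 1, so Λ U² ≤ U_YY becomes impossible.
  obtain ⟨Λ, hΛ0, hΛ⟩ : ∃ Λ > 0, K < Λ * c ^ 2 := by
    refine ⟨(|K| + 1) / c ^ 2, by positivity, ?_⟩
    rw [div_mul_cancel₀ _ (by positivity)]
    linarith [le_abs_self K]
  have key : ∀ δ > 0, 0 < δ * Real.exp (Λ * t) * (1 + stream U t Y) - (dY 2 (U t) Y - 1) := by
    intro δ hδ
    obtain ⟨L, hL, hLs⟩ := h.exists_forall_lt_stream hlt.le (K / (δ * Real.exp (Λ * s₀)))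
    refine pos_of_no_touching (c := 1) (R := L) (s₀ := s₀) (t := t)
      (φ := fun r y => δ * Real.exp (Λ * r) * (1 + stream U r y) - (dY 2 (U r) y - 1))
      (φs := fun r y => (δ * (Real.exp (Λ * r) * (Λ * 1)) * (1 + stream U r y)
        + δ * Real.exp (Λ * r) * stream (dSY s₀ s₁ U 0) r y) - dSY s₀ s₁ U 2 r y)
      (φY := fun r y => δ * Real.exp (Λ * r) * U r y - dY 3 (U r) y)
      (φYY := fun r y => δ * Real.exp (Λ * r) * dY 1 (U r) y - dY 4 (U r) y)
      ?_ ?_ ?_ ?_ ?_ ?_ ?_ ?_ t ⟨ht.1, le_rfl⟩ Y hY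
    · have h1 := (h.continuousOn_dY 2 (by norm_num)).mono (prod_mono htI hsub)
      have h2 := (h.continuousOn_stream hlt.le).mono (prod_mono htI hsub)
      have h3 : Continuous fun p : ℝ × ℝ => Real.exp (Λ * p.1) := by fun_prop
      exact ((continuousOn_const.mul h3.continuousOn).mul
        (continuousOn_const.add h2)).sub (h1.sub continuousOn_const)
    · intro r hr y hy hLy
      have hrI := htI hr
      have hy0 : (0 : ℝ) ≤ y := zero_le_one.trans hy
      have h1 := le_of_abs_le (hK 2 (by norm_num) r hrI y hy0)
      have h2 := hLs r hrI y hLy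
      have h3 : Real.exp (Λ * s₀) ≤ Real.exp (Λ * r) :=
        Real.exp_le_exp.2 (mul_le_mul_of_nonneg_left hr.1 hΛ0.le)
      rw [div_lt_iff₀ (by positivity)] at h2
      have h4 : stream U r y * (δ * Real.exp (Λ * s₀)) ≤ stream U r y * (δ * Real.exp (Λ * r)) := by
        have := h.stream_nonneg hrI hy0
        gcongr
      have : 0 < δ * Real.exp (Λ * r) := by positivity
      linarith
    · intro y hy
      have h0 : s₀ ∈ Icc s₀ s₁ := ⟨le_rfl, hlt.le⟩
      have h1 := hinit y hy
      have := h.stream_nonneg h0 (zero_le_one.trans hy)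
      have : 0 < δ * Real.exp (Λ * s₀) * (1 + stream U s₀ y) := by positivity
      linarith
    · intro r hr
      have h1 := hbdry r (htI hr)
      have := h.stream_nonneg (htI hr) zero_le_one
      have : 0 < δ * Real.exp (Λ * r) * (1 + stream U r 1) := by positivity
      linarith
    · intro r hr y hy
      have hr' : r ∈ Ioo s₀ s₁ := ⟨hr.1, hr.2.trans_lt ht.2⟩
      have hy0 : 0 ≤ y := zero_le_one.trans hy.le
      exact (((((hasDerivAt_id r).const_mul Λ).exp).const_mul δ).mul
          ((h.hasDerivAt_stream_s hr' hy0).const_add 1)).sub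
            ((h.hasDerivAt_s (by norm_num) hr' hy0).sub_const 1)
    · intro r hr y hy
      have hr' := htI (Ioc_subset_Icc_self hr)
      have hy0 : 0 < y := zero_lt_one.trans hy
      exact (((h.hasDerivAt_stream hr' hy0).const_add 1).const_mul _).sub
        ((hasDerivAt_dY (h.contDiffOn r hr') (by norm_num) hy0).sub_const 1)
    · intro r hr y hy
      have hr' := htI (Ioc_subset_Icc_self hr)
      have hy0 : 0 < y := zero_lt_one.trans hy
      exact ((h.hasDerivAt_U hr' hy0).const_mul _).sub
        (hasDerivAt_dY (h.contDiffOn r hr') (by norm_num) hy0)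
    · intro r hr y hy e0 e1 e2 e3
      have hr' : r ∈ Ioo s₀ s₁ := ⟨hr.1, hr.2.trans_lt ht.2⟩
      have hy0 : 0 < y := zero_lt_one.trans hy
      have hrI := Ioo_subset_Icc_self hr'
      have hpar := h.parabolic_eq hr' hy0
      have hU := h.pos r hrI y hy0
      have hcu : c ≤ U r y := (hcU r hrI).trans
        (h.monotoneOn_U hG hrI (mem_Ici.2 zero_le_one) (mem_Ici.2 hy0.le) hy.le)
      have hψ := h.stream_nonneg hrI hy0.le
      have hKF := le_of_abs_le (hK 2 (by norm_num) r hrI y hy0.le)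
      have hb0 := hb r hrI
      have hG0 := hG r hrI y hy0.le
      have hd : 0 < δ * Real.exp (Λ * r) := by positivity
      have hassoc : δ * (Real.exp (Λ * r) * (Λ * 1)) = δ * Real.exp (Λ * r) * Λ := by ring
      simp only [hassoc] at e0 e1 e2 e3
      generalize δ * Real.exp (Λ * r) = d at *
      generalize dSY s₀ s₁ U 2 r y = Fs at *
      generalize stream (dSY s₀ s₁ U 0) r y = S at *
      generalize stream U r y = ψ at *
      generalize dY 1 (U r) y = G at *
      generalize dY 4 (U r) y = F4 at *
      generalize U r y = u at *
      have hF : dY 2 (U r) y = d * (1 + ψ) + 1 := by linarith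
      have hF3 : dY 3 (U r) y = d * u := by linarith
      rw [hF, hF3, eq_div_iff hU.ne'] at hpar
      rw [hF] at hKF
      have hu2 : c ^ 2 ≤ u ^ 2 := pow_le_pow_left₀ hc.le hcu 2
      have hGu : G / u * u = G := div_mul_cancel₀ _ hU.ne'
      have hFs : u ^ 2 * (d * Λ * (1 + ψ) + d * S) ≤ u ^ 2 * Fs :=
        mul_le_mul_of_nonneg_left (by linarith) (by positivity)
      have hF4 : F4 * u ≤ d * G * u := mul_le_mul_of_nonneg_right (by linarith) hU.le
      have hB : 0 < d * (1 + ψ) := by positivity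
      have q1 : u ^ 2 * (Λ * (d * (1 + ψ))) ≤ d * (1 + ψ) * (d * (1 + ψ) + 1) := by
        have q0 : 0 ≤ d * u * (3 * b r / 2 * ψ) * u := by positivity
        have e : (u * Fs + d * u * (3 * b r / 2 * ψ - S + G / u) - F4) * u
          = u ^ 2 * Fs + d * u * (3 * b r / 2 * ψ) * u - d * u ^ 2 * S + d * u * (G / u * u)
            - F4 * u := by ring
        rw [e, hGu] at hpar
        nlinarith
      have q2 : Λ * u ^ 2 ≤ d * (1 + ψ) + 1 := by
        have : (Λ * u ^ 2) * (d * (1 + ψ)) ≤ (d * (1 + ψ) + 1) * (d * (1 + ψ)) := by linarith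
        exact le_of_mul_le_mul_right this hB
      have q3 : Λ * c ^ 2 ≤ Λ * u ^ 2 := mul_le_mul_of_nonneg_left hu2 hΛ0.le
      linarith
  have hnn := h.stream_nonneg (htI ⟨ht.1, le_rfl⟩) hY0
  have hB : 0 < Real.exp (Λ * t) * (1 + stream U t Y) := by positivity
  by_contra! hneg
  have hneg' : 1 < dY 2 (U t) Y := hneg
  have := key ((dY 2 (U t) Y - 1) / (Real.exp (Λ * t) * (1 + stream U t Y)))
    (div_pos (by linarith) hB)
  rw [mul_assoc, div_mul_cancel₀ _ hB.ne'] at this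
  linarith

end IsRescaledSolution

end Prandtl

namespace Prandtl

/-! ### Primitives of functions with a limit at the boundary -/

/-- The value of q at 0, a division by zero in the applications, does not affect the integral.
Replacing it by the limit gives a function continuous on the closed half line. -/
theorem primitive_of_tendsto {q : ℝ → ℝ} {l : ℝ} (hq : ContinuousOn q (Ioi 0))
    (hl : Tendsto q (𝓝[>] 0) (𝓝 l)) :
    (∀ Y ≥ 0, IntervalIntegrable q volume 0 Y) ∧
      (∀ Y > 0, HasDerivAt (fun y => ∫ z in (0 : ℝ)..y, q z) (q Y) Y) ∧
      ContinuousOn (fun y => ∫ z in (0 : ℝ)..y, q z) (Ici 0) := by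
  classical
  set p := Function.update q 0 l with hp
  have hpq : ∀ z > 0, p z = q z := fun z hz => Function.update_of_ne hz.ne' _ _
  have hpc : ContinuousOn p (Ici 0) := by
    intro z hz
    rcases (mem_Ici.1 hz).eq_or_lt with h0 | h0
    · subst h0
      rw [continuousWithinAt_update_same]
      exact hl.mono_left (nhdsWithin_mono _ fun x hx => lt_of_le_of_ne hx.1 (Ne.symm hx.2))
    · have h1 : ContinuousAt q z := hq.continuousAt (Ioi_mem_nhds h0)
      refine (h1.congr ?_).continuousWithinAt
      filter_upwards [Ioi_mem_nhds h0] with y hy using (hpq y hy).symm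
  have hint : ∀ y ≥ 0, ∫ z in (0 : ℝ)..y, q z = ∫ z in (0 : ℝ)..y, p z := by
    intro y hy
    refine intervalIntegral.integral_congr_ae (Eventually.of_forall fun z hz => ?_)
    rw [uIoc_of_le hy] at hz
    exact (hpq z hz.1).symm
  refine ⟨fun Y hY => ?_, fun Y hY => ?_, ?_⟩
  · have h1 : IntervalIntegrable p volume 0 Y :=
      (hpc.mono (by rw [uIcc_of_le hY]; exact Icc_subset_Ici_self)).intervalIntegrable
    refine h1.congr fun z hz => ?_
    rw [uIoc_of_le hY] at hz
    exact hpq z hz.1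
  · rw [← hpq Y hY]
    refine (hasDerivAt_integral_Ici hpc hY).congr_of_eventuallyEq ?_
    filter_upwards [Ioi_mem_nhds hY] with y hy using hint y (le_of_lt hy)
  · exact (continuousOn_integral_Ici hpc).congr fun y hy => hint y hy

/-- A function whose derivative is dominated is itself dominated. -/
theorem abs_le_of_abs_deriv_le {f g f' g' : ℝ → ℝ} {Y : ℝ} (hY : 0 ≤ Y)
    (hf : ContinuousOn f (Icc 0 Y)) (hg : ContinuousOn g (Icc 0 Y))
    (hf' : ∀ z ∈ Ioo 0 Y, HasDerivAt f (f' z) z) (hg' : ∀ z ∈ Ioo 0 Y, HasDerivAt g (g' z) z)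
    (hle : ∀ z ∈ Ioo 0 Y, |f' z| ≤ g' z) (hf0 : f 0 = 0) (hg0 : g 0 = 0) : |f Y| ≤ g Y := by
  have mono : ∀ {k k' : ℝ → ℝ}, ContinuousOn k (Icc 0 Y) →
      (∀ z ∈ Ioo 0 Y, HasDerivAt k (k' z) z) → (∀ z ∈ Ioo 0 Y, 0 ≤ k' z) → k 0 ≤ k Y := by
    intro k k' hk hk' hk0
    refine monotoneOn_of_deriv_nonneg (convex_Icc 0 Y) hk ?_ ?_ ⟨le_rfl, hY⟩ ⟨hY, le_rfl⟩ hY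
    · rw [interior_Icc]
      exact fun z hz => (hk' z hz).differentiableAt.differentiableWithinAt
    · rw [interior_Icc]
      intro z hz
      rw [(hk' z hz).deriv]
      exact hk0 z hz
  have h1 := mono (hg.sub hf) (fun z hz => (hg' z hz).sub (hf' z hz)) fun z hz => by
    have := le_of_abs_le (hle z hz); linarith
  have h2 := mono (hg.add hf) (fun z hz => (hg' z hz).add (hf' z hz)) fun z hz => by
    have := neg_le_of_abs_le (hle z hz); linarith
  simp only [Pi.sub_apply, Pi.add_apply, hf0, hg0] at h1 h2
  exact abs_le.2 ⟨by linarith, by linarith⟩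

/-- Limits at the boundary of quotients by powers of a function with unit slope. -/
theorem tendsto_div_of_boundary {u u' v v' v'' : ℝ → ℝ}
    (hu : ∀ z > 0, HasDerivAt u (u' z) z) (hu0 : Tendsto u (𝓝[>] 0) (𝓝 0))
    (hu1 : Tendsto u' (𝓝[>] 0) (𝓝 1)) (hpos : ∀ z > 0, 0 < u z)
    (hv : ∀ z > 0, HasDerivAt v (v' z) z) (hv' : ∀ z > 0, HasDerivAt v' (v'' z) z)
    (hv0 : Tendsto v (𝓝[>] 0) (𝓝 0)) (hv1 : Tendsto v' (𝓝[>] 0) (𝓝 0)) {l : ℝ}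
    (hv2 : Tendsto v'' (𝓝[>] 0) (𝓝 l)) :
    Tendsto (fun z => v' z / u z) (𝓝[>] 0) (𝓝 l) ∧
      Tendsto (fun z => v z / u z ^ 2) (𝓝[>] 0) (𝓝 (l / 2)) := by
  have hmem : ∀ᶠ z in 𝓝[>] (0 : ℝ), 0 < z := self_mem_nhdsWithin
  have hu1' : ∀ᶠ z in 𝓝[>] (0 : ℝ), u' z ≠ 0 :=
    (hu1.eventually (lt_mem_nhds (zero_lt_one))).mono fun z hz => ne_of_gt hz
  have h1 : Tendsto (fun z => v' z / u z) (𝓝[>] 0) (𝓝 l) := by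
    refine HasDerivAt.lhopital_zero_nhdsGT (hmem.mono hv') (hmem.mono hu) hu1' hv1 hu0 ?_
    have := hv2.div hu1 one_ne_zero
    rwa [div_one] at this
  refine ⟨h1, ?_⟩
  refine HasDerivAt.lhopital_zero_nhdsGT (f' := v') (g' := fun z => 2 * u z * u' z)
    (hmem.mono hv) (hmem.mono fun z hz => ?_) ?_ hv0 ?_ ?_
  · exact ((hu z hz).pow 2).congr_deriv (by norm_num)
  · filter_upwards [hmem, hu1'] with z hz h'
    exact mul_ne_zero (mul_ne_zero two_ne_zero (hpos z hz).ne') h'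
  · simpa using hu0.pow 2
  · have h2 := h1.div (hu1.const_mul 2) (by norm_num)
    rw [mul_one] at h2
    refine h2.congr' ?_
    filter_upwards [hmem, hu1'] with z hz h'
    have := (hpos z hz).ne'
    simp only [Pi.div_apply]
    field_simp

namespace IsRescaledSolution

variable {s₀ s₁ : ℝ} {b : ℝ → ℝ} {U : ℝ → ℝ → ℝ} {Uinf : ℝ → ℝ}

theorem tendsto_U_zero (h : IsRescaledSolution s₀ s₁ b U Uinf) {s : ℝ} (hs : s ∈ Icc s₀ s₁) :
    Tendsto (U s) (𝓝[>] 0) (𝓝 0) := by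
  have := h.tendsto_dY_zero hs (k := 0) (by norm_num)
  rwa [dY_zero, h.zero s hs] at this

theorem tendsto_dY_one_zero (h : IsRescaledSolution s₀ s₁ b U Uinf) {s : ℝ}
    (hs : s ∈ Icc s₀ s₁) : Tendsto (dY 1 (U s)) (𝓝[>] 0) (𝓝 1) := by
  have := h.tendsto_dY_zero hs (k := 1) (by norm_num)
  rwa [h.slope s hs] at this

/-- The primitive of `(U_YY - 1) / U²`. -/
theorem primitive_div_sq (h : IsRescaledSolution s₀ s₁ b U Uinf) (hlt : s₀ < s₁) {s : ℝ}
    (hs : s ∈ Icc s₀ s₁) :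
    (∀ Y ≥ 0, IntervalIntegrable (fun z => (dY 2 (U s) z - 1) / U s z ^ 2) volume 0 Y) ∧
      (∀ Y > 0, HasDerivAt (fun y => ∫ z in (0 : ℝ)..y, (dY 2 (U s) z - 1) / U s z ^ 2)
        ((dY 2 (U s) Y - 1) / U s Y ^ 2) Y) ∧
      ContinuousOn (fun y => ∫ z in (0 : ℝ)..y, (dY 2 (U s) z - 1) / U s z ^ 2) (Ici 0) := by
  obtain ⟨e2, e3, -⟩ := h.boundary_values hlt hs
  have hC := h.contDiffOn s hs
  have t2 := (h.tendsto_dY_zero hs (k := 2) (by norm_num)).sub_const 1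
  rw [e2, sub_self] at t2
  have t3 := h.tendsto_dY_zero hs (k := 3) (by norm_num)
  rw [e3] at t3
  refine primitive_of_tendsto ?_ (tendsto_div_of_boundary (u := U s) (v := fun z => dY 2 (U s) z - 1)
    (fun z hz => h.hasDerivAt_U hs hz) (h.tendsto_U_zero hs) (h.tendsto_dY_one_zero hs)
    (h.pos s hs) (fun z hz => (hasDerivAt_dY hC (k := 2) (by norm_num) hz).sub_const 1)
    (fun z hz => hasDerivAt_dY hC (k := 3) (by norm_num) hz) t2 t3
    (h.tendsto_dY_zero hs (k := 4) (by norm_num))).2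
  refine ContinuousOn.div ?_ ?_ fun z hz => pow_ne_zero _ (h.pos s hs z hz).ne'
  · exact ((continuousOn_dY_of_contDiffOn hC (by norm_num)).sub continuousOn_const).mono
      Ioi_subset_Ici_self
  · exact ((h.continuousOn_U hs).pow 2).mono Ioi_subset_Ici_self

/-- The normal velocity, recovered from the equation by inverting `g ↦ U g - U_Y ∫₀^Y g`. -/
theorem stream_dSY_eq (h : IsRescaledSolution s₀ s₁ b U Uinf) (hlt : s₀ < s₁) {s : ℝ}
    (hs : s ∈ Ioo s₀ s₁) {Y : ℝ} (hY : 0 < Y) :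
    stream (dSY s₀ s₁ U 0) s Y = 3 * b s / 2 * stream U s Y - b s / 2 * Y * U s Y
      + U s Y * ∫ z in (0 : ℝ)..Y, (dY 2 (U s) z - 1) / U s z ^ 2 := by
  have hs' := Ioo_subset_Icc_self hs
  obtain ⟨-, hI, hIc⟩ := h.primitive_div_sq hlt hs'
  set I := fun y => ∫ z in (0 : ℝ)..y, (dY 2 (U s) z - 1) / U s z ^ 2 with hIdef
  set T := fun y => stream (dSY s₀ s₁ U 0) s y - 3 * b s / 2 * stream U s y with hT
  have hTd : ∀ y > 0, HasDerivAt T (dSY s₀ s₁ U 0 s y - 3 * b s / 2 * U s y) y := fun y hy =>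
    (h.hasDerivAt_stream_dSY hs hy).sub ((h.hasDerivAt_stream hs' hy).const_mul _)
  -- The equation reads U T' - U_Y T = U_YY - 1 - bU²/2, that is (T/U)' = (U_YY - 1)/U² - b/2. Thus
  -- Q is constant. It vanishes because T and T' tend to 0 at the wall, where U has slope one.
  set Q := fun y => T y / U s y + b s / 2 * y - I y with hQ
  have hQd : ∀ y > 0, HasDerivAt Q 0 y := by
    intro y hy
    have hpos := (h.pos s hs' y hy).ne'
    have h1 := (((hTd y hy).div (h.hasDerivAt_U hs' hy) hpos).add
      ((hasDerivAt_id y).const_mul (b s / 2))).sub (hI y hy)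
    refine h1.congr_deriv ?_
    have h2 := h.dY_two_eq hs hy
    rw [h2]
    simp only [hT]
    field_simp
    ring
  have hconst : ∀ y > 0, Q y = Q Y := by
    intro y hy
    refine (convex_Ioi (0 : ℝ)).is_const_of_fderivWithin_eq_zero (𝕜 := ℝ) (f := Q) ?_ ?_ hy hY
    · exact fun z hz => (hQd z hz).differentiableAt.differentiableWithinAt
    · intro z hz
      have h1 := (hQd z hz).hasDerivWithinAt (s := Ioi 0)
      have h2 := h1.hasFDerivWithinAt.fderivWithin (isOpen_Ioi.uniqueDiffWithinAt hz)
      rw [h2]; ext; simp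
  have hmem : ∀ᶠ z in 𝓝[>] (0 : ℝ), 0 < z := self_mem_nhdsWithin
  have tT : Tendsto T (𝓝[>] 0) (𝓝 0) := by
    have c1 : ContinuousOn T (Ici 0) :=
      (continuousOn_integral_Ici (h.continuousOn_dSY_right (k := 0) (by norm_num) hs)).sub
        (continuousOn_const.mul (continuousOn_integral_Ici (h.continuousOn_U hs')))
    have := (c1 0 self_mem_Ici).mono_left (nhdsWithin_mono _ Ioi_subset_Ici_self)
    simpa [hT, stream_zero] using this
  have tw : Tendsto (fun y => dSY s₀ s₁ U 0 s y - 3 * b s / 2 * U s y) (𝓝[>] 0) (𝓝 0) := by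
    have h1 := ((h.continuousOn_dSY_right (k := 0) (by norm_num) hs) 0 self_mem_Ici).mono_left
      (nhdsWithin_mono _ Ioi_subset_Ici_self)
    rw [h.dSY_zero_at_zero hs] at h1
    have h2 := Tendsto.sub h1 ((h.tendsto_U_zero hs').const_mul (3 * b s / 2))
    simpa using h2
  have tq : Tendsto (fun y => T y / U s y) (𝓝[>] 0) (𝓝 0) := by
    refine HasDerivAt.lhopital_zero_nhdsGT (hmem.mono hTd)
      (hmem.mono fun z hz => h.hasDerivAt_U hs' hz)
      (((h.tendsto_dY_one_zero hs').eventually (lt_mem_nhds zero_lt_one)).mono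
        fun z hz => ne_of_gt hz) tT (h.tendsto_U_zero hs') ?_
    have := tw.div (h.tendsto_dY_one_zero hs') one_ne_zero
    rwa [div_one] at this
  have tI : Tendsto I (𝓝[>] 0) (𝓝 0) := by
    have := (hIc 0 self_mem_Ici).mono_left (nhdsWithin_mono _ Ioi_subset_Ici_self)
    simpa [hIdef] using this
  have tid : Tendsto (fun y : ℝ => b s / 2 * y) (𝓝[>] 0) (𝓝 0) := by
    have : Tendsto (fun y : ℝ => b s / 2 * y) (𝓝 0) (𝓝 (b s / 2 * 0)) :=
      (continuous_const.mul continuous_id).tendsto 0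
    rw [mul_zero] at this
    exact this.mono_left nhdsWithin_le_nhds
  have tQ : Tendsto Q (𝓝[>] 0) (𝓝 0) := by simpa using (tq.add tid).sub tI
  have hQY : Q Y = 0 := by
    have : Tendsto Q (𝓝[>] 0) (𝓝 (Q Y)) :=
      tendsto_const_nhds.congr' (hmem.mono fun z hz => (hconst z hz).symm)
    exact tendsto_nhds_unique this tQ
  have hpos := (h.pos s hs' Y hY).ne'
  have hTY : T Y = U s Y * (I Y - b s / 2 * Y) := by
    have : T Y / U s Y = I Y - b s / 2 * Y := by simp only [hQ] at hQY; linarith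
    rw [← this, mul_div_cancel₀ _ hpos]
  have : stream (dSY s₀ s₁ U 0) s Y = T Y + 3 * b s / 2 * stream U s Y := by simp [hT]
  rw [this, hTY]
  ring

theorem dSY_eq (h : IsRescaledSolution s₀ s₁ b U Uinf) (hlt : s₀ < s₁) {s : ℝ}
    (hs : s ∈ Ioo s₀ s₁) {Y : ℝ} (hY : 0 < Y) :
    dSY s₀ s₁ U 0 s Y = b s * U s Y - b s / 2 * Y * dY 1 (U s) Y
      + dY 1 (U s) Y * (∫ z in (0 : ℝ)..Y, (dY 2 (U s) z - 1) / U s z ^ 2)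
      + (dY 2 (U s) Y - 1) / U s Y := by
  have hpos := (h.pos s (Ioo_subset_Icc_self hs) Y hY).ne'
  have h1 := h.stream_dSY_eq hlt hs hY
  have h2 := h.dY_two_eq hs hY
  rw [h1] at h2
  field_simp
  linear_combination -2 * h2

/-! ### The lower bound on the second derivative -/

/-- For z ≤ Y, monotonicity gives z U(z)² ≤ Y U(Y)². Since U_YY - 1 ≤ 0, the integrand times Y U(Y)²
is at most z (U_YY - 1), whose primitive is explicit. -/
theorem integral_div_sq_le (h : IsRescaledSolution s₀ s₁ b U Uinf) (hlt : s₀ < s₁)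
    (hG : ∀ s ∈ Icc s₀ s₁, ∀ Y ≥ 0, 0 ≤ dY 1 (U s) Y)
    (hF : ∀ s ∈ Icc s₀ s₁, ∀ Y ≥ 0, dY 2 (U s) Y ≤ 1) {s : ℝ} (hs : s ∈ Icc s₀ s₁) {Y : ℝ}
    (hY : 0 < Y) :
    Y * U s Y ^ 2 * (∫ z in (0 : ℝ)..Y, (dY 2 (U s) z - 1) / U s z ^ 2)
      ≤ Y * dY 1 (U s) Y - U s Y - Y ^ 2 / 2 := by
  have hC := h.contDiffOn s hs
  have hcont : ContinuousOn (fun z => z * (dY 2 (U s) z - 1)) (Icc 0 Y) :=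
    (continuousOn_id.mul ((continuousOn_dY_of_contDiffOn hC (by norm_num)).sub
      continuousOn_const)).mono Icc_subset_Ici_self
  have hint : IntervalIntegrable (fun z => z * (dY 2 (U s) z - 1)) volume 0 Y := by
    refine ContinuousOn.intervalIntegrable ?_
    rwa [uIcc_of_le hY.le]
  have hftc : ∫ z in (0 : ℝ)..Y, z * (dY 2 (U s) z - 1)
      = Y * dY 1 (U s) Y - U s Y - Y ^ 2 / 2 := by
    rw [intervalIntegral.integral_eq_sub_of_hasDerivAt_of_le hY.le
      (f := fun z => z * dY 1 (U s) z - U s z - z ^ 2 / 2) ?_ ?_ hint]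
    · simp [h.zero s hs]
    · exact (((continuousOn_id.mul (continuousOn_dY_of_contDiffOn hC (by norm_num))).sub
        (h.continuousOn_U hs)).mono Icc_subset_Ici_self).sub (by fun_prop)
    · intro z hz
      have h1 := (((hasDerivAt_id z).mul (hasDerivAt_dY hC (k := 1) (by norm_num) hz.1)).sub
        (h.hasDerivAt_U hs hz.1)).sub (((hasDerivAt_id z).pow 2).div_const 2)
      refine h1.congr_deriv ?_
      norm_num
      ring
  rw [← hftc, ← intervalIntegral.integral_const_mul]
  refine intervalIntegral.integral_mono_on hY.le
    (((h.primitive_div_sq hlt hs).1 Y hY.le).const_mul _) hint ?_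
  intro z hz
  have hFz := hF s hs z hz.1
  rcases hz.1.eq_or_lt with h0 | h0
  · rw [← h0, h.zero s hs]; simp
  have hUz := h.pos s hs z h0
  have hUm : U s z ≤ U s Y := h.monotoneOn_U hG hs (mem_Ici.2 hz.1) (mem_Ici.2 hY.le) hz.2
  rw [← mul_div_assoc, div_le_iff₀ (by positivity)]
  have h1 : z * U s z ^ 2 ≤ Y * U s Y ^ 2 :=
    mul_le_mul hz.2 (pow_le_pow_left₀ hUz.le hUm 2) (by positivity) hY.le
  nlinarith

/-- Write p = κg, so that p' = -bp. At contact F_s ≤ bpY², F_Y = -2pY and F_YY ≥ -2p. Once S is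
eliminated, the drift contains bYU/2, whose contribution cancels bpY²; this is what dictates g' =
-bg. The bound on the integral of (F - 1)/U² absorbs the terms in U_Y and U and leaves -pY². What
remains is (α + pY²)² ≤ α, contradictory for α = 0 and for α ≥ 1. -/
theorem one_sub_dY_two_lt (h : IsRescaledSolution s₀ s₁ b U Uinf) (hlt : s₀ < s₁)
    (hG : ∀ s ∈ Icc s₀ s₁, ∀ Y ≥ 0, 0 ≤ dY 1 (U s) Y)
    (hF : ∀ s ∈ Icc s₀ s₁, ∀ Y ≥ 0, dY 2 (U s) Y ≤ 1) {g : ℝ → ℝ}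
    (hg : ∀ s ∈ Ioo s₀ s₁, HasDerivAt g (-(b s * g s)) s) (hgc : ContinuousOn g (Icc s₀ s₁))
    (hgpos : ∀ s ∈ Icc s₀ s₁, 0 < g s) {α κ : ℝ} (hα : α = 0 ∨ 1 ≤ α) (hκ : 0 < κ)
    (hinit : ∀ Y ≥ 1, 1 - dY 2 (U s₀) Y < α + κ * g s₀ * Y ^ 2)
    (hbdry : ∀ s ∈ Icc s₀ s₁, 1 - dY 2 (U s) 1 < α + κ * g s) :
    ∀ s ∈ Ico s₀ s₁, ∀ Y ≥ 1, 1 - dY 2 (U s) Y < α + κ * g s * Y ^ 2 := by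
  obtain ⟨K, hK⟩ := h.bounded
  obtain ⟨c, hc, hcg⟩ : ∃ c > 0, ∀ s ∈ Icc s₀ s₁, c ≤ g s := by
    obtain ⟨r, hr, hmin⟩ := isCompact_Icc.exists_isMinOn (nonempty_Icc.2 hlt.le) hgc
    exact ⟨g r, hgpos r hr, fun s hs => hmin hs⟩
  have hα0 : 0 ≤ α := by rcases hα with h0 | h0 <;> linarith
  intro t ht Y hY
  have htI : Icc s₀ t ⊆ Icc s₀ s₁ := Icc_subset_Icc le_rfl ht.2.le
  have hsub : Ici (1 : ℝ) ⊆ Ici 0 := Ici_subset_Ici.2 zero_le_one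
  suffices H : 0 < α + κ * g t * Y ^ 2 + (dY 2 (U t) Y - 1) by linarith
  refine pos_of_no_touching (c := 1) (R := (|K| + 2) / (κ * c)) (s₀ := s₀) (t := t)
    (φ := fun r y => α + κ * g r * y ^ 2 + (dY 2 (U r) y - 1))
    (φs := fun r y => κ * (-(b r * g r)) * y ^ 2 + dSY s₀ s₁ U 2 r y)
    (φY := fun r y => κ * g r * (2 * y) + dY 3 (U r) y)
    (φYY := fun r y => κ * g r * 2 + dY 4 (U r) y)
    ?_ ?_ ?_ ?_ ?_ ?_ ?_ ?_ t ⟨ht.1, le_rfl⟩ Y hY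
  · have h1 := (h.continuousOn_dY 2 (by norm_num)).mono (prod_mono htI hsub)
    have h2 : ContinuousOn (fun p : ℝ × ℝ => g p.1) (Icc s₀ t ×ˢ Ici 1) :=
      hgc.comp continuous_fst.continuousOn fun p hp => htI hp.1
    have h3 : Continuous fun p : ℝ × ℝ => p.2 ^ 2 := by fun_prop
    exact (continuousOn_const.add ((continuousOn_const.mul h2).mul h3.continuousOn)).add
      (h1.sub continuousOn_const)
  · intro r hr y hy hRy
    have hrI := htI hr
    have hy0 : (0 : ℝ) ≤ y := zero_le_one.trans hy
    have h1 := neg_le_of_abs_le (hK 2 (by norm_num) r hrI y hy0)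
    rw [div_le_iff₀ (by positivity)] at hRy
    have h2 : y * (κ * c) ≤ κ * g r * y ^ 2 := by
      have h3 : κ * c ≤ κ * g r := mul_le_mul_of_nonneg_left (hcg r hrI) hκ.le
      have h4 : y ≤ y ^ 2 := by nlinarith
      calc y * (κ * c) ≤ y ^ 2 * (κ * g r) := mul_le_mul h4 h3 (by positivity) (by positivity)
        _ = _ := by ring
    have := le_abs_self K
    linarith
  · intro y hy; have := hinit y hy; linarith
  · intro r hr; have := hbdry r (htI hr); simp only [one_pow, mul_one]; linarith
  · intro r hr y hy
    have hr' : r ∈ Ioo s₀ s₁ := ⟨hr.1, hr.2.trans_lt ht.2⟩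
    have hy0 : 0 ≤ y := zero_le_one.trans hy.le
    exact ((((hg r hr').const_mul κ).mul_const (y ^ 2)).const_add α).add
      ((h.hasDerivAt_s (by norm_num) hr' hy0).sub_const 1)
  · intro r hr y hy
    have hr' := htI (Ioc_subset_Icc_self hr)
    have hy0 : 0 < y := zero_lt_one.trans hy
    have := ((((hasDerivAt_id y).pow 2).const_mul (κ * g r)).const_add α).add
      ((hasDerivAt_dY (h.contDiffOn r hr') (k := 2) (by norm_num) hy0).sub_const 1)
    exact this.congr_deriv (by norm_num)
  · intro r hr y hy
    have hr' := htI (Ioc_subset_Icc_self hr)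
    have hy0 : 0 < y := zero_lt_one.trans hy
    have := (((hasDerivAt_id y).const_mul 2).const_mul (κ * g r)).add
      (hasDerivAt_dY (h.contDiffOn r hr') (k := 3) (by norm_num) hy0)
    exact this.congr_deriv (by norm_num)
  · intro r hr y hy e0 e1 e2 e3
    have hr' : r ∈ Ioo s₀ s₁ := ⟨hr.1, hr.2.trans_lt ht.2⟩
    have hy0 : 0 < y := zero_lt_one.trans hy
    have hrI := Ioo_subset_Icc_self hr'
    have hpar := h.parabolic_eq hr' hy0
    have hU := h.pos r hrI y hy0
    have hS := h.stream_dSY_eq hlt hr' hy0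
    have hI := h.integral_div_sq_le hlt hG hF hrI hy0
    have hp : 0 < κ * g r := mul_pos hκ (hgpos r hrI)
    rw [hS] at hpar
    have hassoc : κ * (-(b r * g r)) * y ^ 2 = -(b r * (κ * g r) * y ^ 2) := by ring
    rw [hassoc] at e1
    generalize κ * g r = p at *
    generalize (∫ z in (0 : ℝ)..y, (dY 2 (U r) z - 1) / U r z ^ 2) = I at *
    generalize dSY s₀ s₁ U 2 r y = Fs at *
    generalize stream U r y = ψ at *
    generalize dY 1 (U r) y = G at *
    generalize dY 4 (U r) y = F4 at *
    generalize U r y = u at *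
    have hF2 : dY 2 (U r) y = 1 - (α + p * y ^ 2) := by linarith
    have hF3 : dY 3 (U r) y = -(2 * p * y) := by linarith
    rw [hF2, hF3, eq_div_iff hU.ne'] at hpar
    have hGu : G / u * u = G := div_mul_cancel₀ _ hU.ne'
    have hFs : u ^ 2 * Fs ≤ u ^ 2 * (b r * p * y ^ 2) :=
      mul_le_mul_of_nonneg_left (by linarith) (by positivity)
    have hF4 : -(p * 2) * u ≤ F4 * u := mul_le_mul_of_nonneg_right (by linarith) hU.le
    have e : (u * Fs + -(2 * p * y) * (3 * b r / 2 * ψ - (3 * b r / 2 * ψ - b r / 2 * y * u + u * I)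
        + G / u) - F4) * u
      = u ^ 2 * Fs - u ^ 2 * (b r * p * y ^ 2) + 2 * p * (y * u ^ 2 * I) - 2 * p * y * (G / u * u)
        - F4 * u := by ring
    rw [e, hGu] at hpar
    have hI' : 2 * p * (y * u ^ 2 * I) ≤ 2 * p * (y * G - u - y ^ 2 / 2) :=
      mul_le_mul_of_nonneg_left hI (by positivity)
    have hfin : (α + p * y ^ 2) ^ 2 ≤ α := by nlinarith
    have hpy : 0 < p * y ^ 2 := by positivity
    rcases hα with h0 | h0
    · rw [h0] at hfin; nlinarith
    · nlinarith

end IsRescaledSolution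

end Prandtl

namespace Prandtl

/-! ### Consequences of an energy bound at a fixed time -/

theorem dY_two_of_hasDerivWithinAt {f f' : ℝ → ℝ} {f'' y : ℝ} (hy : 0 ≤ y)
    (hf : ∀ᶠ z in 𝓝[Ici 0] y, HasDerivWithinAt f (f' z) (Ici 0) z)
    (hf' : HasDerivWithinAt f' f'' (Ici 0) y) : dY 2 f y = f'' := by
  have hud : UniqueDiffOn ℝ (Ici (0 : ℝ)) := uniqueDiffOn_Ici 0
  rw [dY, iteratedDerivWithin_succ, iteratedDerivWithin_one]
  have hev : derivWithin f (Ici 0) =ᶠ[𝓝[Ici 0] y] f' := by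
    filter_upwards [hf, self_mem_nhdsWithin] with z hz hz0 using hz.derivWithin (hud z hz0)
  rw [hev.derivWithin_eq (hev.self_of_nhdsWithin hy), hf'.derivWithin (hud y hy)]

theorem integral_sq_le_of_lintegral_le {D w k : ℝ → ℝ} {e Y c E : ℝ} (he : 0 < e) (heY : e ≤ Y)
    (hk : ContinuousOn k (Ioi 0)) (hD : ∀ z ∈ Ioc e Y, D z = k z) (hc : 0 < c)
    (hw : ∀ z ∈ Ioc e Y, c ≤ w z) (hE0 : 0 ≤ E)
    (hE : ∫⁻ z in Ioi (0 : ℝ), ENNReal.ofReal (D z ^ 2 * w z) ≤ ENNReal.ofReal E) :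
    ∫ z in e..Y, k z ^ 2 ≤ E / c := by
  have hkc : ContinuousOn (fun z => k z ^ 2 * c) (Icc e Y) :=
    ((hk.mono fun z hz => he.trans_le hz.1).pow 2).mul continuousOn_const
  have hint : IntegrableOn (fun z => k z ^ 2 * c) (Ioc e Y) :=
    (hkc.integrableOn_compact isCompact_Icc).mono_set Ioc_subset_Icc_self
  have h1 : ENNReal.ofReal (∫ z in Ioc e Y, k z ^ 2 * c) ≤ ENNReal.ofReal E := by
    rw [ofReal_integral_eq_lintegral_ofReal hint
      (Eventually.of_forall fun z => mul_nonneg (sq_nonneg _) hc.le)]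
    calc ∫⁻ z in Ioc e Y, ENNReal.ofReal (k z ^ 2 * c)
        ≤ ∫⁻ z in Ioc e Y, ENNReal.ofReal (D z ^ 2 * w z) := by
          refine setLIntegral_mono' measurableSet_Ioc fun z hz => ENNReal.ofReal_le_ofReal ?_
          rw [hD z hz]
          exact mul_le_mul_of_nonneg_left (hw z hz) (sq_nonneg _)
      _ ≤ ∫⁻ z in Ioi (0 : ℝ), ENNReal.ofReal (D z ^ 2 * w z) :=
          lintegral_mono_set fun z hz => he.trans hz.1
      _ ≤ _ := hE
  rw [ENNReal.ofReal_le_ofReal_iff hE0, ← intervalIntegral.integral_of_le heY,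
    intervalIntegral.integral_mul_const] at h1
  rwa [le_div_iff₀ hc]

/-- This is Cauchy–Schwarz in the form |f'| ≤ (f'²/A + A)/2, where A makes both halves contribute
equally. The integral starts at e > 0 since f' may be singular at 0. -/
theorem abs_le_of_integral_sq_deriv_le {f f' : ℝ → ℝ} {Y A : ℝ} (hY : 0 < Y) (hA : 0 < A)
    (hd : ∀ z > 0, HasDerivAt f (f' z) z) (hc : ContinuousOn f' (Ioi 0))
    (h0 : Tendsto f (𝓝[>] 0) (𝓝 0))
    (hE : ∀ e ∈ Ioo 0 Y, ∫ z in e..Y, f' z ^ 2 ≤ A ^ 2 * (1 + Y)) : |f Y| ≤ A * (1 + Y) := by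
  have h1 : ∀ e ∈ Ioo 0 Y, |f Y - f e| ≤ A * (1 + Y) := by
    intro e he
    have hcI : ContinuousOn f' (Icc e Y) := hc.mono fun z hz => he.1.trans_le hz.1
    have hcu : ContinuousOn f' (uIcc e Y) := by rwa [uIcc_of_le he.2.le]
    have hFTC : ∫ z in e..Y, f' z = f Y - f e :=
      intervalIntegral.integral_eq_sub_of_hasDerivAt (fun z hz => hd z (by
        rw [uIcc_of_le he.2.le] at hz; exact he.1.trans_le hz.1)) hcu.intervalIntegrable
    have hint : IntervalIntegrable (fun z => 1 / 2 * (A⁻¹ * f' z ^ 2 + A)) volume e Y :=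
      (((hcu.pow 2).const_mul A⁻¹ |>.add continuousOn_const).const_mul (1 / 2)).intervalIntegrable
    calc |f Y - f e| = |∫ z in e..Y, f' z| := by rw [hFTC]
      _ ≤ ∫ z in e..Y, |f' z| := intervalIntegral.abs_integral_le_integral_abs he.2.le
      _ ≤ ∫ z in e..Y, 1 / 2 * (A⁻¹ * f' z ^ 2 + A) := by
          refine intervalIntegral.integral_mono_on he.2.le hcu.abs.intervalIntegrable hint ?_
          intro z _
          have h2 : 0 ≤ A⁻¹ * (|f' z| - A) ^ 2 := by positivity
          have h3 : A⁻¹ * (|f' z| - A) ^ 2 = A⁻¹ * f' z ^ 2 - 2 * |f' z| + A := by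
            rw [sub_sq, sq_abs]; field_simp
          linarith
      _ = 1 / 2 * (A⁻¹ * (∫ z in e..Y, f' z ^ 2) + A * (Y - e)) := by
          have hsq : IntervalIntegrable (fun z => A⁻¹ * f' z ^ 2) volume e Y :=
            ((hcu.pow 2).const_mul A⁻¹).intervalIntegrable
          rw [intervalIntegral.integral_const_mul,
            intervalIntegral.integral_add hsq intervalIntegrable_const,
            intervalIntegral.integral_const_mul, intervalIntegral.integral_const, smul_eq_mul]
          ring
      _ ≤ 1 / 2 * (A⁻¹ * (A ^ 2 * (1 + Y)) + A * Y) := by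
          have := hE e he
          have := he.1
          gcongr
          linarith
      _ ≤ A * (1 + Y) := by
          have : A⁻¹ * (A ^ 2 * (1 + Y)) = A * (1 + Y) := by field_simp
          rw [this]; nlinarith
  have h2 : Tendsto (fun e => |f Y - f e|) (𝓝[>] 0) (𝓝 |f Y - 0|) :=
    (tendsto_const_nhds.sub h0).abs
  rw [sub_zero] at h2
  exact le_of_tendsto h2 (by filter_upwards [Ioo_mem_nhdsGT hY] with e he using h1 e he)

/-- Linear bootstrap: a perturbation of `u'' = 1 - f` which is small relative to `u`, `u'`. -/
theorem abs_le_of_linear_perturbation {u f v : ℝ → ℝ} {A L : ℝ} (hu : ContDiffOn ℝ 4 u (Ici 0))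
    (hu0 : u 0 = 0) (hu1 : dY 1 u 0 = 1) (hA : 0 < A) (hL : 0 ≤ L)
    (hAL : 4 * A * (1 + L) ^ 4 ≤ 1)
    (hf : ∀ z ∈ Icc 0 L, 0 ≤ f z ∧ f z ≤ 1) (huv : ∀ z ∈ Icc 0 L, dY 2 u z = 1 - f z + v z)
    (hv : ∀ z ∈ Icc 0 L, |v z| ≤ |u z| * (A * z * (1 + z)) + |dY 1 u z| * (A * z ^ 2 * (1 + z))) :
    ∀ z ∈ Icc 0 L, |v z| ≤ 4 * A * z ^ 2 * (1 + z) ^ 2 := by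
  have hc0 : ContinuousOn u (Icc 0 L) := hu.continuousOn.mono Icc_subset_Ici_self
  have hc1 : ContinuousOn (dY 1 u) (Icc 0 L) :=
    (continuousOn_dY_of_contDiffOn hu (by norm_num)).mono Icc_subset_Ici_self
  have hd0 : ∀ z > 0, HasDerivAt u (dY 1 u z) z := fun z hz => by
    have := hasDerivAt_dY hu (k := 0) (by norm_num) hz
    rwa [dY_zero] at this
  have hq : ContinuousOn (fun z => |dY 1 u z| / (1 + z)) (Icc 0 L) :=
    hc1.abs.div (by fun_prop) fun z hz => by have := hz.1; positivity
  obtain ⟨z₀, hz₀, hmax⟩ := isCompact_Icc.exists_isMaxOn (nonempty_Icc.2 hL) hq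
  -- The maximum m of |u'|/(1 + z) is bounded by a bootstrap. It gives |u| ≤ m z (1 + z), hence |v|
  -- ≤ m/2 by smallness of A. Integrating u'' = 1 - f + v yields m (1 + z₀) ≤ 1 + (1 + m/2) z₀, so m
  -- ≤ 2.
  set m := |dY 1 u z₀| / (1 + z₀) with hm
  have hm0 : 0 ≤ m := by have := hz₀.1; positivity
  have hu' : ∀ z ∈ Icc 0 L, |dY 1 u z| ≤ m * (1 + z) := fun z hz => by
    have h1 : |dY 1 u z| / (1 + z) ≤ m := hmax hz
    rwa [div_le_iff₀ (by linarith [hz.1])] at h1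
  have huz : ∀ z ∈ Icc 0 L, |u z| ≤ m * z * (1 + z) := by
    intro z hz
    have hsub : Icc 0 z ⊆ Icc 0 L := Icc_subset_Icc le_rfl hz.2
    refine abs_le_of_abs_deriv_le (g := fun z => m * z * (1 + z))
      (g' := fun z => m * 1 * (1 + z) + m * z * 1) hz.1 (hc0.mono hsub) (by fun_prop)
      (fun y hy => hd0 y hy.1) (fun y _ => ?_) (fun y hy => ?_) hu0 (by simp)
    · exact ((hasDerivAt_id y).const_mul m).mul ((hasDerivAt_id y).const_add 1)
    · have := hu' y (hsub (Ioo_subset_Icc_self hy))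
      have := mul_nonneg hm0 hy.1.le
      linarith
  have hvz : ∀ z ∈ Icc 0 L, |v z| ≤ 2 * m * A * z ^ 2 * (1 + z) ^ 2 := by
    intro z hz
    have hz0 := hz.1
    calc |v z| ≤ |u z| * (A * z * (1 + z)) + |dY 1 u z| * (A * z ^ 2 * (1 + z)) := hv z hz
      _ ≤ (m * z * (1 + z)) * (A * z * (1 + z)) + (m * (1 + z)) * (A * z ^ 2 * (1 + z)) := by
          have := huz z hz
          have := hu' z hz
          gcongr
      _ = _ := by ring
  have hvm : ∀ z ∈ Icc 0 L, |v z| ≤ m / 2 := by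
    intro z hz
    have hz0 := hz.1
    have h1 : z ^ 2 * (1 + z) ^ 2 ≤ (1 + L) ^ 4 := by
      calc z ^ 2 * (1 + z) ^ 2 ≤ (1 + L) ^ 2 * (1 + L) ^ 2 := by
            have := hz.2
            gcongr
            linarith
        _ = _ := by ring
    calc |v z| ≤ 2 * m * A * z ^ 2 * (1 + z) ^ 2 := hvz z hz
      _ = m / 2 * (4 * A * (z ^ 2 * (1 + z) ^ 2)) := by ring
      _ ≤ m / 2 * 1 := by
          refine mul_le_mul_of_nonneg_left ?_ (by positivity)
          exact (mul_le_mul_of_nonneg_left h1 (by positivity)).trans hAL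
      _ = m / 2 := mul_one _
  have hu1z : |dY 1 u z₀ - 1| ≤ (1 + m / 2) * z₀ := by
    have hsub : Icc 0 z₀ ⊆ Icc 0 L := Icc_subset_Icc le_rfl hz₀.2
    refine abs_le_of_abs_deriv_le (f := fun z => dY 1 u z - 1) (f' := dY 2 u)
      (g := fun z => (1 + m / 2) * z) (g' := fun _ => (1 + m / 2) * 1) hz₀.1
      ((hc1.mono hsub).sub continuousOn_const) (by fun_prop)
      (fun y hy => (hasDerivAt_dY hu (k := 1) (by norm_num) hy.1).sub_const 1)
      (fun y _ => (hasDerivAt_id y).const_mul _) (fun y hy => ?_) (by simp [hu1]) (by simp)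
    have hyL := hsub (Ioo_subset_Icc_self hy)
    have h1 := abs_le.1 (hvm y hyL)
    have h2 := hf y hyL
    rw [huv y hyL]
    exact abs_le.2 ⟨by linarith, by linarith⟩
  have hm2 : m ≤ 2 := by
    have h1 : |dY 1 u z₀| ≤ 1 + (1 + m / 2) * z₀ := by
      have := abs_sub_abs_le_abs_sub (dY 1 u z₀) 1
      rw [abs_one] at this
      linarith
    have h2 : m * (1 + z₀) = |dY 1 u z₀| := by
      rw [hm]; exact div_mul_cancel₀ _ (by linarith [hz₀.1])
    have := hz₀.1
    nlinarith
  intro z hz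
  refine (hvz z hz).trans ?_
  have hz0 := hz.1
  have : 0 ≤ A * z ^ 2 * (1 + z) ^ 2 := by positivity
  nlinarith

/-- With v = V'' and I = ∫₀^Y v/u², the function H = 𝓛_u V is (uI)'. The boundary values of u make H
and H' vanish at 0, so an L² bound on H'' gives |H'| ≤ A(1 + y), |H| ≤ Ay(1 + y) and |uI| ≤ Ay²(1 +
y). Then v = uH - u'(uI) is small relative to u and u', and the linear bootstrap applies. The
expansion of V is required up to some L' > L, so that derivatives at L are also identified. -/
theorem abs_second_deriv_sub_le_of_energy {u V w : ℝ → ℝ} {β c₅ c₈ c₉ A E N L L' : ℝ}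
    (hu : ContDiffOn ℝ 4 u (Ici 0)) (hu0 : u 0 = 0) (hu1 : dY 1 u 0 = 1) (hpos : ∀ z > 0, 0 < u z)
    (hu2 : dY 2 u 0 = 1) (hu3 : dY 3 u 0 = 0) (hu4 : dY 4 u 0 = -(β / 2))
    (hV : ∀ y ∈ Ico 0 L', V y = u y - (y + y ^ 2 / 2 - β / 48 * y ^ 4 - c₅ / 42 * y ^ 7
      - c₈ / 90 * y ^ 10 - c₉ / 110 * y ^ 11))
    (hA : 0 < A) (hL : 0 ≤ L) (hLL' : L < L') (hAL : 4 * A * (1 + L) ^ 4 ≤ 1)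
    (hf : ∀ z ∈ Icc 0 L, 0 ≤ β / 4 * z ^ 2 + c₅ * z ^ 5 + c₈ * z ^ 8 + c₉ * z ^ 9 ∧
      β / 4 * z ^ 2 + c₅ * z ^ 5 + c₈ * z ^ 8 + c₉ * z ^ 9 ≤ 1)
    (hN : 0 < N) (hw : ∀ z ∈ Ioc 0 L, (N * (1 + z))⁻¹ ≤ w z) (hE0 : 0 ≤ E) (hEN : E * N ≤ A ^ 2)
    (hE : ∫⁻ z in Ioi (0 : ℝ), ENNReal.ofReal (dY 2 (calL u V) z ^ 2 * w z) ≤ ENNReal.ofReal E) :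
    ∀ z ∈ Icc 0 L, |dY 2 u z - 1 + (β / 4 * z ^ 2 + c₅ * z ^ 5 + c₈ * z ^ 8 + c₉ * z ^ 9)|
      ≤ 4 * A * z ^ 2 * (1 + z) ^ 2 := by
  set f : ℝ → ℝ := fun z => β / 4 * z ^ 2 + c₅ * z ^ 5 + c₈ * z ^ 8 + c₉ * z ^ 9 with hfdef
  set f₁ : ℝ → ℝ := fun z => β / 2 * z + 5 * c₅ * z ^ 4 + 8 * c₈ * z ^ 7 + 9 * c₉ * z ^ 8
  set f₂ : ℝ → ℝ := fun z => β / 2 + 20 * c₅ * z ^ 3 + 56 * c₈ * z ^ 6 + 72 * c₉ * z ^ 7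
  have hpow : ∀ (c : ℝ) (n : ℕ) (z : ℝ),
      HasDerivAt (fun z => c * z ^ n) (c * (n * z ^ (n - 1))) z :=
    fun c n z => (hasDerivAt_pow n z).const_mul c
  have hfd : ∀ z, HasDerivAt f (f₁ z) z := fun z =>
    ((((hpow (β / 4) 2 z).add (hpow c₅ 5 z)).add (hpow c₈ 8 z)).add (hpow c₉ 9 z)).congr_deriv
      (by simp only [f₁]; norm_num; ring)
  have hf₁d : ∀ z, HasDerivAt f₁ (f₂ z) z := fun z =>
    (((((hasDerivAt_id z).const_mul (β / 2)).add (hpow (5 * c₅) 4 z)).add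
      (hpow (8 * c₈) 7 z)).add (hpow (9 * c₉) 8 z)).congr_deriv
      (by simp only [f₂]; norm_num; ring)
  have hf₂c : Continuous f₂ := by fun_prop
  have hfc : Continuous f := by fun_prop
  have hf₁c : Continuous f₁ := by fun_prop
  have hdu : ∀ z > 0, HasDerivAt u (dY 1 u z) z := fun z hz => by
    have := hasDerivAt_dY hu (k := 0) (by norm_num) hz
    rwa [dY_zero] at this
  have hduw : ∀ z ≥ 0, HasDerivWithinAt u (dY 1 u z) (Ici 0) z := fun z hz => by
    have := hasDerivWithinAt_dY hu (k := 0) (by norm_num) hz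
    rwa [dY_zero] at this
  have cdY : ∀ k ≤ 4, ContinuousOn (dY k u) (Ici 0) := fun k hk =>
    continuousOn_dY_of_contDiffOn hu hk
  have T : ∀ {k : ℝ → ℝ}, ContinuousOn k (Ici 0) → Tendsto k (𝓝[>] 0) (𝓝 (k 0)) := fun hk =>
    (hk 0 self_mem_Ici).mono_left (nhdsWithin_mono _ Ioi_subset_Ici_self)
  have tu : Tendsto u (𝓝[>] 0) (𝓝 0) := by have := T hu.continuousOn; rwa [hu0] at this
  have tu1 : Tendsto (dY 1 u) (𝓝[>] 0) (𝓝 1) := by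
    have := T (cdY 1 (by norm_num)); rwa [hu1] at this
  -- the perturbation and its derivatives
  set v : ℝ → ℝ := fun z => dY 2 u z - 1 + f z with hv
  set v₁ : ℝ → ℝ := fun z => dY 3 u z + f₁ z with hv₁
  set v₂ : ℝ → ℝ := fun z => dY 4 u z + f₂ z with hv₂
  have cv : ContinuousOn v (Ici 0) :=
    ((cdY 2 (by norm_num)).sub continuousOn_const).add hfc.continuousOn
  have cv₁ : ContinuousOn v₁ (Ici 0) := (cdY 3 (by norm_num)).add hf₁c.continuousOn
  have cv₂ : ContinuousOn v₂ (Ici 0) := (cdY 4 (by norm_num)).add hf₂c.continuousOn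
  have v0 : v 0 = 0 := by simp [hv, hu2, hfdef]
  have v₁0 : v₁ 0 = 0 := by simp [hv₁, hu3, f₁]
  have v₂0 : v₂ 0 = 0 := by simp [hv₂, hu4, f₂]
  have tv : Tendsto v (𝓝[>] 0) (𝓝 0) := by have := T cv; rwa [v0] at this
  have tv₁ : Tendsto v₁ (𝓝[>] 0) (𝓝 0) := by have := T cv₁; rwa [v₁0] at this
  have tv₂ : Tendsto v₂ (𝓝[>] 0) (𝓝 0) := by have := T cv₂; rwa [v₂0] at this
  have dv : ∀ z > 0, HasDerivAt v (v₁ z) z := fun z hz =>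
    ((hasDerivAt_dY hu (k := 2) (by norm_num) hz).sub_const 1).add (hfd z)
  have dv₁ : ∀ z > 0, HasDerivAt v₁ (v₂ z) z := fun z hz =>
    (hasDerivAt_dY hu (k := 3) (by norm_num) hz).add (hf₁d z)
  obtain ⟨tq₁, tq⟩ := tendsto_div_of_boundary hdu tu tu1 hpos dv dv₁ tv tv₁ tv₂
  have cu : ContinuousOn u (Ioi 0) := hu.continuousOn.mono Ioi_subset_Ici_self
  have hune : ∀ z ∈ Ioi (0 : ℝ), u z ≠ 0 := fun z hz => (hpos z hz).ne'
  have cq : ContinuousOn (fun z => v z / u z ^ 2) (Ioi 0) :=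
    (cv.mono Ioi_subset_Ici_self).div (cu.pow 2) fun z hz => pow_ne_zero _ (hune z hz)
  obtain ⟨-, dI, cI⟩ := primitive_of_tendsto cq tq
  set I : ℝ → ℝ := fun y => ∫ z in (0 : ℝ)..y, v z / u z ^ 2 with hI
  have I0 : I 0 = 0 := intervalIntegral.integral_same
  have tI : Tendsto I (𝓝[>] 0) (𝓝 0) := by have := T cI; rwa [I0] at this
  set H : ℝ → ℝ := fun y => dY 1 u y * I y + v y / u y with hH
  set H₁ : ℝ → ℝ := fun y => dY 2 u y * I y + v₁ y / u y with hH₁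
  set H₂ : ℝ → ℝ := fun y => dY 3 u y * I y + dY 2 u y * (v y / u y ^ 2)
    + (v₂ y * u y - v₁ y * dY 1 u y) / u y ^ 2 with hH₂
  have dH : ∀ y > 0, HasDerivAt H (H₁ y) y := by
    intro y hy
    have hne := hune y hy
    refine (((hasDerivAt_dY hu (k := 1) (by norm_num) hy).mul (dI y hy)).add
      ((dv y hy).div (hdu y hy) hne)).congr_deriv ?_
    simp only [hH₁]
    field_simp
    ring
  have dH₁ : ∀ y > 0, HasDerivAt H₁ (H₂ y) y := by
    intro y hy
    have hne := hune y hy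
    exact ((hasDerivAt_dY hu (k := 2) (by norm_num) hy).mul (dI y hy)).add
      ((dv₁ y hy).div (hdu y hy) hne)
  have M := fun {k : ℝ → ℝ} (hk : ContinuousOn k (Ici 0)) => hk.mono Ioi_subset_Ici_self
  have cH₂ : ContinuousOn H₂ (Ioi 0) :=
    (((M (cdY 3 (by norm_num))).mul (M cI)).add ((M (cdY 2 (by norm_num))).mul cq)).add
      ((((M cv₂).mul cu).sub ((M cv₁).mul (M (cdY 1 (by norm_num))))).div (cu.pow 2)
        fun z hz => pow_ne_zero _ (hune z hz))
  have tH₁ : Tendsto H₁ (𝓝[>] 0) (𝓝 0) := by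
    have := ((T (cdY 2 (by norm_num))).mul tI).add tq₁
    rwa [mul_zero, add_zero] at this
  have tvu : Tendsto (fun y => v y / u y) (𝓝[>] 0) (𝓝 0) := by
    have := tq.mul tu
    rw [mul_zero] at this
    refine this.congr' ?_
    filter_upwards [self_mem_nhdsWithin] with y hy
    have := hune y hy
    field_simp
  have tH : Tendsto H (𝓝[>] 0) (𝓝 0) := by
    have := (tu1.mul tI).add tvu
    rwa [mul_zero, add_zero] at this
  have H0 : H 0 = 0 := by simp [hH, I0, v0]
  have cH : ContinuousOn H (Ici 0) := by
    intro y hy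
    rcases (mem_Ici.1 hy).eq_or_lt with h0 | h0
    · subst h0
      rw [← continuousWithinAt_Ioi_iff_Ici, ContinuousWithinAt, H0]
      exact tH
    · exact (dH y h0).continuousAt.continuousWithinAt
  -- identification of `calL u V` near the boundary
  have hVd : ∀ y ∈ Ico 0 L', dY 2 V y = v y := by
    intro y hy
    set P : ℝ → ℝ := fun y => y + y ^ 2 / 2 - β / 48 * y ^ 4 - c₅ / 42 * y ^ 7
      - c₈ / 90 * y ^ 10 - c₉ / 110 * y ^ 11
    set P₁ : ℝ → ℝ := fun y => 1 + y - β / 12 * y ^ 3 - c₅ / 6 * y ^ 6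
      - c₈ / 9 * y ^ 9 - c₉ / 10 * y ^ 10
    have dP : ∀ z, HasDerivAt P (P₁ z) z := fun z =>
      ((((((hasDerivAt_id z).add ((hasDerivAt_pow 2 z).div_const 2)).sub (hpow (β / 48) 4 z)).sub
        (hpow (c₅ / 42) 7 z)).sub (hpow (c₈ / 90) 10 z)).sub (hpow (c₉ / 110) 11 z)).congr_deriv
        (by simp only [P₁]; norm_num; ring)
    have dP₁ : ∀ z, HasDerivAt P₁ (1 - f z) z := fun z =>
      ((((((hasDerivAt_id z).const_add 1).sub (hpow (β / 12) 3 z)).sub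
        (hpow (c₅ / 6) 6 z)).sub (hpow (c₈ / 9) 9 z)).sub (hpow (c₉ / 10) 10 z)).congr_deriv
        (by simp only [hfdef]; norm_num; ring)
    refine dY_two_of_hasDerivWithinAt (f' := fun z => dY 1 u z - P₁ z) hy.1 ?_ ?_
    · filter_upwards [self_mem_nhdsWithin, mem_nhdsWithin_of_mem_nhds (Iio_mem_nhds hy.2)]
        with z hz hz'
      refine ((hduw z hz).sub (dP z).hasDerivWithinAt).congr_of_eventuallyEq ?_ (hV z ⟨hz, hz'⟩)
      filter_upwards [self_mem_nhdsWithin, mem_nhdsWithin_of_mem_nhds (Iio_mem_nhds hz')]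
        with x hx hx' using hV x ⟨hx, hx'⟩
    · refine ((hasDerivWithinAt_dY hu (k := 1) (by norm_num) hy.1).sub
        (dP₁ y).hasDerivWithinAt).congr_deriv ?_
      simp only [hv]
      norm_num
      ring
  have hcalL : ∀ y ∈ Ico 0 L', calL u V y = H y := by
    intro y hy
    simp only [calL, Linv, hH, hI, hVd y hy]
    congr 2
    refine intervalIntegral.integral_congr fun z hz => ?_
    rw [uIcc_of_le hy.1] at hz
    simp only [hVd z ⟨hz.1, hz.2.trans_lt hy.2⟩]
  have hD : ∀ y ∈ Ioo 0 L', dY 2 (calL u V) y = H₂ y := by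
    intro y hy
    refine dY_two_of_hasDerivWithinAt (f' := H₁) hy.1.le ?_ (dH₁ y hy.1).hasDerivWithinAt
    filter_upwards [mem_nhdsWithin_of_mem_nhds (Ioo_mem_nhds hy.1 hy.2)] with z hz
    refine ((dH z hz.1).congr_of_eventuallyEq ?_).hasDerivWithinAt
    filter_upwards [Ioo_mem_nhds hz.1 hz.2] with x hx using hcalL x ⟨hx.1.le, hx.2⟩
  -- the energy bound
  have bH₁ : ∀ y ∈ Ioc 0 L, |H₁ y| ≤ A * (1 + y) := by
    intro y hy
    refine abs_le_of_integral_sq_deriv_le hy.1 hA dH₁ cH₂ tH₁ fun e he => ?_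
    have hy1 : 0 < 1 + y := by linarith [hy.1]
    refine (integral_sq_le_of_lintegral_le (c := (N * (1 + y))⁻¹) he.1 he.2.le cH₂
      (fun z hz => hD z ⟨he.1.trans hz.1, (hz.2.trans hy.2).trans_lt hLL'⟩) (by positivity)
      (fun z hz => ?_) hE0 hE).trans ?_
    · have hz0 : 0 < z := he.1.trans hz.1
      refine le_trans ?_ (hw z ⟨hz0, hz.2.trans hy.2⟩)
      have := hz.2
      gcongr
    · rw [div_inv_eq_mul, ← mul_assoc]
      exact mul_le_mul_of_nonneg_right hEN hy1.le
  have bH : ∀ y ∈ Icc 0 L, |H y| ≤ A * y * (1 + y) := by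
    intro y hy
    refine abs_le_of_abs_deriv_le (g := fun z => A * z * (1 + z))
      (g' := fun z => A * 1 * (1 + z) + A * z * 1) hy.1 (cH.mono Icc_subset_Ici_self) (by fun_prop)
      (fun z hz => dH z hz.1) (fun z _ => ?_) (fun z hz => ?_) H0 (by simp)
    · exact ((hasDerivAt_id z).const_mul A).mul ((hasDerivAt_id z).const_add 1)
    · have := bH₁ z ⟨hz.1, hz.2.le.trans hy.2⟩
      have := mul_pos hA hz.1
      linarith
  have bJ : ∀ y ∈ Icc 0 L, |u y * I y| ≤ A * y ^ 2 * (1 + y) := by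
    intro y hy
    refine abs_le_of_abs_deriv_le (f := fun y => u y * I y) (f' := H)
      (g := fun z => A * z ^ 2 * (1 + z))
      (g' := fun z => A * (2 * z) * (1 + z) + A * z ^ 2 * 1) hy.1
      ((hu.continuousOn.mul cI).mono Icc_subset_Ici_self) (by fun_prop)
      (fun z hz => ?_) (fun z _ => ?_) (fun z hz => ?_) (by simp [hu0]) (by simp)
    · have hne := hune z hz.1
      refine ((hdu z hz.1).mul (dI z hz.1)).congr_deriv ?_
      simp only [hH]
      field_simp
    · exact ((hpow A 2 z).congr_deriv (by norm_num)).mul ((hasDerivAt_id z).const_add 1)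
    · have h1 := bH z ⟨hz.1.le, hz.2.le.trans hy.2⟩
      have h2 : 0 ≤ A * z * (1 + z) + A * z ^ 2 := by have := hz.1; positivity
      linarith
  refine abs_le_of_linear_perturbation (v := v) hu hu0 hu1 hA hL hAL hf (fun z _ => by
    simp only [hv, hfdef]; ring) fun z hz => ?_
  rcases hz.1.eq_or_lt with h0 | h0
  · rw [← h0, v0]; simp [hu0]
  have hne := hune z h0
  have hid : v z = u z * H z - dY 1 u z * (u z * I z) := by
    simp only [hH]; field_simp; ring
  rw [hid]
  calc |u z * H z - dY 1 u z * (u z * I z)| ≤ |u z * H z| + |dY 1 u z * (u z * I z)| := abs_sub _ _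
    _ = |u z| * |H z| + |dY 1 u z| * |u z * I z| := by rw [abs_mul, abs_mul (dY 1 u z)]
    _ ≤ _ := by
        have := bH z hz
        have := bJ z hz
        gcongr

end Prandtl

namespace Prandtl

/-! ### The boundary layer `Y ≤ s^{1/4}` -/

theorem le_rpow_inv_of_pow_le {n : ℕ} (hn : n ≠ 0) {y s : ℝ} (hy : 0 ≤ y) (h : y ^ n ≤ s) :
    y ≤ s ^ ((n : ℝ)⁻¹) := by
  rw [← Real.pow_rpow_inv_natCast hy hn]
  exact Real.rpow_le_rpow (by positivity) h (by positivity)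

/-- The eighth root is the natural length unit: the boundary layer has width `(s^{1/8})²`. -/
theorem exists_eighth_root {s : ℝ} (hs : 0 < s) : ∃ x > 0, x ^ 8 = s :=
  ⟨s ^ (((8 : ℕ) : ℝ)⁻¹), Real.rpow_pos_of_pos hs _, Real.rpow_inv_natCast_pow hs.le (by norm_num)⟩

/-- With i = s^{-1/8}, the contributions of the Y⁷, Y¹⁰ and Y¹¹ corrections to U_YY are no larger
than the energy error as long as Y ≤ s^{1/4}. Only the quadratic term survives in the expansion. -/
theorem residual_coefficients_le {β i z : ℝ} (hi0 : 0 < i) (hi1 : i ≤ 1) (hβ0 : 0 < β)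
    (hβ : β ≤ 2 * i ^ 8) (hz0 : 0 ≤ z) (hz : i ^ 2 * z ≤ 1) :
    0 ≤ 42 * a₇ * β ^ 2 * z ^ 5 + 90 * a₁₀ * β ^ 3 * z ^ 8 + 110 * a₁₁ * β ^ 3 * z ^ 9 ∧
      42 * a₇ * β ^ 2 * z ^ 5 + 90 * a₁₀ * β ^ 3 * z ^ 8 + 110 * a₁₁ * β ^ 3 * z ^ 9
        ≤ i ^ 13 * z ^ 2 * (1 + z) ^ 2 / 8 := by
  have h14 : i ^ 14 ≤ i ^ 13 := pow_le_pow_of_le_one hi0.le hi1 (by norm_num)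
  have h16 : i ^ 16 ≤ i ^ 13 := pow_le_pow_of_le_one hi0.le hi1 (by norm_num)
  have p4 : (i ^ 2 * z) ^ 4 ≤ 1 := pow_le_one₀ (by positivity) hz
  have p5 : (i ^ 2 * z) ^ 5 ≤ 1 := pow_le_one₀ (by positivity) hz
  have b2 : β ^ 2 * z ≤ 4 * i ^ 13 := by
    calc β ^ 2 * z ≤ (2 * i ^ 8) ^ 2 * z := by gcongr
      _ = 4 * i ^ 14 * (i ^ 2 * z) := by ring
      _ ≤ 4 * i ^ 14 * 1 := by gcongr
      _ ≤ _ := by linarith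
  have b3 : β ^ 3 * z ^ 4 ≤ 8 * i ^ 13 := by
    calc β ^ 3 * z ^ 4 ≤ (2 * i ^ 8) ^ 3 * z ^ 4 := by gcongr
      _ = 8 * i ^ 16 * (i ^ 2 * z) ^ 4 := by ring
      _ ≤ 8 * i ^ 16 * 1 := by gcongr
      _ ≤ _ := by linarith
  have b4 : β ^ 3 * z ^ 5 ≤ 8 * i ^ 13 := by
    calc β ^ 3 * z ^ 5 ≤ (2 * i ^ 8) ^ 3 * z ^ 5 := by gcongr
      _ = 8 * i ^ 14 * (i ^ 2 * z) ^ 5 := by ring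
      _ ≤ 8 * i ^ 14 * 1 := by gcongr
      _ ≤ _ := by linarith
  have e7 : a₇ = 1 / 4032 := by norm_num [a₇, a₄]
  have e10 : a₁₀ = 27 / (16 * 90) * (1 / 4032) := by rw [a₁₀, e7]
  have e11 : a₁₁ = 3 / (16 * 110) * (1 / 4032) := by rw [a₁₁, e7]
  rw [e10, e11, e7]
  refine ⟨by positivity, ?_⟩
  have hz4 : z ^ 4 ≤ z ^ 2 * (1 + z) ^ 2 := by
    have : z ^ 4 = z ^ 2 * z ^ 2 := by ring
    rw [this]; gcongr; linarith
  calc 42 * (1 / 4032) * β ^ 2 * z ^ 5 + 90 * (27 / (16 * 90) * (1 / 4032)) * β ^ 3 * z ^ 8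
        + 110 * (3 / (16 * 110) * (1 / 4032)) * β ^ 3 * z ^ 9
      = (1 / 96 * (β ^ 2 * z) + 27 / 16 / 4032 * (β ^ 3 * z ^ 4)
        + 3 / 16 / 4032 * (β ^ 3 * z ^ 5)) * z ^ 4 := by ring
    _ ≤ (1 / 8 * i ^ 13) * z ^ 4 := by
        refine mul_le_mul_of_nonneg_right ?_ (by positivity)
        have : 0 < i ^ 13 := by positivity
        linarith
    _ ≤ (1 / 8 * i ^ 13) * (z ^ 2 * (1 + z) ^ 2) := by gcongr
    _ = _ := by ring

/-- Since β₁ > 1/4, the product s^{-β₁} z is at most 1 in the layer, and a < 1 gives z^{-a} ≥ 1/(1 +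
z). -/
theorem weight_lower_bound {a β₁ s z : ℝ} (m₁ : ℕ) (ha0 : 0 < a) (ha1 : a < 1) (hβ₁ : 1 / 4 < β₁)
    (hs : 1 ≤ s) (hz0 : 0 < z) (hz : z ≤ s ^ (1 / 4 : ℝ)) :
    (2 ^ m₁ * (1 + z))⁻¹ ≤ w₁ a β₁ m₁ s z := by
  have hs0 : 0 < s := by linarith
  have h1 : (1 + z)⁻¹ ≤ z ^ (-a) := by
    rw [Real.rpow_neg hz0.le]
    refine inv_anti₀ (Real.rpow_pos_of_pos hz0 a) ?_
    calc z ^ a ≤ (1 + z) ^ a := Real.rpow_le_rpow hz0.le (by linarith) ha0.le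
      _ ≤ (1 + z) ^ (1 : ℝ) := Real.rpow_le_rpow_of_exponent_le (by linarith) ha1.le
      _ = 1 + z := Real.rpow_one _
  have h2 : s ^ (-β₁) * z ≤ 1 := by
    calc s ^ (-β₁) * z ≤ s ^ (-(1 / 4 : ℝ)) * s ^ (1 / 4 : ℝ) := by
          refine mul_le_mul ?_ hz hz0.le (Real.rpow_nonneg hs0.le _)
          exact Real.rpow_le_rpow_of_exponent_le hs (by linarith)
      _ = 1 := by rw [← Real.rpow_add hs0]; norm_num
  have h3 : 0 ≤ s ^ (-β₁) * z := mul_nonneg (Real.rpow_nonneg hs0.le _) hz0.le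
  have h4 : ((2 : ℝ) ^ m₁)⁻¹ ≤ ((1 + s ^ (-β₁) * z) ^ m₁)⁻¹ := by
    refine inv_anti₀ (by positivity) ?_
    gcongr
    linarith
  rw [w₁, mul_inv, mul_comm]
  exact mul_le_mul h1 h4 (by positivity) (Real.rpow_nonneg hz0.le _)

/-- For Y < 2s^{1/4} both profiles are in their explicit range. The argument of χ is at most
2s^{-1/28} because 2/7 - 1/4 = 1/28, and that of Θ is at most 4s^{-1/4}, so Θ/b contributes Y²/2. -/
theorem Uapp_eq_of_le {χ Θ : ℝ → ℝ} {r c s β y x : ℝ} (hχ : ∀ ξ ∈ Icc 0 r, χ ξ = 1)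
    (hΘ : ∀ ξ ∈ Icc 0 c, Θ ξ = ξ ^ 2 / 2) (hx : 0 < x) (hxs : x ^ 8 = s) (hr : 0 < r) (hc : 0 < c)
    (hsr : (2 / r) ^ 28 ≤ s) (hsc : (4 / c) ^ 4 ≤ s) (hβ0 : 0 < β) (hβ : β ≤ 2 / s) (hy0 : 0 ≤ y)
    (hy : y < 2 * x ^ 2) :
    Uapp χ Θ s β y = y + y ^ 2 / 2 - β / 48 * y ^ 4 - a₇ * β ^ 2 * y ^ 7 - a₁₀ * β ^ 3 * y ^ 10
      - a₁₁ * β ^ 3 * y ^ 11 := by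
  have hs : 0 < s := by rw [← hxs]; positivity
  have hx2 : x ^ 2 = s ^ (1 / 4 : ℝ) := by
    rw [← hxs, ← Real.rpow_natCast x 8, ← Real.rpow_mul hx.le, ← Real.rpow_natCast]
    norm_num
  have h27 : s ^ (2 / 7 : ℝ) = x ^ 2 * s ^ (((28 : ℕ) : ℝ)⁻¹) := by
    rw [hx2, ← Real.rpow_add hs]; norm_num
  have hsr' : 2 / r ≤ s ^ (((28 : ℕ) : ℝ)⁻¹) :=
    le_rpow_inv_of_pow_le (by norm_num) (by positivity) hsr
  have hsc' : 4 / c ≤ x ^ 2 := by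
    have := le_rpow_inv_of_pow_le (n := 4) (by norm_num) (by positivity) hsc
    rw [hx2]
    convert this using 2
    norm_num
  have h1 : χ (y / s ^ (2 / 7 : ℝ)) = 1 := by
    refine hχ _ ⟨by positivity, ?_⟩
    rw [div_le_iff₀ (by positivity), h27]
    rw [div_le_iff₀ hr] at hsr'
    have : 2 * x ^ 2 ≤ r * (x ^ 2 * s ^ (((28 : ℕ) : ℝ)⁻¹)) := by nlinarith [sq_nonneg x]
    linarith
  have h2 : Θ (√β * y) = (√β * y) ^ 2 / 2 := by
    refine hΘ _ ⟨by positivity, ?_⟩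
    have h3 : √β ≤ 2 / x ^ 4 := by
      refine Real.sqrt_le_iff.2 ⟨by positivity, hβ.trans ?_⟩
      rw [← hxs, div_pow, div_le_div_iff₀ (by positivity) (by positivity)]
      nlinarith [pow_pos hx 8]
    calc √β * y ≤ 2 / x ^ 4 * (2 * x ^ 2) := by gcongr
      _ = 4 / x ^ 2 := by field_simp; norm_num
      _ ≤ c := by
          rw [div_le_iff₀ hc] at hsc'
          rw [div_le_iff₀ (by positivity)]
          linarith
  rw [Uapp, h1, h2, mul_pow, Real.sq_sqrt hβ0.le, a₄]
  field_simp
  ring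

theorem exists_boundary_layer_estimate {χ Θ : ℝ → ℝ} (hχ : IsCutoff χ) (hΘ : IsOuterProfile Θ)
    {C₁ β₁ : ℝ} (m₁ : ℕ) (hC₁ : 0 < C₁) (hβ₁ : 1 / 4 < β₁) :
    ∃ S B : ℝ, 1 ≤ S ∧ 0 < B ∧ ∀ (a s₀ s₁ : ℝ) (b : ℝ → ℝ) (U : ℝ → ℝ → ℝ) (Uinf : ℝ → ℝ),
      0 < a → a < 1 → S ≤ s₀ → s₀ < s₁ → IsRescaledSolution s₀ s₁ b U Uinf →
      (∀ s ∈ Icc s₀ s₁, 0 < b s ∧ b s ≤ 2 / s) →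
      (∀ s ∈ Icc s₀ s₁, E₁ χ Θ a β₁ m₁ b U s ≤ ENNReal.ofReal (C₁ * s ^ (-(13 / 4) : ℝ))) →
      ∀ s ∈ Icc s₀ s₁, ∀ x > 0, x ^ 8 = s → ∀ Y ∈ Icc 0 (x ^ 2),
        |dY 2 (U s) Y - 1 + b s / 4 * Y ^ 2| ≤ B * x⁻¹ ^ 13 * Y ^ 2 * (1 + Y) ^ 2 := by
  obtain ⟨r, hr, hχr⟩ := hχ.eq_one
  obtain ⟨c, hc, hΘc⟩ := hΘ.eq_sq
  set A₁ := √(2 ^ m₁ * C₁) with hA₁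
  have hA₁0 : 0 < A₁ := Real.sqrt_pos.2 (by positivity)
  -- The middle summands put χ and Θ in their explicit range. The last one gives s^{1/8} ≥ 64A₁ + 1,
  -- which is the smallness 4A(1 + L)⁴ ≤ 1 for A = A₁ s^{-13/8} and L = s^{1/4}.
  refine ⟨1 + (2 / r) ^ 28 + (4 / c) ^ 4 + (64 * A₁ + 1) ^ 8, 4 * A₁ + 1, ?_, by positivity, ?_⟩
  · have h1 : 0 ≤ (2 / r) ^ 28 + (4 / c) ^ 4 + (64 * A₁ + 1) ^ 8 := by positivity
    linarith
  intro a s₀ s₁ b U Uinf ha0 ha1 hS hlt h hb hE s hs x hx hxs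
  have hSs := hS.trans hs.1
  have q1 : 0 ≤ (2 / r) ^ 28 := by positivity
  have q2 : 0 ≤ (4 / c) ^ 4 := by positivity
  have q3 : 0 ≤ (64 * A₁ + 1) ^ 8 := by positivity
  have hs1 : 1 ≤ s := by linarith
  have hs0 : 0 < s := by linarith
  have hxA : 64 * A₁ + 1 ≤ x := by
    have : (64 * A₁ + 1) ^ 8 ≤ x ^ 8 := by rw [hxs]; linarith
    exact le_of_pow_le_pow_left₀ (by norm_num) hx.le this
  have hx1 : 1 ≤ x := by linarith
  obtain ⟨hb0, hb2⟩ := hb s hs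
  set i := x⁻¹ with hi
  have hi0 : 0 < i := by positivity
  have hi1 : i ≤ 1 := inv_le_one_of_one_le₀ hx1
  have hix : i * x = 1 := inv_mul_cancel₀ hx.ne'
  have hbi : b s ≤ 2 * i ^ 8 := by
    rwa [hi, inv_pow, hxs, ← div_eq_mul_inv]
  have hiz : ∀ z ≤ x ^ 2, i ^ 2 * z ≤ 1 := fun z hz => by
    calc i ^ 2 * z ≤ i ^ 2 * x ^ 2 := by gcongr
      _ = (i * x) ^ 2 := by ring
      _ = 1 := by rw [hix]; norm_num
  have hx2 : x ^ 2 = s ^ (1 / 4 : ℝ) := by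
    rw [← hxs, ← Real.rpow_natCast x 8, ← Real.rpow_mul hx.le, ← Real.rpow_natCast]
    norm_num
  have hEs : s ^ (-(13 / 4) : ℝ) = i ^ 26 := by
    rw [← hxs, ← Real.rpow_natCast x 8, ← Real.rpow_mul hx.le, hi, inv_pow, ← Real.rpow_natCast,
      ← Real.rpow_neg hx.le]
    norm_num
  obtain ⟨e2, e3, e4⟩ := h.boundary_values hlt hs
  have hres := fun z (hz : z ∈ Icc 0 (x ^ 2)) =>
    residual_coefficients_le hi0 hi1 hb0 hbi hz.1 (hiz z hz.2)
  have key := abs_second_deriv_sub_le_of_energy (u := U s)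
    (V := fun y => U s y - Uapp χ Θ s (b s) y) (w := w₁ a β₁ m₁ s) (β := b s)
    (c₅ := 42 * a₇ * b s ^ 2) (c₈ := 90 * a₁₀ * b s ^ 3) (c₉ := 110 * a₁₁ * b s ^ 3)
    (A := A₁ * i ^ 13) (E := C₁ * i ^ 26) (N := 2 ^ m₁) (L := x ^ 2) (L' := 2 * x ^ 2)
    (h.contDiffOn s hs) (h.zero s hs) (h.slope s hs) (h.pos s hs) e2 e3 e4
    (fun y hy => by
      rw [Uapp_eq_of_le hχr hΘc hx hxs hr hc (by linarith) (by linarith) hb0 hb2 hy.1 hy.2]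
      ring)
    (by positivity) (by positivity) (by nlinarith [sq_nonneg x]) ?_ ?_ (by positivity)
    (fun z hz => weight_lower_bound m₁ ha0 ha1 hβ₁ hs1 hz.1 (by rw [← hx2]; exact hz.2))
    (by positivity) ?_ ?_
  · intro Y hY
    obtain ⟨r0, r1⟩ := hres Y hY
    have k1 := key Y hY
    have hY0 := hY.1
    have e : dY 2 (U s) Y - 1 + b s / 4 * Y ^ 2
        = (dY 2 (U s) Y - 1 + (b s / 4 * Y ^ 2 + 42 * a₇ * b s ^ 2 * Y ^ 5
          + 90 * a₁₀ * b s ^ 3 * Y ^ 8 + 110 * a₁₁ * b s ^ 3 * Y ^ 9))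
        - (42 * a₇ * b s ^ 2 * Y ^ 5 + 90 * a₁₀ * b s ^ 3 * Y ^ 8
          + 110 * a₁₁ * b s ^ 3 * Y ^ 9) := by ring
    rw [e]
    refine (abs_sub _ _).trans ?_
    rw [abs_of_nonneg r0]
    have : 0 ≤ i ^ 13 * Y ^ 2 * (1 + Y) ^ 2 := by positivity
    linarith
  · have h1 : (1 + x ^ 2) ^ 4 ≤ (2 * x ^ 2) ^ 4 := by gcongr; nlinarith
    calc 4 * (A₁ * i ^ 13) * (1 + x ^ 2) ^ 4 ≤ 4 * (A₁ * i ^ 13) * (2 * x ^ 2) ^ 4 := by gcongr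
      _ = 64 * A₁ * i ^ 5 * (i * x) ^ 8 := by ring
      _ = 64 * A₁ * i ^ 5 := by rw [hix]; ring
      _ ≤ 64 * A₁ * i ^ 1 := by
          gcongr 64 * A₁ * ?_
          exact pow_le_pow_of_le_one hi0.le hi1 (by norm_num)
      _ ≤ x * i := by rw [pow_one]; gcongr; linarith
      _ = 1 := by rw [mul_comm, hix]
  · intro z hz
    obtain ⟨r0, r1⟩ := hres z hz
    have hz0 := hz.1
    have h1 := hiz z hz.2
    have h2 : b s * z ^ 2 ≤ 2 := by
      calc b s * z ^ 2 ≤ 2 * i ^ 8 * z ^ 2 := by gcongr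
        _ = 2 * i ^ 4 * (i ^ 2 * z) ^ 2 := by ring
        _ ≤ 2 * 1 * 1 := by
            gcongr
            · exact pow_le_one₀ hi0.le hi1
            · exact pow_le_one₀ (by positivity) h1
        _ = 2 := by norm_num
    have h3 : i ^ 13 * z ^ 2 * (1 + z) ^ 2 ≤ 4 := by
      have h4 : i ^ 2 * (1 + z) ≤ 2 := by
        have : i ^ 2 ≤ 1 := pow_le_one₀ hi0.le hi1
        linarith
      calc i ^ 13 * z ^ 2 * (1 + z) ^ 2 = i ^ 5 * (i ^ 2 * z) ^ 2 * (i ^ 2 * (1 + z)) ^ 2 := by ring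
        _ ≤ 1 * 1 * 2 ^ 2 := by
            gcongr
            · exact pow_le_one₀ hi0.le hi1
            · exact pow_le_one₀ (by positivity) h1
        _ = 4 := by norm_num
    constructor
    · have : 0 ≤ b s / 4 * z ^ 2 := by positivity
      linarith
    · linarith
  · rw [mul_pow, hA₁, Real.sq_sqrt (by positivity)]
    exact le_of_eq (by ring)
  · have := hE s hs
    rw [hEs] at this
    exact this

end Prandtl

namespace Prandtl

/-! ### The modulation rate -/

set_option maxHeartbeats 1000000 in
/-- At a fixed time, an expansion of `U_YY` in the boundary layer controls `U` and the right-hand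
side of the equation for `U_s` at the edge `L` of the layer. -/
theorem edge_estimates {u I : ℝ → ℝ} {β B i L : ℝ} (hu : ContDiffOn ℝ 4 u (Ici 0)) (hu0 : u 0 = 0)
    (hu1 : dY 1 u 0 = 1) (hB : 0 < B) (hi0 : 0 < i) (hi1 : i ≤ 1) (hiB : 8 * B * i ≤ 1)
    (hiL : i ^ 2 * L = 1) (hβ0 : 0 < β) (hβ : β ≤ 2 * i ^ 8)
    (hF : ∀ z ∈ Icc 0 L, |dY 2 u z - 1 + β / 4 * z ^ 2| ≤ B * i ^ 13 * z ^ 2 * (1 + z) ^ 2)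
    (hI : ∀ z > 0, HasDerivAt I ((dY 2 u z - 1) / u z ^ 2) z) (hIc : ContinuousOn I (Ici 0))
    (hI0 : I 0 = 0) :
    |u L - L - L ^ 2 / 2 + β * L ^ 4 / 48| ≤ B / 3 * i ∧
      |β * u L - β / 2 * L * dY 1 u L + dY 1 u L * I L + (dY 2 u L - 1) / u L
        + β * (u L - L - L ^ 2 / 2)| ≤ (60 * B + 14) * i ^ 9 := by
  have hL1 : 1 ≤ L := by
    have : i ^ 2 ≤ 1 := pow_le_one₀ hi0.le hi1
    have : 0 < L := by
      by_contra! h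
      have : i ^ 2 * L ≤ 0 := mul_nonpos_of_nonneg_of_nonpos (by positivity) h
      linarith
    nlinarith
  have hL0 : 0 < L := by linarith
  have hd0 : ∀ z > 0, HasDerivAt u (dY 1 u z) z := fun z hz => by
    have := hasDerivAt_dY hu (k := 0) (by norm_num) hz
    rwa [dY_zero] at this
  have hd1 : ∀ z > 0, HasDerivAt (dY 1 u) (dY 2 u z) z := fun z hz =>
    hasDerivAt_dY hu (k := 1) (by norm_num) hz
  have hc0 : ContinuousOn u (Ici 0) := hu.continuousOn
  have hc1 : ContinuousOn (dY 1 u) (Ici 0) := continuousOn_dY_of_contDiffOn hu (by norm_num)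
  have hpow : ∀ (c : ℝ) (n : ℕ) (z : ℝ),
      HasDerivAt (fun z => c * z ^ n) (c * (n * z ^ (n - 1))) z :=
    fun c n z => (hasDerivAt_pow n z).const_mul c
  -- coarse bound on the second derivative
  have hθ : ∀ z ∈ Icc 0 L, B * i ^ 13 * z ^ 2 * (1 + z) ^ 2 ≤ 4 * B * i ^ 9 * z ^ 2 := by
    intro z hz
    have hz0 := hz.1
    have h1 : i ^ 2 * (1 + z) ≤ 2 := by
      have : i ^ 2 ≤ 1 := pow_le_one₀ hi0.le hi1
      have : i ^ 2 * z ≤ i ^ 2 * L := mul_le_mul_of_nonneg_left hz.2 (by positivity)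
      linarith
    calc B * i ^ 13 * z ^ 2 * (1 + z) ^ 2 = B * i ^ 9 * z ^ 2 * (i ^ 2 * (1 + z)) ^ 2 := by ring
      _ ≤ B * i ^ 9 * z ^ 2 * 2 ^ 2 := by gcongr
      _ = _ := by ring
  have hδ : ∀ z ∈ Icc 0 L, |dY 2 u z - 1 + β / 4 * z ^ 2| ≤ 4 * B * i ^ 9 * z ^ 2 := fun z hz =>
    (hF z hz).trans (hθ z hz)
  have hδ8 : 4 * B * i ^ 9 ≤ i ^ 8 / 2 := by
    have : 4 * B * i ^ 9 = i ^ 8 / 2 * (8 * B * i) := by ring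
    rw [this]
    nlinarith [pow_pos hi0 8]
  -- integrated bounds
  have hG : ∀ z ∈ Icc 0 L, |dY 1 u z - 1 - z + β / 12 * z ^ 3| ≤ 4 / 3 * B * i ^ 9 * z ^ 3 := by
    intro z hz
    refine abs_le_of_abs_deriv_le (f := fun z => dY 1 u z - 1 - z + β / 12 * z ^ 3)
      (f' := fun z => dY 2 u z - 1 + β / 4 * z ^ 2) (g := fun z => 4 / 3 * B * i ^ 9 * z ^ 3)
      (g' := fun z => 4 * B * i ^ 9 * z ^ 2) hz.1 ?_ (by fun_prop) (fun y hy => ?_) (fun y _ => ?_)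
      (fun y hy => hδ y ⟨hy.1.le, hy.2.le.trans hz.2⟩) (by simp [hu1]) (by simp)
    · exact (((hc1.mono Icc_subset_Ici_self).sub continuousOn_const).sub continuousOn_id).add
        (by fun_prop)
    · exact ((((hd1 y hy.1).sub_const 1).sub (hasDerivAt_id y)).add
        (hpow (β / 12) 3 y)).congr_deriv (by norm_num; ring)
    · exact (hpow (4 / 3 * B * i ^ 9) 3 y).congr_deriv (by norm_num; ring)
  have hR : ∀ z ∈ Icc 0 L, |u z - z - z ^ 2 / 2 + β / 48 * z ^ 4| ≤ B / 3 * i ^ 9 * z ^ 4 := by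
    intro z hz
    refine abs_le_of_abs_deriv_le (f := fun z => u z - z - z ^ 2 / 2 + β / 48 * z ^ 4)
      (f' := fun z => dY 1 u z - 1 - z + β / 12 * z ^ 3) (g := fun z => B / 3 * i ^ 9 * z ^ 4)
      (g' := fun z => 4 / 3 * B * i ^ 9 * z ^ 3) hz.1 ?_ (by fun_prop) (fun y hy => ?_)
      (fun y _ => ?_) (fun y hy => hG y ⟨hy.1.le, hy.2.le.trans hz.2⟩) (by simp [hu0]) (by simp)
    · exact (((hc0.mono Icc_subset_Ici_self).sub continuousOn_id).sub (by fun_prop)).add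
        (by fun_prop)
    · exact ((((hd0 y hy.1).sub (hasDerivAt_id y)).sub ((hasDerivAt_pow 2 y).div_const 2)).add
        (hpow (β / 48) 4 y)).congr_deriv (by norm_num; ring)
    · exact (hpow (B / 3 * i ^ 9) 4 y).congr_deriv (by norm_num; ring)
  have hRc : ∀ z ∈ Icc 0 L, |u z - z - z ^ 2 / 2| ≤ i ^ 8 * z ^ 4 / 12 := by
    intro z hz
    have h1 := abs_le.1 (hR z hz)
    have hz4 : 0 ≤ z ^ 4 := by have := hz.1; positivity
    have h2 : β / 48 * z ^ 4 ≤ i ^ 8 / 24 * z ^ 4 := mul_le_mul_of_nonneg_right (by linarith) hz4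
    have h3 : B / 3 * i ^ 9 * z ^ 4 ≤ i ^ 8 / 24 * z ^ 4 :=
      mul_le_mul_of_nonneg_right (by linarith) hz4
    have h4 : 0 ≤ β / 48 * z ^ 4 := by positivity
    exact abs_le.2 ⟨by linarith, by linarith⟩
  have hGc : |dY 1 u L - 1 - L| ≤ i ^ 2 / 3 := by
    have h1 := abs_le.1 (hG L ⟨hL0.le, le_rfl⟩)
    have e : i ^ 8 * L ^ 3 = i ^ 2 := by
      calc i ^ 8 * L ^ 3 = i ^ 2 * (i ^ 2 * L) ^ 3 := by ring
        _ = i ^ 2 := by rw [hiL]; ring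
    have h2 : β / 12 * L ^ 3 ≤ i ^ 8 / 6 * L ^ 3 :=
      mul_le_mul_of_nonneg_right (by linarith) (by positivity)
    have h3 : 4 / 3 * B * i ^ 9 * L ^ 3 ≤ i ^ 8 / 6 * L ^ 3 :=
      mul_le_mul_of_nonneg_right (by linarith) (by positivity)
    have h4 : 0 ≤ β / 12 * L ^ 3 := by positivity
    exact abs_le.2 ⟨by linarith, by linarith⟩
  -- comparison of `u` with `z + z² / 2`
  have hRz : ∀ z ∈ Icc 0 L, i ^ 8 * z ^ 4 ≤ z ^ 2 := by
    intro z hz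
    have h1 : i ^ 2 * z ≤ 1 := hiL ▸ mul_le_mul_of_nonneg_left hz.2 (by positivity)
    have hz0 := hz.1
    calc i ^ 8 * z ^ 4 = i ^ 4 * (i ^ 2 * z) ^ 2 * z ^ 2 := by ring
      _ ≤ 1 * 1 * z ^ 2 := by
          gcongr
          · exact pow_le_one₀ hi0.le hi1
          · exact pow_le_one₀ (by positivity) h1
      _ = z ^ 2 := by ring
  have hulow : ∀ z ∈ Icc 0 L, (z + z ^ 2 / 2) / 2 ≤ u z ∧ u z ≤ 3 / 2 * (z + z ^ 2 / 2) := by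
    intro z hz
    have h1 := abs_le.1 (hRc z hz)
    have h2 := hRz z hz
    have hz0 := hz.1
    have : 0 ≤ z ^ 2 := by positivity
    exact ⟨by linarith, by linarith⟩
  -- the integral term
  have hIest : |I L + β / 2 * (L / (2 + L))| ≤ (16 * B * i ^ 13 + 4 * i ^ 16) * L := by
    refine abs_le_of_abs_deriv_le (f := fun z => I z + β / 2 * (z / (2 + z)))
      (f' := fun z => (dY 2 u z - 1) / u z ^ 2 + β / 2 * ((1 * (2 + z) - z * 1) / (2 + z) ^ 2))
      (g := fun z => (16 * B * i ^ 13 + 4 * i ^ 16) * z)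
      (g' := fun _ => (16 * B * i ^ 13 + 4 * i ^ 16) * 1) hL0.le ?_ (by fun_prop)
      (fun y hy => ?_) (fun y _ => (hasDerivAt_id y).const_mul _) (fun y hy => ?_)
      (by simp [hI0]) (by simp)
    · refine (hIc.mono Icc_subset_Ici_self).add (continuousOn_const.mul ?_)
      exact continuousOn_id.div (by fun_prop) fun z hz => by have := hz.1; positivity
    · have hy2 : (2 : ℝ) + y ≠ 0 := by have := hy.1; positivity
      exact (hI y hy.1).add (((hasDerivAt_id y).div ((hasDerivAt_id y).const_add 2) hy2).const_mul _)
    · have hy0 := hy.1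
      have hyI : y ∈ Icc 0 L := Ioo_subset_Icc_self hy
      obtain ⟨l1, l2⟩ := hulow y hyI
      set u₀ := y + y ^ 2 / 2 with hu₀
      have hu₀0 : 0 < u₀ := by positivity
      have huy : 0 < u y := by linarith
      set e := dY 2 u y - 1 + β / 4 * y ^ 2 with he
      -- To leading order (u'' - 1)/u² is -(β/4)y²/(y + y²/2)² = -β/(2 + y)², the derivative of
      -- -(β/2) y/(2 + y). The two terms are the errors of the numerator and of the denominator.
      have hsplit : (dY 2 u y - 1) / u y ^ 2 + β / 2 * ((1 * (2 + y) - y * 1) / (2 + y) ^ 2)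
          = e / u y ^ 2 + β / 4 * y ^ 2 * ((u y - u₀) * (u y + u₀) / (u y ^ 2 * u₀ ^ 2)) := by
        have h1 : (1 * (2 + y) - y * 1) / (2 + y) ^ 2 = y ^ 2 / (2 * u₀ ^ 2) := by
          rw [hu₀]; field_simp; ring
        rw [h1, he]
        field_simp
        ring
      rw [hsplit]
      have b1 : |e / u y ^ 2| ≤ 16 * B * i ^ 13 := by
        rw [abs_div, abs_of_pos (by positivity : 0 < u y ^ 2), div_le_iff₀ (by positivity)]
        refine (hF y hyI).trans ?_
        have h1 : y * (1 + y) ≤ 4 * u y := by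
          have : 0 ≤ y := hy0.le
          linarith [hu₀]
        calc B * i ^ 13 * y ^ 2 * (1 + y) ^ 2 = B * i ^ 13 * (y * (1 + y)) ^ 2 := by ring
          _ ≤ B * i ^ 13 * (4 * u y) ^ 2 := by gcongr
          _ = _ := by ring
      have b2 : |β / 4 * y ^ 2 * ((u y - u₀) * (u y + u₀) / (u y ^ 2 * u₀ ^ 2))| ≤ 4 * i ^ 16 := by
        rw [abs_mul, abs_div, abs_mul (u y - u₀), abs_of_pos (by positivity : 0 < β / 4 * y ^ 2),
          abs_of_pos (by positivity : 0 < u y + u₀),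
          abs_of_pos (by positivity : 0 < u y ^ 2 * u₀ ^ 2), ← mul_div_assoc,
          div_le_iff₀ (by positivity)]
        have h1 : |u y - u₀| ≤ i ^ 8 * y ^ 4 / 12 := by
          have := hRc y hyI
          rwa [show u y - y - y ^ 2 / 2 = u y - u₀ by rw [hu₀]; ring] at this
        have h2 : y ^ 2 ≤ 2 * u₀ := by linarith [hu₀]
        calc β / 4 * y ^ 2 * (|u y - u₀| * (u y + u₀))
            ≤ (2 * i ^ 8) / 4 * y ^ 2 * ((i ^ 8 * y ^ 4 / 12) * (5 / 2 * u₀)) := by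
              gcongr
              linarith
          _ = 5 / 48 * i ^ 16 * (y ^ 2) ^ 3 * u₀ := by ring
          _ ≤ 5 / 48 * i ^ 16 * (2 * u₀) ^ 3 * u₀ := by gcongr
          _ = 4 * i ^ 16 * (5 / 24 * u₀ ^ 2 * u₀ ^ 2) := by ring
          _ ≤ 4 * i ^ 16 * (u y ^ 2 * u₀ ^ 2) := by
              have h3 : (u₀ / 2) ^ 2 ≤ u y ^ 2 := by gcongr
              have h4 : 5 / 24 * u₀ ^ 2 ≤ u y ^ 2 := by nlinarith
              gcongr
      calc _ ≤ |e / u y ^ 2|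
            + |β / 4 * y ^ 2 * ((u y - u₀) * (u y + u₀) / (u y ^ 2 * u₀ ^ 2))| := abs_add_le _ _
        _ ≤ _ := by linarith
  -- values at the edge
  have hLI : L ∈ Icc 0 L := ⟨hL0.le, le_rfl⟩
  have hL4 : i ^ 8 * L ^ 4 = 1 := by
    calc i ^ 8 * L ^ 4 = (i ^ 2 * L) ^ 4 := by ring
      _ = 1 := by rw [hiL]; norm_num
  have hRL := hR L hLI
  have e4 : B / 3 * i ^ 9 * L ^ 4 = B / 3 * i := by
    calc B / 3 * i ^ 9 * L ^ 4 = B / 3 * i * (i ^ 8 * L ^ 4) := by ring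
      _ = _ := by rw [hL4, mul_one]
  rw [e4] at hRL
  refine ⟨by convert hRL using 2; ring, ?_⟩
  set R := u L - L - L ^ 2 / 2 with hRdef
  set G₁ := dY 1 u L - 1 - L with hG₁
  set e := dY 2 u L - 1 + β / 4 * L ^ 2 with he
  set D := I L + β / 2 * (L / (2 + L)) with hD
  obtain ⟨l1, l2⟩ := hulow L hLI
  set u₀ := L + L ^ 2 / 2 with hu₀
  have hu₀0 : 0 < u₀ := by positivity
  have huL : 0 < u L := by linarith
  have hL2 : (0 : ℝ) < 2 + L := by linarith
  -- For u ≈ L + L²/2 the first two terms give βL/2, cancelled by u' I and (u'' - 1)/u, which total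
  -- -(β/2)(L/(2 + L))(2 + L). At next order, 2(-βL⁴/48) + (L/2)(βL³/12) = 0. The remaining terms
  -- are all O(i⁹).
  have hsplit : β * u L - β / 2 * L * dY 1 u L + dY 1 u L * I L + (dY 2 u L - 1) / u L
        + β * (u L - L - L ^ 2 / 2)
      = β * (2 * (R + β / 48 * L ^ 4) - L / 2 * (G₁ + β / 12 * L ^ 3)) + dY 1 u L * D
        - G₁ * (β / 2 * (L / (2 + L))) + e / u L + β / 4 * L ^ 2 * (R / (u L * u₀)) := by
    have h1 : u L = R + (L + L ^ 2 / 2) := by rw [hRdef]; ring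
    have h2 : dY 1 u L = G₁ + 1 + L := by rw [hG₁]; ring
    have h3 : (dY 2 u L - 1) / u L = e / u L - β / 4 * L ^ 2 * (1 / u L) := by rw [he]; ring
    have h4 : I L = D - β / 2 * (L / (2 + L)) := by rw [hD]; ring
    have h5 : β / 4 * L ^ 2 * (R / (u L * u₀))
        = β / 2 * (L / (2 + L)) - β / 4 * L ^ 2 * (1 / u L) := by
      have h6 : R = u L - u₀ := by rw [hRdef, hu₀]; ring
      have h7 : β / 2 * (L / (2 + L)) = β / 4 * L ^ 2 * (1 / u₀) := by
        rw [hu₀]; field_simp; ring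
      rw [h6, h7]; field_simp
    have h7 : β / 2 * (L / (2 + L)) * (2 + L) = β / 2 * L := by field_simp
    rw [h3, h5, h4, h2]
    linear_combination 2 * β * h1 - h7
  rw [hsplit]
  have hi910 : i ^ 10 ≤ i ^ 9 := pow_le_pow_of_le_one hi0.le hi1 (by norm_num)
  have hi912 : i ^ 12 ≤ i ^ 9 := pow_le_pow_of_le_one hi0.le hi1 (by norm_num)
  have t1 : |β * (2 * (R + β / 48 * L ^ 4) - L / 2 * (G₁ + β / 12 * L ^ 3))| ≤ 3 * B * i ^ 9 := by
    have hGL := hG L hLI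
    rw [← hG₁] at hGL
    have hGL' : |L / 2 * (G₁ + β / 12 * L ^ 3)| ≤ 2 / 3 * B * i := by
      rw [abs_mul, abs_of_pos (by positivity : 0 < L / 2)]
      calc L / 2 * |G₁ + β / 12 * L ^ 3| ≤ L / 2 * (4 / 3 * B * i ^ 9 * L ^ 3) := by gcongr
        _ = 2 / 3 * B * i * (i ^ 8 * L ^ 4) := by ring
        _ = _ := by rw [hL4, mul_one]
    have a1 := abs_le.1 hRL
    have a2 := abs_le.1 hGL'
    rw [abs_mul, abs_of_pos hβ0]
    calc β * |2 * (R + β / 48 * L ^ 4) - L / 2 * (G₁ + β / 12 * L ^ 3)|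
        ≤ (2 * i ^ 8) * (4 / 3 * B * i) := by
          gcongr
          exact abs_le.2 ⟨by linarith, by linarith⟩
      _ = 8 / 3 * B * i ^ 9 := by ring
      _ ≤ 3 * B * i ^ 9 := by gcongr; norm_num
  have t2 : |dY 1 u L * D| ≤ (48 * B + 12) * i ^ 9 := by
    have hdY : |dY 1 u L| ≤ 3 * L := by
      have a1 := abs_le.1 hGc
      have : i ^ 2 ≤ 1 := pow_le_one₀ hi0.le hi1
      exact abs_le.2 ⟨by linarith, by linarith⟩
    rw [abs_mul]
    calc |dY 1 u L| * |D| ≤ (3 * L) * ((16 * B * i ^ 13 + 4 * i ^ 16) * L) := by gcongr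
      _ = (48 * B * i ^ 9 + 12 * i ^ 12) * (i ^ 2 * L) ^ 2 := by ring
      _ = 48 * B * i ^ 9 + 12 * i ^ 12 := by rw [hiL]; ring
      _ ≤ _ := by linarith
  have t3 : |G₁ * (β / 2 * (L / (2 + L)))| ≤ i ^ 9 := by
    have hq : L / (2 + L) ≤ 1 := by rw [div_le_one hL2]; linarith
    rw [abs_mul, abs_of_pos (by positivity : 0 < β / 2 * (L / (2 + L)))]
    calc |G₁| * (β / 2 * (L / (2 + L))) ≤ (i ^ 2 / 3) * ((2 * i ^ 8) / 2 * 1) := by gcongr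
      _ = i ^ 10 / 3 := by ring
      _ ≤ i ^ 9 := by have := pow_pos hi0 10; linarith
  have t4 : |e / u L| ≤ 8 * B * i ^ 9 := by
    rw [abs_div, abs_of_pos huL, div_le_iff₀ huL]
    have h1 : L * (1 + L) ≤ 4 * u L := by linarith [hu₀]
    calc |e| ≤ B * i ^ 13 * L ^ 2 * (1 + L) ^ 2 := hF L hLI
      _ = B * i ^ 13 * (L * (1 + L)) * (L * (1 + L)) := by ring
      _ ≤ B * i ^ 13 * (L * (L + L)) * (4 * u L) := by gcongr
      _ = 8 * B * i ^ 9 * (i ^ 2 * L) ^ 2 * u L := by ring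
      _ = _ := by rw [hiL]; ring
  have t5 : |β / 4 * L ^ 2 * (R / (u L * u₀))| ≤ i ^ 9 := by
    rw [abs_mul, abs_div, abs_of_pos (by positivity : 0 < β / 4 * L ^ 2),
      abs_of_pos (by positivity : 0 < u L * u₀), ← mul_div_assoc, div_le_iff₀ (by positivity)]
    have h1 : |R| ≤ i ^ 8 * L ^ 4 / 12 := hRc L hLI
    have h2 : L ^ 4 ≤ 8 * (u L * u₀) := by
      have h3 : L ^ 2 ≤ 4 * u L := by linarith [hu₀]
      have h4 : L ^ 2 ≤ 2 * u₀ := by linarith [hu₀]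
      calc L ^ 4 = L ^ 2 * L ^ 2 := by ring
        _ ≤ (4 * u L) * (2 * u₀) := by gcongr
        _ = _ := by ring
    calc β / 4 * L ^ 2 * |R| ≤ (2 * i ^ 8) / 4 * L ^ 2 * (i ^ 8 * (8 * (u L * u₀)) / 12) := by
          gcongr
          exact h1.trans (by gcongr)
      _ = 1 / 3 * i ^ 12 * (i ^ 2 * L) ^ 2 * (u L * u₀) := by ring
      _ = 1 / 3 * i ^ 12 * (u L * u₀) := by rw [hiL]; ring
      _ ≤ i ^ 9 * (u L * u₀) := by
          gcongr
          have := pow_pos hi0 12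
          linarith
  rw [abs_le] at t1 t2 t3 t4 t5 ⊢
  constructor <;> linarith [t1.1, t1.2, t2.1, t2.2, t3.1, t3.2, t4.1, t4.2, t5.1, t5.2]

end Prandtl

/-! ### Near constancy of b exp(∫b) and the comparison rate. -/

namespace Prandtl

/-- The expansion of `U_YY` in the boundary layer `Y ≤ s^{1/4}`, with constant `B`. -/
def BoundaryLayerExpansion (B s₀ s₁ : ℝ) (b : ℝ → ℝ) (U : ℝ → ℝ → ℝ) : Prop :=
  ∀ s ∈ Icc s₀ s₁, ∀ x > 0, x ^ 8 = s → ∀ Y ∈ Icc 0 (x ^ 2),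
    |dY 2 (U s) Y - 1 + b s / 4 * Y ^ 2| ≤ B * x⁻¹ ^ 13 * Y ^ 2 * (1 + Y) ^ 2

namespace IsRescaledSolution

variable {s₀ s₁ : ℝ} {b : ℝ → ℝ} {U : ℝ → ℝ → ℝ} {Uinf : ℝ → ℝ}

/-- Over a time window of bounded ratio, `b exp (∫ b)` is almost constant. -/
theorem abs_rate_mul_exp_sub_le (h : IsRescaledSolution s₀ s₁ b U Uinf) (hlt : s₀ < s₁)
    (hb : ∀ s ∈ Icc s₀ s₁, 1 / (2 * s) ≤ b s ∧ b s ≤ 2 / s) {B : ℝ} (hB : 0 < B)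
    (hin : BoundaryLayerExpansion B s₀ s₁ b U) {p : ℝ → ℝ} (hpc : ContinuousOn p (Icc s₀ s₁))
    (hpd : ∀ s ∈ Ioo s₀ s₁, HasDerivAt p (b s) s) {x r s : ℝ} (hx1 : 1 ≤ x) (hxB : 8 * B ≤ x)
    (hxr : x ^ 8 = r) (hr : r ∈ Icc s₀ s₁) (hs : s ∈ Icc s₀ s₁) (hrs : r ≤ s)
    (hs256 : s ≤ 256 * r) :
    |b s * Real.exp (p s - p r) - b r|
      ≤ 48 * Real.exp 510 * (255 * (60 * B + 14) + B) * x⁻¹ ^ 9 := by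
  have hx0 : 0 < x := by linarith
  set i := x⁻¹ with hi
  have hi0 : 0 < i := by positivity
  have hi1 : i ≤ 1 := inv_le_one_of_one_le₀ hx1
  have hix : i * x = 1 := inv_mul_cancel₀ hx0.ne'
  set L := x ^ 2 with hL
  have hiL : i ^ 2 * L = 1 := by rw [hL, ← mul_pow, hix, one_pow]
  have hL0 : 0 < L := by positivity
  have hr0 : 0 < r := by rw [← hxr]; positivity
  have hir : i ^ 8 * r = 1 := by rw [← hxr, ← mul_pow, hix, one_pow]
  have hiB : 8 * B * i ≤ 1 := by
    calc 8 * B * i ≤ x * i := by gcongr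
      _ = 1 := by rw [mul_comm, hix]
  have hsub : Icc r s ⊆ Icc s₀ s₁ := Icc_subset_Icc hr.1 hs.2
  -- estimates at each time of the window
  have hedge : ∀ t ∈ Icc r s,
      |U t L - L - L ^ 2 / 2 + b t * L ^ 4 / 48| ≤ B / 3 * i ∧
      |b t * U t L - b t / 2 * L * dY 1 (U t) L
        + dY 1 (U t) L * (∫ z in (0 : ℝ)..L, (dY 2 (U t) z - 1) / U t z ^ 2)
        + (dY 2 (U t) L - 1) / U t L + b t * (U t L - L - L ^ 2 / 2)|
        ≤ (60 * B + 14) * i ^ 9 := by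
    intro t ht
    have htI := hsub ht
    have ht0 : 0 < t := hr0.trans_le ht.1
    obtain ⟨y, hy, hyt⟩ := exists_eighth_root ht0
    have hxy : x ≤ y := le_of_pow_le_pow_left₀ (n := 8) (by norm_num) hy.le (by
      rw [hyt, hxr]; exact ht.1)
    obtain ⟨hb1, hb2⟩ := hb t htI
    obtain ⟨-, dI, cI⟩ := h.primitive_div_sq hlt htI
    refine edge_estimates (I := fun y => ∫ z in (0 : ℝ)..y, (dY 2 (U t) z - 1) / U t z ^ 2)
      (h.contDiffOn t htI) (h.zero t htI) (h.slope t htI) hB hi0 hi1 hiB hiL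
      (lt_of_lt_of_le (by positivity) hb1) ?_ ?_ dI cI intervalIntegral.integral_same
    · refine hb2.trans ?_
      rw [div_le_iff₀ ht0]
      have : i ^ 8 * r ≤ i ^ 8 * t := mul_le_mul_of_nonneg_left ht.1 (by positivity)
      linarith
    · intro z hz
      have hz0 := hz.1
      refine (hin t htI y hy hyt z ⟨hz.1, hz.2.trans (by rw [hL]; gcongr)⟩).trans ?_
      have : y⁻¹ ≤ i := by rw [hi]; gcongr
      gcongr
  -- The window has length at most 255r and b ≤ 2/r on it, so ∫b ≤ 510.
  have hexp : ∀ t ∈ Icc r s, Real.exp (p t - p r) ≤ Real.exp 510 := by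
    intro t ht
    refine Real.exp_le_exp.2 ?_
    rcases ht.1.eq_or_lt with h0 | h0
    · rw [← h0, sub_self]; norm_num
    have hsub' : Icc r t ⊆ Icc s₀ s₁ := (Icc_subset_Icc le_rfl ht.2).trans hsub
    obtain ⟨ζ, hζ, e⟩ := exists_hasDerivAt_eq_slope p b h0 (hpc.mono hsub') fun y hy =>
      hpd y ⟨(hsub' ⟨le_rfl, h0.le⟩).1.trans_lt hy.1, hy.2.trans_le (hsub' ⟨h0.le, le_rfl⟩).2⟩
    rw [eq_div_iff (by linarith)] at e
    rw [← e]
    have h2 : b ζ ≤ 2 / r := (hb ζ (hsub' (Ioo_subset_Icc_self hζ))).2.trans (by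
      have := hζ.1
      gcongr)
    calc b ζ * (t - r) ≤ 2 / r * (255 * r) := by
          gcongr
          linarith [ht.2]
      _ = 510 := by field_simp; norm_num
  -- the mean value theorem for `(U - L - L² / 2) exp (∫ b)`
  set D : ℝ → ℝ := fun t => (U t L - L - L ^ 2 / 2) * Real.exp (p t - p r) with hD
  have hDiff : |D s - D r| ≤ 255 * (60 * B + 14) * Real.exp 510 * i := by
    rcases hrs.eq_or_lt with h0 | h0
    · rw [h0, sub_self, abs_zero]; positivity
    have hUc : ContinuousOn (fun t => U t L) (Icc r s) := by
      have := (h.continuousOn_dY_left (k := 0) (by norm_num) hL0.le).mono hsub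
      simpa only [dY_zero] using this
    have hDc : ContinuousOn D (Icc r s) :=
      ((hUc.sub continuousOn_const).sub continuousOn_const).mul
        (((hpc.mono hsub).sub continuousOn_const).rexp)
    have hIoo : Ioo r s ⊆ Ioo s₀ s₁ := Ioo_subset_Ioo hr.1 hs.2
    obtain ⟨ζ, hζ, e⟩ := exists_hasDerivAt_eq_slope D
      (fun t => dSY s₀ s₁ U 0 t L * Real.exp (p t - p r)
        + (U t L - L - L ^ 2 / 2) * (Real.exp (p t - p r) * b t)) h0 hDc (fun t ht => by
        exact (((h.hasDerivAt_U_s (hIoo ht) hL0.le).sub_const L).sub_const (L ^ 2 / 2)).mul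
          (((hpd t (hIoo ht)).sub_const (p r)).exp))
    rw [eq_div_iff (by linarith)] at e
    rw [← e, abs_mul, abs_of_pos (by linarith : 0 < s - r)]
    have hζ' := Ioo_subset_Icc_self hζ
    have k1 := (hedge ζ hζ').2
    have k2 := hexp ζ hζ'
    rw [h.dSY_eq hlt (hIoo hζ) hL0]
    have k3 : |(b ζ * U ζ L - b ζ / 2 * L * dY 1 (U ζ) L
        + dY 1 (U ζ) L * (∫ z in (0 : ℝ)..L, (dY 2 (U ζ) z - 1) / U ζ z ^ 2)
        + (dY 2 (U ζ) L - 1) / U ζ L) * Real.exp (p ζ - p r)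
        + (U ζ L - L - L ^ 2 / 2) * (Real.exp (p ζ - p r) * b ζ)|
        ≤ (60 * B + 14) * i ^ 9 * Real.exp 510 := by
      have e1 : ∀ X Z E c : ℝ, X * E + Z * (E * c) = (X + c * Z) * E := by intros; ring
      rw [e1, abs_mul, abs_of_pos (Real.exp_pos _)]
      gcongr
    calc _ ≤ (60 * B + 14) * i ^ 9 * Real.exp 510 * (255 * r) := by
          gcongr
          linarith
      _ = 255 * (60 * B + 14) * Real.exp 510 * i * (i ^ 8 * r) := by ring
      _ = _ := by rw [hir, mul_one]
  -- conclusion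
  have a1 := (hedge s ⟨hrs, le_rfl⟩).1
  have a2 := (hedge r ⟨le_rfl, hrs⟩).1
  have hE := hexp s ⟨hrs, le_rfl⟩
  have hE1 : 1 ≤ Real.exp 510 := Real.one_le_exp (by norm_num)
  have a1' : |(U s L - L - L ^ 2 / 2 + b s * L ^ 4 / 48) * Real.exp (p s - p r)|
      ≤ B / 3 * i * Real.exp 510 := by
    rw [abs_mul, abs_of_pos (Real.exp_pos _)]
    gcongr
  have hDr : D r = U r L - L - L ^ 2 / 2 := by simp [hD]
  have hL4 : i ^ 8 * L ^ 4 = 1 := by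
    calc i ^ 8 * L ^ 4 = (i ^ 2 * L) ^ 4 := by ring
      _ = 1 := by rw [hiL]; norm_num
  -- Since i⁸L⁴ = 1, the edge values of U read off b after multiplication by 48i⁸. An error O(i) in
  -- U thus becomes O(i⁹) in b, smaller than b ~ i⁸ by a factor i.
  have hid : b s * Real.exp (p s - p r) - b r
      = 48 * i ^ 8 * ((U s L - L - L ^ 2 / 2 + b s * L ^ 4 / 48) * Real.exp (p s - p r)
        - (U r L - L - L ^ 2 / 2 + b r * L ^ 4 / 48) - (D s - D r)) := by
    rw [hDr]
    simp only [hD]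
    linear_combination (-(b s * Real.exp (p s - p r)) + b r) * hL4
  rw [hid, abs_mul, abs_of_pos (by positivity : 0 < 48 * i ^ 8)]
  have hBi : 0 < B * i := by positivity
  have k : |(U s L - L - L ^ 2 / 2 + b s * L ^ 4 / 48) * Real.exp (p s - p r)
        - (U r L - L - L ^ 2 / 2 + b r * L ^ 4 / 48) - (D s - D r)|
      ≤ Real.exp 510 * (255 * (60 * B + 14) + B) * i := by
    have a2' : B / 3 * i ≤ B / 3 * i * Real.exp 510 :=
      le_mul_of_one_le_right (by positivity) hE1
    have hpos : 0 ≤ B / 3 * i * Real.exp 510 := by positivity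
    have b1 := abs_le.1 a1'
    have b2 := abs_le.1 a2
    have b3 := abs_le.1 hDiff
    exact abs_le.2 ⟨by linarith, by linarith⟩
  calc _ ≤ 48 * i ^ 8 * (Real.exp 510 * (255 * (60 * B + 14) + B) * i) := by gcongr
    _ = _ := by ring

end IsRescaledSolution

theorem abs_log_le_of_abs_sub_one_le {q e : ℝ} (he : e ≤ 1 / 2) (h : |q - 1| ≤ e) :
    |Real.log q| ≤ 2 * e := by
  obtain ⟨h1, h2⟩ := abs_le.1 h
  have hq : 0 < q := by linarith
  have he0 : 0 ≤ e := (abs_nonneg _).trans h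
  have h3 := Real.log_le_sub_one_of_pos hq
  have h4 := Real.one_sub_inv_le_log_of_pos hq
  have h5 : q⁻¹ ≤ 1 + 2 * e := by
    rw [inv_le_iff_one_le_mul₀ hq]
    nlinarith
  exact abs_le.2 ⟨by linarith, by linarith⟩

/-- The modulation rate is comparable to an exact solution `g` of `g' = -b g`. -/
theorem exists_comparison_rate {B : ℝ} (hB : 0 < B) :
    ∃ S : ℝ, ∀ (s₀ s₁ : ℝ) (b : ℝ → ℝ) (U : ℝ → ℝ → ℝ) (Uinf : ℝ → ℝ), 1 ≤ s₀ → S ≤ s₀ →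
      s₀ < s₁ → IsRescaledSolution s₀ s₁ b U Uinf →
      (∀ s ∈ Icc s₀ s₁, 1 / (2 * s) ≤ b s ∧ b s ≤ 2 / s) →
      BoundaryLayerExpansion B s₀ s₁ b U →
      ∃ g : ℝ → ℝ, ContinuousOn g (Icc s₀ s₁) ∧
        (∀ s ∈ Ioo s₀ s₁, HasDerivAt g (-(b s * g s)) s) ∧
        ∀ s ∈ Icc s₀ s₁, b s / 2 ≤ g s ∧ g s ≤ 2 * b s := by
  set C := 48 * Real.exp 510 * (255 * (60 * B + 14) + B) with hC
  have hC0 : 0 < C := by positivity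
  -- With x = s₀^{1/8}, the condition x ≥ 8B allows the window estimate, and x ≥ 16C makes the sum
  -- 8C/x of all window errors at most 1/2 < log 2.
  refine ⟨(8 * B + 16 * C + 1) ^ 8, ?_⟩
  intro s₀ s₁ b U Uinf hs1 hS hlt h hb hin
  have hs₀ : 0 < s₀ := by linarith
  obtain ⟨x, hx, hxs⟩ := exists_eighth_root hs₀
  have hxC : 8 * B + 16 * C + 1 ≤ x :=
    le_of_pow_le_pow_left₀ (n := 8) (by norm_num) hx.le (by rw [hxs]; exact hS)
  have hb0 : ∀ s ∈ Icc s₀ s₁, 0 < b s := fun s hs => by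
    have : 0 < s := hs₀.trans_le hs.1
    exact lt_of_lt_of_le (by positivity) (hb s hs).1
  -- a primitive of `b`
  set bE := IccExtend hlt.le ((Icc s₀ s₁).domRestrict b)
  have hbEc : Continuous bE := h.b_continuousOn.domRestrict.Icc_extend'
  have hbE : ∀ s ∈ Icc s₀ s₁, bE s = b s := fun s hs => IccExtend_of_mem hlt.le _ hs
  set p : ℝ → ℝ := fun s => ∫ t in s₀..s, bE t with hp
  have hpd' : ∀ s, HasDerivAt p (bE s) s := fun s =>
    (hbEc.integral_hasStrictDerivAt s₀ s).hasDerivAt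
  have hpd : ∀ s ∈ Ioo s₀ s₁, HasDerivAt p (b s) s := fun s hs => by
    rw [← hbE s (Ioo_subset_Icc_self hs)]; exact hpd' s
  have hpc : Continuous p := continuous_iff_continuousAt.2 fun s => (hpd' s).continuousAt
  have hp0 : p s₀ = 0 := intervalIntegral.integral_same
  -- This is the logarithm of b exp(∫b), so multiplicative errors of successive windows add up.
  set c : ℝ → ℝ := fun s => Real.log (b s) + p s with hc
  have hs₀I : s₀ ∈ Icc s₀ s₁ := ⟨le_rfl, hlt.le⟩
  -- one window
  have hstep : ∀ y ≥ x, ∀ r ∈ Icc s₀ s₁, y ^ 8 = r → ∀ s ∈ Icc s₀ s₁, r ≤ s → s ≤ 256 * r →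
      |c s - c r| ≤ 4 * C * y⁻¹ := by
    intro y hyx r hr hyr s hs hrs hs256
    have hy0 : 0 < y := hx.trans_le hyx
    have hr0 : 0 < r := hs₀.trans_le hr.1
    have k := h.abs_rate_mul_exp_sub_le hlt hb hB hin hpc.continuousOn hpd (x := y)
      (by linarith) (by linarith) hyr hr hs hrs hs256
    rw [← hC] at k
    have hbr := hb0 r hr
    have hbs := hb0 s hs
    have hyr' : y⁻¹ ^ 8 ≤ 2 * b r := by
      have := (hb r hr).1
      rw [div_le_iff₀ (by positivity)] at this
      rw [inv_pow, hyr, inv_le_iff_one_le_mul₀ hr0]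
      linarith
    have hq : |b s * Real.exp (p s - p r) / b r - 1| ≤ 2 * C * y⁻¹ := by
      have : b s * Real.exp (p s - p r) / b r - 1 = (b s * Real.exp (p s - p r) - b r) / b r := by
        field_simp
      rw [this, abs_div, abs_of_pos hbr, div_le_iff₀ hbr]
      calc _ ≤ C * y⁻¹ ^ 9 := k
        _ = C * y⁻¹ * y⁻¹ ^ 8 := by ring
        _ ≤ C * y⁻¹ * (2 * b r) := by gcongr
        _ = _ := by ring
    have hlog : Real.log (b s * Real.exp (p s - p r) / b r) = c s - c r := by
      rw [Real.log_div (by positivity) hbr.ne', Real.log_mul hbs.ne' (Real.exp_ne_zero _),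
        Real.log_exp]
      simp only [hc]
      ring
    rw [← hlog]
    refine (abs_log_le_of_abs_sub_one_le ?_ hq).trans (le_of_eq (by ring))
    rw [← div_eq_mul_inv, div_le_iff₀ hy0]
    linarith
  -- geometric chain of windows
  have hchain : ∀ n : ℕ, ∀ s ∈ Icc s₀ s₁, s ≤ 256 ^ n * s₀ →
      |c s - c s₀| ≤ 8 * C * x⁻¹ * (1 - (1 / 2) ^ n) := by
    intro n
    induction n with
    | zero =>
      intro s hs hle
      have : s = s₀ := le_antisymm (by simpa using hle) hs.1
      simp [this]
    | succ n ih =>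
      intro s hs hle
      have hCx : 0 < C * x⁻¹ := by positivity
      have hhalf : (0 : ℝ) < (1 / 2) ^ n := by positivity
      have hsucc : ((1 : ℝ) / 2) ^ (n + 1) = (1 / 2) ^ n / 2 := by ring
      rcases le_or_gt s (256 ^ n * s₀) with h1 | h1
      · refine (ih s hs h1).trans ?_
        rw [hsucc]
        gcongr
        linarith
      · set r := 256 ^ n * s₀ with hr
        have h256 : (1 : ℝ) ≤ 256 ^ n := one_le_pow₀ (by norm_num)
        have hrI : r ∈ Icc s₀ s₁ := ⟨by rw [hr]; nlinarith, h1.le.trans hs.2⟩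
        have h2n : (1 : ℝ) ≤ 2 ^ n := one_le_pow₀ (by norm_num)
        have k1 := ih r hrI le_rfl
        -- Since 256 = 2⁸, multiplying time by 256 doubles the eighth root and halves the window
        -- error.
        have k2 := hstep (2 ^ n * x) (by nlinarith) r hrI (by
          rw [mul_pow, hxs, hr, ← pow_mul, mul_comm n 8, pow_mul]; norm_num) s hs h1.le (by
          rw [hr]; calc s ≤ 256 ^ (n + 1) * s₀ := hle
            _ = _ := by ring)
        have k3 : (2 ^ n * x)⁻¹ = x⁻¹ * (1 / 2) ^ n := by
          rw [mul_inv, one_div, inv_pow]; ring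
        rw [k3] at k2
        calc |c s - c s₀| ≤ |c s - c r| + |c r - c s₀| := abs_sub_le _ _ _
          _ ≤ 4 * C * (x⁻¹ * (1 / 2) ^ n) + 8 * C * x⁻¹ * (1 - (1 / 2) ^ n) := add_le_add k2 k1
          _ = _ := by rw [hsucc]; ring
  have hcs : ∀ s ∈ Icc s₀ s₁, |c s - c s₀| ≤ Real.log 2 := by
    intro s hs
    obtain ⟨n, hn⟩ := pow_unbounded_of_one_lt (s / s₀) (by norm_num : (1 : ℝ) < 256)
    rw [div_lt_iff₀ hs₀] at hn
    refine (hchain n s hs hn.le).trans ?_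
    have h1 : 8 * C * x⁻¹ ≤ 1 / 2 := by
      rw [← div_eq_mul_inv, div_le_iff₀ hx]; linarith
    have h2 : (0 : ℝ) < (1 / 2) ^ n := by positivity
    have h3 : 0 < 8 * C * x⁻¹ := by positivity
    have := Real.log_two_gt_d9
    nlinarith
  refine ⟨fun s => b s₀ * Real.exp (-p s), ?_, ?_, ?_⟩
  · exact (continuous_const.mul (Real.continuous_exp.comp hpc.neg)).continuousOn
  · intro s hs
    exact (((hpd s hs).neg.exp).const_mul (b s₀)).congr_deriv (by
      rw [Pi.neg_apply]; ring)
  · intro s hs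
    have hbs := hb0 s hs
    have hb00 := hb0 s₀ hs₀I
    have hg : b s₀ * Real.exp (-p s) = b s * Real.exp (c s₀ - c s) := by
      simp only [hc, hp0]
      rw [show Real.log (b s₀) + 0 - (Real.log (b s) + p s)
        = Real.log (b s₀) + -Real.log (b s) + -p s by ring, Real.exp_add, Real.exp_add,
        Real.exp_log hb00, Real.exp_neg (Real.log _), Real.exp_log hbs]
      field_simp
    obtain ⟨k1, k2⟩ := abs_le.1 (hcs s hs)
    have u1 : Real.exp (c s₀ - c s) ≤ 2 := by
      rw [← Real.exp_log (by norm_num : (0 : ℝ) < 2)]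
      exact Real.exp_le_exp.2 (by linarith)
    have u2 : 1 / 2 ≤ Real.exp (c s₀ - c s) := by
      rw [← Real.exp_log (by norm_num : (0 : ℝ) < 1 / 2), one_div, Real.log_inv]
      exact Real.exp_le_exp.2 (by linarith)
    simp only [hg]
    constructor <;> nlinarith

end Prandtl

/-! ### Bounds for Y ≤ 1, bounds for Y ≥ 1, and the conclusion. -/

namespace Prandtl

namespace BoundaryLayerExpansion

variable {B s₀ s₁ : ℝ} {b : ℝ → ℝ} {U : ℝ → ℝ → ℝ}

/-- For large times, `1 - U_YY` is comparable to `b Y²` on `[0, 1]`. -/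
theorem one_sub_dY_two_bounds (hin : BoundaryLayerExpansion B s₀ s₁ b U) (hB : 0 < B)
    (hS : (64 * B + 1) ^ 8 ≤ s₀) {s : ℝ} (hs : s ∈ Icc s₀ s₁) (hb : 1 / (2 * s) ≤ b s)
    {Y : ℝ} (hY : Y ∈ Icc 0 1) :
    b s / 8 * Y ^ 2 ≤ 1 - dY 2 (U s) Y ∧ 1 - dY 2 (U s) Y ≤ 3 / 8 * b s * Y ^ 2 := by
  have hs0 : 0 < s := lt_of_lt_of_le (by positivity) (hS.trans hs.1)
  obtain ⟨x, hx, hxs⟩ := exists_eighth_root hs0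
  have hxB : 64 * B + 1 ≤ x :=
    le_of_pow_le_pow_left₀ (n := 8) (by norm_num) hx.le (by rw [hxs]; exact hS.trans hs.1)
  have hx1 : 1 ≤ x := by linarith
  have k := hin s hs x hx hxs Y ⟨hY.1, hY.2.trans (one_le_pow₀ hx1)⟩
  have hi0 : 0 < x⁻¹ := by positivity
  have hi1 : x⁻¹ ≤ 1 := inv_le_one_of_one_le₀ hx1
  have hBi : 64 * (B * x⁻¹) ≤ 1 := by
    rw [← div_eq_mul_inv, ← mul_div_assoc, div_le_one hx]; linarith
  have hxb : x⁻¹ ^ 8 ≤ 2 * b s := by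
    have := (div_le_iff₀ (by positivity)).1 hb
    rw [inv_pow, hxs, inv_le_iff_one_le_mul₀ hs0]
    linarith
  have hb0 : 0 < b s := lt_of_lt_of_le (by positivity) hb
  have hY1 : (1 + Y) ^ 2 ≤ 4 := by nlinarith [hY.1, hY.2]
  have hsmall : B * x⁻¹ ^ 13 * Y ^ 2 * (1 + Y) ^ 2 ≤ b s / 8 * Y ^ 2 := by
    calc B * x⁻¹ ^ 13 * Y ^ 2 * (1 + Y) ^ 2
        = B * x⁻¹ * x⁻¹ ^ 4 * x⁻¹ ^ 8 * (1 + Y) ^ 2 * Y ^ 2 := by ring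
      _ ≤ 1 / 64 * 1 * (2 * b s) * 4 * Y ^ 2 := by
          gcongr
          · linarith
          · exact pow_le_one₀ hi0.le hi1
      _ = b s / 8 * Y ^ 2 := by ring
  obtain ⟨k1, k2⟩ := abs_le.1 (k.trans hsmall)
  constructor <;> linarith

end BoundaryLayerExpansion

namespace IsRescaledSolution

variable {s₀ s₁ : ℝ} {b : ℝ → ℝ} {U : ℝ → ℝ → ℝ} {Uinf : ℝ → ℝ}

/-- Away from the wall, bounds on `1 - U_YY` propagate from the initial time and from `Y = 1`. -/
theorem one_sub_dY_two_le (h : IsRescaledSolution s₀ s₁ b U Uinf) (hlt : s₀ < s₁) (hs₀ : 0 < s₀)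
    (hb : ∀ s ∈ Icc s₀ s₁, 1 / (2 * s) ≤ b s ∧ b s ≤ 2)
    (hG : ∀ s ∈ Icc s₀ s₁, ∀ Y ≥ 0, 0 ≤ dY 1 (U s) Y)
    (hF : ∀ s ∈ Icc s₀ s₁, ∀ Y ≥ 0, dY 2 (U s) Y ≤ 1) {g : ℝ → ℝ}
    (hg : ∀ s ∈ Ioo s₀ s₁, HasDerivAt g (-(b s * g s)) s) (hgc : ContinuousOn g (Icc s₀ s₁))
    (hgb : ∀ s ∈ Icc s₀ s₁, b s / 2 ≤ g s ∧ g s ≤ 2 * b s) {m : ℝ} (hm : 1 ≤ m)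
    (hinit : ∀ Y ≥ 1, 1 - dY 2 (U s₀) Y ≤ m * min 1 (s₀⁻¹ * Y ^ 2))
    (hbdry : ∀ s ∈ Icc s₀ s₁, 1 - dY 2 (U s) 1 ≤ 3 / 8 * b s) :
    ∀ s ∈ Icc s₀ s₁, ∀ Y ≥ 1,
      1 - dY 2 (U s) Y ≤ 10 * m * b s * Y ^ 2 ∧ 1 - dY 2 (U s) Y ≤ m := by
  have hb0 : ∀ s ∈ Icc s₀ s₁, 0 < b s := fun s hs => by
    have : 0 < s := hs₀.trans_le hs.1
    exact lt_of_lt_of_le (by positivity) (hb s hs).1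
  have hg0 : ∀ s ∈ Icc s₀ s₁, 0 < g s := fun s hs => by
    have := hb0 s hs
    linarith [(hgb s hs).1]
  have hs₀I : s₀ ∈ Icc s₀ s₁ := ⟨le_rfl, hlt.le⟩
  have hsg : s₀⁻¹ ≤ 4 * g s₀ := by
    have h1 := (hb s₀ hs₀I).1
    have h2 := (hgb s₀ hs₀I).1
    rw [one_div, mul_inv] at h1
    linarith
  intro s hs Y hY
  have hY0 : (0 : ℝ) < Y := by linarith
  have hc : ContinuousOn (fun s => 1 - dY 2 (U s) Y) (Icc s₀ s₁) :=
    continuousOn_const.sub (h.continuousOn_dY_left (by norm_num) hY0.le)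
  constructor
  · refine forall_Icc_of_forall_Ico hlt (g := fun s => 10 * m * b s * Y ^ 2) hc
      ((continuousOn_const.mul h.b_continuousOn).mul continuousOn_const) ?_ s hs
    intro t ht
    -- Initially s₀⁻¹ ≤ 2b(s₀) ≤ 4g(s₀), and 5 makes the inequality strict. Returning to b costs g ≤
    -- 2b, whence the constant 10.
    have key := h.one_sub_dY_two_lt hlt hG hF hg hgc hg0 (α := 0) (κ := 5 * m) (Or.inl rfl)
      (by positivity) ?_ ?_ t ht Y hY
    · have h2 := (hgb t (Ico_subset_Icc_self ht)).2
      calc 1 - dY 2 (U t) Y ≤ 5 * m * g t * Y ^ 2 := by linarith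
        _ ≤ 5 * m * (2 * b t) * Y ^ 2 := by gcongr
        _ = _ := by ring
    · intro y hy
      have hy0 : (0 : ℝ) < y := by linarith
      have hpos : 0 < m * g s₀ * y ^ 2 := by
        have := hg0 s₀ hs₀I
        positivity
      calc 1 - dY 2 (U s₀) y ≤ m * min 1 (s₀⁻¹ * y ^ 2) := hinit y hy
        _ ≤ m * (s₀⁻¹ * y ^ 2) := by gcongr; exact min_le_right _ _
        _ ≤ m * (4 * g s₀ * y ^ 2) := by gcongr
        _ < 0 + 5 * m * g s₀ * y ^ 2 := by linarith
    · intro r hr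
      have h1 := hb0 r hr
      have h2 := (hgb r hr).1
      have h3 := hg0 r hr
      nlinarith [hbdry r hr]
  · refine forall_Icc_of_forall_Ico hlt (g := fun _ => m) hc continuousOn_const ?_ s hs
    intro t ht
    have hgt := hg0 t (Ico_subset_Icc_self ht)
    refine le_of_forall_pos_le_add fun δ hδ => ?_
    -- This κ makes the quadratic correction equal to δ at the point under consideration. At Y = 1
    -- the constant m ≥ 1 already dominates 3b/8 ≤ 3/4.
    have key := h.one_sub_dY_two_lt hlt hG hF hg hgc hg0 (α := m) (κ := δ / (g t * Y ^ 2))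
      (Or.inr hm) (by positivity) ?_ ?_ t ht Y hY
    · refine key.le.trans (le_of_eq ?_)
      field_simp
    · intro y hy
      have hy0 : (0 : ℝ) < y := by linarith
      have hpos : 0 < δ / (g t * Y ^ 2) * g s₀ * y ^ 2 := by
        have := hg0 s₀ hs₀I
        positivity
      calc 1 - dY 2 (U s₀) y ≤ m * min 1 (s₀⁻¹ * y ^ 2) := hinit y hy
        _ ≤ m * 1 := by gcongr; exact min_le_left _ _
        _ < _ := by linarith
    · intro r hr
      have hpos : 0 < δ / (g t * Y ^ 2) * g r := by
        have := hg0 r hr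
        positivity
      linarith [hbdry r hr, (hb r hr).2]

end IsRescaledSolution

end Prandtl

theorem mainTheorem4 :
    ∃ Mbar Cbar : ℝ, 0 < Mbar ∧ 0 < Cbar ∧
      ∀ χ Θ : ℝ → ℝ, Prandtl.IsCutoff χ → Prandtl.IsOuterProfile Θ →
      ∀ (C₁ β₁ : ℝ) (m₁ : ℕ), 0 < C₁ → 1 / 4 < β₁ → β₁ < 2 / 7 →
      ∃ S₀ : ℝ, 0 < S₀ ∧
      ∀ (a J η ε M₀ s₀ s₁ : ℝ) (b : ℝ → ℝ) (U : ℝ → ℝ → ℝ) (Uinf : ℝ → ℝ),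
        0 < a → a < 1 → 0 < J → 0 < η → 0 < ε → ε < 1 / 2 → s₀ < s₁ →
        max S₀ (Cbar * (J * ε ^ (-2 : ℤ)) ^ (1 / (2 * η))) ≤ s₀ →
        -- the solution, with increasing initial data
        Prandtl.IsRescaledSolution s₀ s₁ b U Uinf →
        MonotoneOn (U s₀) (Set.Ici 0) →
        -- the modulation bounds
        IntervalIntegrable (fun s => s ^ (3 + 2 * η) * (deriv b s + b s ^ 2) ^ 2)
          MeasureTheory.volume s₀ s₁ →
        (∫ s in s₀..s₁, s ^ (3 + 2 * η) * (deriv b s + b s ^ 2) ^ 2) ≤ J →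
        (∀ s ∈ Set.Icc s₀ s₁, (1 - ε) / s ≤ b s ∧ b s ≤ (1 + ε) / s) →
        -- the initial bounds
        (∀ Y > 0, -(M₀ * min 1 (s₀⁻¹ * Y ^ 2)) ≤ Prandtl.dY 2 (U s₀) Y - 1 ∧
          Prandtl.dY 2 (U s₀) Y - 1 ≤ 0) →
        Uinf s₀ ≤ M₀ * s₀ →
        -- the energy bound
        (∀ s ∈ Set.Icc s₀ s₁,
          Prandtl.E₁ χ Θ a β₁ m₁ b U s ≤ ENNReal.ofReal (C₁ * s ^ (-(13 / 4) : ℝ))) →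
        (∀ s ∈ Set.Icc s₀ s₁, ∀ Y ∈ Set.Icc 0 (s ^ (1 / 3 : ℝ)),
          -(Mbar * max 1 M₀ * b s * Y ^ 2) ≤ Prandtl.dY 2 (U s) Y - 1 ∧
            Prandtl.dY 2 (U s) Y - 1 ≤ 0) ∧
        (∀ s ∈ Set.Icc s₀ s₁, ∀ Y ≥ s ^ (1 / 3 : ℝ),
          -(Mbar * max 1 M₀) ≤ Prandtl.dY 2 (U s) Y - 1 ∧
            Prandtl.dY 2 (U s) Y - 1 ≤ 0) := by
  -- The constant 10 comes from the outer quadratic barrier; for Y ≤ 1 the constant 3/8 suffices.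
  refine ⟨10, 1, by norm_num, by norm_num, ?_⟩
  intro χ Θ hχ hΘ C₁ β₁ m₁ hC₁ hβ₁ _
  obtain ⟨S, B, hS1, hB, hlayer⟩ := Prandtl.exists_boundary_layer_estimate hχ hΘ m₁ hC₁ hβ₁
  obtain ⟨T, hrate⟩ := Prandtl.exists_comparison_rate hB
  refine ⟨max S (max T ((64 * B + 1) ^ 8)), lt_max_of_lt_left (by linarith), ?_⟩
  intro a J η ε M₀ s₀ s₁ b U Uinf ha0 ha1 _ _ _ hε hlt hs₀ h hmono _ _ hbε hinit _ hE
  obtain ⟨hSs, hTs, hBs⟩ : S ≤ s₀ ∧ T ≤ s₀ ∧ (64 * B + 1) ^ 8 ≤ s₀ := by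
    simpa only [max_le_iff] using (le_max_left _ _).trans hs₀
  have hs1 : 1 ≤ s₀ := hS1.trans hSs
  have hb : ∀ s ∈ Icc s₀ s₁, 1 / (2 * s) ≤ b s ∧ b s ≤ 2 / s := by
    intro s hs
    have hs0 : 0 < s := by linarith [hs.1]
    obtain ⟨h1, h2⟩ := hbε s hs
    refine ⟨le_trans ?_ h1, h2.trans ?_⟩
    · rw [← div_div]
      gcongr
      linarith
    · gcongr
      linarith
  have hb0 : ∀ s ∈ Icc s₀ s₁, 0 < b s := fun s hs => by
    have : 0 < s := by linarith [hs.1]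
    exact lt_of_lt_of_le (by positivity) (hb s hs).1
  have hb2 : ∀ s ∈ Icc s₀ s₁, b s ≤ 2 := fun s hs =>
    (hb s hs).2.trans (div_le_self (by norm_num) (hs1.trans hs.1))
  have hin : Prandtl.BoundaryLayerExpansion B s₀ s₁ b U :=
    hlayer a s₀ s₁ b U Uinf ha0 ha1 hSs hlt h (fun s hs => ⟨hb0 s hs, (hb s hs).2⟩) hE
  have hwall : ∀ s ∈ Icc s₀ s₁, ∀ Y ∈ Icc (0 : ℝ) 1, b s / 8 * Y ^ 2 ≤ 1 - Prandtl.dY 2 (U s) Y ∧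
      1 - Prandtl.dY 2 (U s) Y ≤ 3 / 8 * b s * Y ^ 2 := fun s hs Y hY =>
    hin.one_sub_dY_two_bounds hB hBs hs (hb s hs).1 hY
  have hone : (1 : ℝ) ∈ Icc (0 : ℝ) 1 := ⟨zero_le_one, le_rfl⟩
  have hG := h.dY_one_nonneg hlt (fun s hs => ⟨hb0 s hs, hb2 s hs⟩) hmono
  -- At Y = 1 the layer expansion gives the strict inequality U_YY ≤ 1 - b/8 < 1 needed as boundary
  -- datum.
  have hF1 := h.dY_two_le_one hlt hb0 hG (fun Y hY => by linarith [(hinit Y (by linarith)).2])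
    (fun s hs => by linarith [(hwall s hs 1 hone).1, hb0 s hs])
  have hF : ∀ s ∈ Icc s₀ s₁, ∀ Y ≥ 0, Prandtl.dY 2 (U s) Y ≤ 1 := by
    intro s hs Y hY
    rcases le_total 1 Y with hY1 | hY1
    · exact hF1 s hs Y hY1
    · have := hb0 s hs
      have : 0 ≤ b s / 8 * Y ^ 2 := by positivity
      linarith [(hwall s hs Y ⟨hY, hY1⟩).1]
  obtain ⟨g, hgc, hg, hgb⟩ := hrate s₀ s₁ b U Uinf hs1 hTs hlt h hb hin
  have hm : 1 ≤ max 1 M₀ := le_max_left _ _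
  have houter := h.one_sub_dY_two_le hlt (by linarith) (fun s hs => ⟨(hb s hs).1, hb2 s hs⟩)
    hG hF hg hgc hgb hm (fun Y hY => by
      have hmin : 0 ≤ min 1 (s₀⁻¹ * Y ^ 2) := le_min zero_le_one (by positivity)
      have := mul_le_mul_of_nonneg_right (le_max_right 1 M₀) hmin
      linarith [(hinit Y (by linarith)).1])
    (fun s hs => by linarith [(hwall s hs 1 hone).2])
  refine ⟨fun s hs Y hY => ⟨?_, by linarith [hF s hs Y hY.1]⟩, fun s hs Y hY => ?_⟩
  · rcases le_total 1 Y with hY1 | hY1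
    · linarith [(houter s hs Y hY1).1]
    · have hpos : 0 ≤ b s * Y ^ 2 := mul_nonneg (hb0 s hs).le (sq_nonneg Y)
      nlinarith [(hwall s hs Y ⟨hY.1, hY1⟩).2]
  · have hY1 : 1 ≤ Y := (Real.one_le_rpow (hs1.trans hs.1) (by norm_num)).trans hY
    exact ⟨by linarith [(houter s hs Y hY1).2], by linarith [hF1 s hs Y hY1]⟩
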